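/- Let $M_1, M_2$ be finite loopless matroids on groundsets $E_1,E_2$, with lattices of flats $\mathcal F(M_i)$ and rank functions $\operatorname{rk}_{M_i}$. Let $f\colon\mathcal F(M_1)\to\mathcal F(M_2)$ be a covering lattice map: $f$ is order preserving, $f(F)\neq\varnothing$ for $F\ne\varnothing$, $\operatorname{rk}_{M_2} f(F)\le \operatorname{rk}_{M_1}F$, and if $F$ covers $F'$, then $f(F)=f(F')$ or $f(F)$ covers $f(F')$. *Graph correspondence.* For $1\le i\le \operatorname{rk}M_1$ let $\gamma_i(f)$ be the function on the flats $(F_1,F_2)$ of $M_1\oplus M_2$ with value $0$ if $\operatorname{rk}_{M_2}(f(F_1)\cup F_2)+\operatorname{rk}M_1-i\ge \operatorname{rk}_{M_1}F_1+\operatorname{rk}_{M_2}F_2$ and $-1$ otherwise. View it as the rational function on the affine Bergman fan $B(M_1)\times B(M_2)=B(M_1\oplus M_2)$ in $\mathbb R^{E_1\sqcup E_2}$ that is linear on the cones of flags of flats, takes these values on the rays $e_{(F_1,F_2)}$ and is linear on the lineality space spanned by $(1,\dots,1)$. The graph correspondence $\Gamma_f=\gamma_{\operatorname{rk}M_1}(f)\cdots\gamma_1(f)\cdot(B(M_1)\times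 B(M_2))$ is the result of successively taking Weil divisors. *Flag fans.* Consider a pair $(\mathcal G,\omega)$ of a ranked poset $\mathcal G$ of subsets of a finite set $E$, with least element $\varnothing$ and greatest element $E$, such that $X\le_{\mathcal G}X'$ implies $X\subseteq X'$, and an integer weight $\omega$ on the edges (covering relations) of $\mathcal G$. Its Flag fan consists of the cones generated by $e_{F_1},\dots,e_{F_{r-1}},\pm e_E$ for the maximal flags $\varnothing=F_0\lessdot\dots\lessdot F_r=E$ of $\mathcal G$, with weights $\prod_i\omega(F_i,F_{i+1})$. The pair is called reduced if all edge weights are nonzero. *Weights.* For $X_1\le X_2$ in $\mathcal F(M_1)$ and $Y_1\in\mathcal F(M_2)$ with $f(X_1)\le Y_1$, let $\mathcal F(X_1,X_2,Y_1)$ be the subposet of all $F\in\mathcal F(M_1)$ with $X_1\le F\le X_2$ and $f(F)\le Y_1$, and put $\eta(X_1,X_2,Y_1)=\sum_{b}\mu(X_1,b)$, the sum over all $b$ in this subposet, where $\mu$ is the Möbius function of this subposet. Write $(X_1,Y_1)\to(X_2,Y_2)$ if $Y_1\lessdot Y_2$ in $\mathcal F(M_2)$, $f(X_1)\le Y_1$,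 $X_1\le X_2$ and $\eta(X_1,X_2,Y_1)\ne0$. **Theorem.** The graph correspondence $\Gamma_f$ is a (balanced) tropical fan of dimension $\operatorname{rk}M_2$, and it is the Flag fan of a reduced pair $(\mathcal G,\omega)$ with $$\omega\big((X_1,Y_1),(X_2,Y_2)\big)=\eta(X_1,X_2,Y_1)$$ for every edge. Moreover, for every reduced pair $(\mathcal G,\omega)$ whose Flag fan is $\Gamma_f$, the edges of $\mathcal G$ are exactly the pairs $(X_1,Y_1)\lessdot_{\mathcal G}(X_2,Y_2)$ such that $(X_1,Y_1)\to(X_2,Y_2)$ and $(E_1,E_2)$ can be reached from $(X_2,Y_2)$ by finitely many (possibly zero) steps $\to$; and the weights are the above ones up to rescaling at the vertices, i.e. there are nonzero rational numbers $c(v)$, $v\in\mathcal G$, with $c(\varnothing)=c(E_1\sqcup E_2)=1$ and $$c(X_1,Y_1)\,\omega\big((X_1,Y_1),(X_2,Y_2)\big)=\eta(X_1,X_2,Y_1)\,c(X_2,Y_2)$$ for every edge. -/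

import Mathlib

namespace TropGraph

open Set

/-! ### Tropical fans

The ambient space is `ℝ^ι = ℤ^ι ⊗ ℝ`. All cones are simplicial and unimodular, and a cone is given by
the finite set of its primitive lattice generators in `ℤ^ι`. -/

section Fans

variable {ι : Type*}

/-- A weighted collection of cones: a finitely supported integer weight on sets of generators.
The cones of the collection are those with nonzero weight. -/
abbrev Fan (ι : Type*) := Finset (ι → ℤ) →₀ ℤ

/-- The vector of `ℝ^ι` given by a lattice vector. -/
def toReal (v : ι → ℤ) : ι → ℝ := fun i => (v i : ℝ)

/-- The generators are linearly independent and generate the lattice `V_σ ∩ ℤ^ι`, where `V_σ` is the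
real span of the cone. (For a facet `τ` of `σ`, the generator of `σ` outside `τ` is then a primitive
normal vector `v_{σ/τ}`.) -/
def IsUnimodular (σ : Finset (ι → ℤ)) : Prop :=
  LinearIndependent ℝ (fun v : σ => toReal v.1) ∧
  ∀ w : ι → ℤ, toReal w ∈ Submodule.span ℝ (toReal '' (σ : Set (ι → ℤ))) →
    w ∈ Submodule.span ℤ (σ : Set (ι → ℤ))

open Classical in
/-- `∑_{σ ⊃ τ} ω(σ) g(v_{σ/τ})`, the sum over the cones `σ` having `τ` as a facet, where `v_{σ/τ}` is
the unique generator of `σ` outside `τ`. -/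
noncomputable def starSum {A : Type*} [AddCommGroup A] (X : Fan ι) (τ : Finset (ι → ℤ))
    (g : (ι → ℤ) → A) : A :=
  ∑ σ ∈ X.support with τ ⊂ σ ∧ σ.card = τ.card + 1, X σ • ∑ v ∈ σ \ τ, g v

/-- A tropical fan of dimension `k`: unimodular cones with `k` generators, satisfying the balancing
condition `∑_{σ ⊃ τ} ω(σ) v_{σ/τ} ∈ V_τ` at every `(k-1)`-dimensional face `τ`. -/
def IsTropicalFan (k : ℕ) (X : Fan ι) : Prop :=
  (∀ σ ∈ X.support, σ.card = k ∧ IsUnimodular σ) ∧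
  ∀ τ : Finset (ι → ℤ), τ.card + 1 = k →
    toReal (starSum X τ (fun v => v)) ∈ Submodule.span ℝ (toReal '' (τ : Set (ι → ℤ)))

open Classical in
/-- The linear extension of `φ|_τ`, evaluated at the lattice vector `w`; for unimodular `τ` it exists,
and its value is determined for `w ∈ V_τ`. -/
noncomputable def linExt (φ : (ι → ℤ) → ℤ) (τ : Finset (ι → ℤ)) (w : ι → ℤ) : ℤ :=
  if h : ∃ L : (ι → ℤ) →ₗ[ℤ] ℤ, ∀ v ∈ τ, L v = φ v then h.choose w else 0

open Classical in
/-- The Weil divisor `φ · X`. The rational function `φ`, linear on each cone, is given by its values on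
the primitive generators of the rays. The weight of `τ` is
`∑_{σ ⊃ τ} ω(σ) φ(v_{σ/τ}) - φ_τ (∑_{σ ⊃ τ} ω(σ) v_{σ/τ})`. -/
noncomputable def weilDivisor (φ : (ι → ℤ) → ℤ) (X : Fan ι) : Fan ι :=
  Finsupp.onFinset (X.support.biUnion Finset.powerset)
    (fun τ => starSum X τ φ - linExt φ τ (starSum X τ (fun v => v)))
    (by
      intro τ hτ
      by_contra hn
      apply hτ
      have key : ∀ g : (ι → ℤ) → ℤ, starSum X τ g = 0 := fun g =>
        Finset.sum_eq_zero fun σ hσ => by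
          rw [Finset.mem_filter] at hσ
          exact absurd (Finset.mem_biUnion.2 ⟨σ, hσ.1, Finset.mem_powerset.2 hσ.2.1.1⟩) hn
      have key' : starSum X τ (fun v => v) = 0 :=
        Finset.sum_eq_zero fun σ hσ => by
          rw [Finset.mem_filter] at hσ
          exact absurd (Finset.mem_biUnion.2 ⟨σ, hσ.1, Finset.mem_powerset.2 hσ.2.1.1⟩) hn
      rw [key, key']
      unfold linExt
      split_ifs <;> simp)

open Classical in
/-- The characteristic vector `e_S`. -/
noncomputable def chi (S : Set ι) : ι → ℤ := fun i => if i ∈ S then 1 else 0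

open Classical in
/-- Generators of the cone of a flag `C` of subsets of `ι` containing `ι`: the vectors `e_S` for
`S ∈ C`, `S ≠ ∅, ι`, together with `s e_ι`, where `s = ±1`. -/
noncomputable def flagCone [Finite ι] (C : Set (Set ι)) (s : ℤ) : Finset (ι → ℤ) :=
  (Set.toFinite (chi '' (C \ {univ}) ∪ {s • chi (univ : Set ι)})).toFinset.erase 0

open Classical in
/-- The positive and the negative cone of a flag, both with weight `w`. -/
noncomputable def flagCones [Finite ι] (C : Set (Set ι)) (w : ℤ) : Fan ι :=
  ∑ σ ∈ ({flagCone C 1, flagCone C (-1)} : Finset (Finset (ι → ℤ))), Finsupp.single σ w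

/-- A pair `(𝒢, ω)`: a ranked poset `𝒢` of subsets of `ι` with bottom `∅` and top `ι`, whose order
implies (but need not equal) inclusion, and integer weights `ω` on its covering relations (the values
of `weight` on other pairs are irrelevant). -/
structure FlagPair (ι : Type*) where
  carrier : Set (Set ι)
  order : PartialOrder carrier
  subset_of_le : ∀ S T : carrier, order.le S T → S.1 ⊆ T.1
  empty_mem : ∅ ∈ carrier
  univ_mem : univ ∈ carrier
  empty_le : ∀ S : carrier, order.le ⟨∅, empty_mem⟩ S
  le_univ : ∀ S : carrier, order.le S ⟨univ, univ_mem⟩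
  ranked : ∃ rk : carrier → ℕ, ∀ S T : carrier, @CovBy carrier order.toLT S T → rk T = rk S + 1
  weight : Set ι → Set ι → ℤ

/-- The elements of `𝒢`, with the order of `𝒢` (not the inclusion order). -/
def FlagPair.Vertex (P : FlagPair ι) : Type _ := {S : Set ι // S ∈ P.carrier}

instance (P : FlagPair ι) : PartialOrder P.Vertex := P.order

instance [Finite ι] (P : FlagPair ι) : Finite P.Vertex :=
  inferInstanceAs (Finite {S : Set ι // S ∈ P.carrier})

/-- The covering relation (edges) of `𝒢`. -/
def FlagPair.Edge (P : FlagPair ι) (S T : Set ι) : Prop :=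
  ∃ A B : P.Vertex, A.1 = S ∧ B.1 = T ∧ A ⋖ B

/-- All edge weights are nonzero. -/
def FlagPair.Reduced (P : FlagPair ι) : Prop := ∀ S T, P.Edge S T → P.weight S T ≠ 0

open Classical in
/-- The Flag fan of `(𝒢, ω)`: the cones of the maximal flags of `𝒢`, the weight of a cone being the
product of the weights of the edges of its flag. -/
noncomputable def FlagPair.flagFan [Finite ι] (P : FlagPair ι) : Fan ι :=
  letI : Fintype P.Vertex := Fintype.ofFinite _
  ∑ᶠ c : Flag P.Vertex, flagCones ((fun A : P.Vertex => A.1) '' (c : Set P.Vertex))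
    (∏ p : P.Vertex × P.Vertex with p.1 ∈ c ∧ p.2 ∈ c ∧ p.1 ⋖ p.2, P.weight p.1.1 p.2.1)

end Fans

/-! ### Lattice maps -/

section Matroids

variable {α β : Type*}

/-- The rank of a set in a matroid (of finite rank). -/
noncomputable def rk (M : Matroid α) (X : Set α) : ℕ := (M.eRk X).toNat

/-- The lattice of flats, ordered by inclusion. -/
abbrev Flats (M : Matroid α) := {F : Set α // M.IsFlat F}

instance (M : Matroid α) [M.Finite] : Finite (Flats M) := by
  refine Set.Finite.to_subtype (M.ground_finite.finite_subsets.subset ?_)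
  intro F hF
  exact Matroid.IsFlat.subset_ground hF

variable {M₁ : Matroid α} {M₂ : Matroid β}

/-- Weak lattice maps of lattices of flats. -/
structure IsWeakLatticeMap (f : Flats M₁ → Flats M₂) : Prop where
  monotone : Monotone f
  nonempty : ∀ F : Flats M₁, F.1 ≠ ∅ → (f F).1 ≠ ∅
  rk_le : ∀ F : Flats M₁, rk M₂ (f F).1 ≤ rk M₁ F.1

/-- Covering lattice maps. -/
structure IsCoveringLatticeMap (f : Flats M₁ → Flats M₂) : Prop extends IsWeakLatticeMap f where
  covering : ∀ F' F : Flats M₁, F' ⋖ F → f F' ⋖ f F ∨ f F = f F'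

/-! ### Graph correspondences -/

/-- The disjoint union of the two groundsets. -/
abbrev Ground (M₁ : Matroid α) (M₂ : Matroid β) := ↥M₁.E ⊕ ↥M₂.E

instance (M₁ : Matroid α) (M₂ : Matroid β) [M₁.Finite] [M₂.Finite] : Finite (Ground M₁ M₂) :=
  haveI : Finite ↥M₁.E := M₁.ground_finite.to_subtype
  haveI : Finite ↥M₂.E := M₂.ground_finite.to_subtype
  inferInstance

/-- The flat `F₁ ⊔ F₂` of `M₁ ⊕ M₂`, as a subset of the groundset. The flats of `M₁ ⊕ M₂` are the
pairs `(F₁, F₂)`, ordered componentwise. -/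
def pairSet (p : Flats M₁ × Flats M₂) : Set (Ground M₁ M₂) :=
  {s | Sum.elim (fun a : ↥M₁.E => (a : α) ∈ p.1.1) (fun b : ↥M₂.E => (b : β) ∈ p.2.1) s}

/-- The top flat `(E₁, E₂)`. -/
def topPair (M₁ : Matroid α) (M₂ : Matroid β) : Flats M₁ × Flats M₂ :=
  (⟨M₁.E, M₁.ground_isFlat⟩, ⟨M₂.E, M₂.ground_isFlat⟩)

/-- `B(M₁) × B(M₂) = B(M₁ ⊕ M₂)`, with the fan structure given by the maximal flags of flats of
`M₁ ⊕ M₂`; all weights are `1`. -/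
noncomputable def bergmanProduct (M₁ : Matroid α) (M₂ : Matroid β) [M₁.Finite] [M₂.Finite] :
    Fan (Ground M₁ M₂) :=
  ∑ᶠ c : Flag (Flats M₁ × Flats M₂), flagCones (pairSet '' (c : Set (Flats M₁ × Flats M₂))) 1

/-- The functions `γ_i(f)` on the flats of `M₁ ⊕ M₂`. -/
noncomputable def gammaFun (f : Flats M₁ → Flats M₂) (i : ℕ) (p : Flats M₁ × Flats M₂) : ℤ :=
  if (rk M₁ p.1.1 : ℤ) + rk M₂ p.2.1 ≤ rk M₂ ((f p.1).1 ∪ p.2.1) + rk M₁ M₁.E - i then 0 else -1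

open Classical in
/-- The rational function with values `g F` on the rays `e_F`, extended linearly to the lineality space:
its value on `-e_E` is `-g E`. -/
noncomputable def rayFun (g : Flats M₁ × Flats M₂ → ℤ) (v : Ground M₁ M₂ → ℤ) : ℤ :=
  if h : ∃ p : Flats M₁ × Flats M₂, v = chi (pairSet p) then g h.choose
  else if v = -chi univ then -g (topPair M₁ M₂) else 0

/-- `γ_i(f) ⋯ γ_1(f) · (B(M₁) × B(M₂))`. -/
noncomputable def graphStep [M₁.Finite] [M₂.Finite] (f : Flats M₁ → Flats M₂) :
    ℕ → Fan (Ground M₁ M₂)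
  | 0 => bergmanProduct M₁ M₂
  | i + 1 => weilDivisor (rayFun (gammaFun f (i + 1))) (graphStep f i)

/-- The graph correspondence `Γ_f`. -/
noncomputable def graphCorrespondence [M₁.Finite] [M₂.Finite] (f : Flats M₁ → Flats M₂) :
    Fan (Ground M₁ M₂) :=
  graphStep f (rk M₁ M₁.E)

open Classical in
/-- `η(x) = ∑_{b ≥ x} μ(x, b)` in a finite poset. -/
noncomputable def eta {P : Type*} [PartialOrder P] [Finite P] (x : P) : ℤ :=
  letI : Fintype P := Fintype.ofFinite P
  letI : LocallyFiniteOrder P := Fintype.toLocallyFiniteOrder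
  ∑ b : P with x ≤ b, IncidenceAlgebra.mu ℤ x b

/-- The subposet `ℱ(X₁, X₂, Y₁)` of the flats `F` of `M₁` with `X₁ ≤ F ≤ X₂` and `f F ≤ Y₁`. -/
abbrev Between (f : Flats M₁ → Flats M₂) (X₁ X₂ : Flats M₁) (Y₁ : Flats M₂) :=
  {F : Flats M₁ // X₁ ≤ F ∧ F ≤ X₂ ∧ f F ≤ Y₁}

open Classical in
/-- The number `η(X₁)` computed in `ℱ(X₁, X₂, Y₁)`, for `X₁ ≤ X₂` and `f X₁ ≤ Y₁`
(and `0` by convention if `X₁` does not lie in this subposet). -/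
noncomputable def edgeEta [M₁.Finite] (f : Flats M₁ → Flats M₂) (X₁ X₂ : Flats M₁) (Y₁ : Flats M₂) :
    ℤ :=
  if h : X₁ ≤ X₂ ∧ f X₁ ≤ Y₁ then eta (⟨X₁, le_rfl, h.1, h.2⟩ : Between f X₁ X₂ Y₁) else 0

/-- `Y₁ ⋖ Y₂`, `f X₁ ≤ Y₁`, `X₁ ≤ X₂`, and the weight `η(X₁)` is nonzero. -/
def GraphEdge [M₁.Finite] (f : Flats M₁ → Flats M₂) (p q : Flats M₁ × Flats M₂) : Prop :=
  p.2 ⋖ q.2 ∧ f p.1 ≤ p.2 ∧ p.1 ≤ q.1 ∧ edgeEta f p.1 q.1 p.2 ≠ 0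

end Matroids

end TropGraph

open TropGraph

/-!
Let `L` be the lattice of flats `(F₁, F₂)` of `M₁ ⊕ M₂`. Every intermediate fan of the construction
of `Γ_f` is described by a single function `ρ : L → ℕ`. For a monotone `ρ` with `ρ ⊥ = 0` which
grows by at most one under the join with the flat of one element (`IsRankLike`), `rankFan` is the
fan of all chains of flats mapped bijectively onto `{0, …, ρ ⊤}`, a chain being weighted by the
product of the numbers `pathEta ρ p q = ∑ μ(p, b)`, the sum over `b ∈ [p, q]` with `ρ b = ρ p`, over
its consecutive elements `p < q`.

*Balancing.* If `ρ q = ρ p + 2`, then for every element `i ∈ q \ p` the products `pathEta ρ p F *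
pathEta ρ F q`, over the `F ∋ i` between `p` and `q` with `ρ F = ρ p + 1`, add up to `pathEta ρ p
q`, independently of `i` (`sum_pathEta_mul_pathEta`). This follows from Weisner's theorem
(`sum_mob_sup`) for the closure operator `b ↦ b ∨ i`, and it says that the vectors `e_F` balance
modulo `e_p` and `e_q`; so `rankFan` is a tropical fan (`isTropicalFan_rankFan`).

*Divisors.* Let `U` be an upper set of flats, containing `⊤` but not `⊥`, such that `ρ` is strictly
increasing outside `U` and `ρ - 1_U` is monotone. Taking the Weil divisor of the function `-1` on
`U` and `0` elsewhere replaces `ρ` by `ρ - 1_U` (`weilDivisor_rankFan`). Only the chains whose gap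
`p < q` crosses into `U` have a nonzero coefficient, and there the coefficient is `pathEta` of the
lowered function by Möbius inversion (`IsLowering.pathEta_crossing`).

*The graph.* The fan `B(M₁) × B(M₂)` belongs to the rank function of `M₁ ⊕ M₂`, and `γ_i(f)` is `-1`
on the flats whose rank exceeds `ρ_f = rk (f F₁ ∪ F₂)` by more than `rk M₁ - i`. The successive
divisors therefore belong to the functions `min (rk, ρ_f + t)` for `t = rk M₁, …, 0`, whence `Γ_f =
rankFan ρ_f` (`graphCorrespondence_eq`). Covering maps are used to see that these functions are
rank-like and that `rk - ρ_f` is monotone.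

*The edges.* By Weisner's theorem for the join with `(∅, f X₁)`, a nonzero weight from `(X₁, Y₁)` to
a pair `(X₂, Y₂)` with `f X₂ ≤ Y₂` forces `f X₁ ≤ Y₁` (`map_le_of_pathEta_ne_zero`). Going down from
the top, all chains of nonzero weight thus consist of pairs with `f X ≤ Y`; between such pairs
`pathEta ρ_f` is the number `η` (`edgeEta_eq_pathEta`). So `Γ_f` is the Flag fan of the pairs on
paths of steps `→` from bottom to top (`flagFan_graphPair`). All pairs with `f X ≤ Y` are reached
from the bottom (`reach_bot`), which is why only reachability of the top matters.

*Uniqueness.* The cones of a Flag fan determine the maximal flags of a reduced pair, hence its edges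
as the consecutive members (`FlagPair.edge_of_flagFan_eq`), and the products of the weights along
maximal flags. Two weights with the same products differ by the rescaling by `c(v) = ∏ η⁻¹ ω`, the
product along a flag up to `v`: splicing two maximal flags along an edge shows that this product
does not depend on the flag (`exists_potential`, `FlagPair.exists_rescaling`).
-/

namespace TropGraph

/-! ### Möbius functions and closure operators -/

section Moebius

variable {L : Type*} [PartialOrder L] [Fintype L]

open Classical in
/-- The integral Möbius function of a finite poset. -/
noncomputable def mob (a b : L) : ℤ :=
  letI : LocallyFiniteOrder L := Fintype.toLocallyFiniteOrder
  IncidenceAlgebra.mu ℤ a b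

theorem mob_eq_mu [LocallyFiniteOrder L] [DecidableEq L] (a b : L) :
    mob a b = IncidenceAlgebra.mu ℤ a b := by
  unfold mob
  congr!
  exact Subsingleton.elim _ _

theorem mob_self (a : L) : mob a a = 1 := by
  classical
  simp [mob]

open Classical in
theorem sum_mob_right (a b : L) :
    ∑ x with a ≤ x ∧ x ≤ b, mob a x = if a = b then 1 else 0 := by
  let _ : LocallyFiniteOrder L := Fintype.toLocallyFiniteOrder
  rw [← IncidenceAlgebra.sum_Icc_mu_right (𝕜 := ℤ) a b]
  refine Finset.sum_congr (by ext; simp) fun x _ => mob_eq_mu a x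

open Classical in
theorem sum_mob_left (a b : L) :
    ∑ x with a ≤ x ∧ x ≤ b, mob x b = if a = b then 1 else 0 := by
  let _ : LocallyFiniteOrder L := Fintype.toLocallyFiniteOrder
  rw [← IncidenceAlgebra.sum_Icc_mu_left (𝕜 := ℤ) a b]
  refine Finset.sum_congr (by ext; simp) fun x _ => mob_eq_mu x b

open Classical in
theorem mob_of_lt {a b : L} (h : a < b) : mob a b = -∑ x with a ≤ x ∧ x < b, mob a x := by
  have h1 := sum_mob_right a b
  rw [if_neg h.ne] at h1
  have h2 : (Finset.univ.filter fun x => a ≤ x ∧ x ≤ b)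
      = insert b (Finset.univ.filter fun x => a ≤ x ∧ x < b) := by
    ext x
    simp only [Finset.mem_filter, Finset.mem_univ, true_and, Finset.mem_insert]
    constructor
    · rintro ⟨h3, h4⟩
      rcases h4.eq_or_lt with h5 | h5
      · exact Or.inl h5
      · exact Or.inr ⟨h3, h5⟩
    · rintro (rfl | h3)
      · exact ⟨h.le, le_rfl⟩
      · exact ⟨h3.1, h3.2.le⟩
  rw [h2, Finset.sum_insert (by simp)] at h1
  linarith

/-- The Möbius function is computed inside intervals. -/
theorem mob_orderEmbedding {P : Type*} [PartialOrder P] [Fintype P] (e : P ↪o L)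
    (he : ∀ (a b : P) (x : L), e a ≤ x → x ≤ e b → ∃ c, e c = x) (a b : P) (hab : a ≤ b) :
    mob (e a) (e b) = mob a b := by
  classical
  induction b using WellFoundedLT.induction with
  | ind b ih =>
    rcases hab.eq_or_lt with rfl | hlt
    · rw [mob_self, mob_self]
    · rw [mob_of_lt hlt, mob_of_lt (e.lt_iff_lt.2 hlt), neg_inj]
      symm
      refine Finset.sum_bij (fun x _ => e x) ?_ ?_ ?_ ?_
      · intro x hx
        simpa using hx
      · intro x _ y _ hxy
        exact e.injective hxy
      · intro y hy
        simp only [Finset.mem_filter, Finset.mem_univ, true_and] at hy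
        obtain ⟨c, rfl⟩ := he a b y hy.1 hy.2.le
        exact ⟨c, by simpa using hy, rfl⟩
      · intro x hx
        simp only [Finset.mem_filter, Finset.mem_univ, true_and] at hx
        exact (ih x hx.2 hx.1).symm

open Classical in
/-- **Weisner's theorem** for a closure operator `c` that moves `p`: the sum of `μ(p, b)` over the
elements `b` with a given closure vanishes. -/
theorem sum_mob_closure_fiber (c : ClosureOperator L) {p : L} (hp : c p ≠ p) (x : L) :
    ∑ b with p ≤ b ∧ c b = x, mob p b = 0 := by
  induction x using WellFoundedLT.induction with
  | ind x ih =>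
    by_cases hne : ∃ b, p ≤ b ∧ c b = x
    · obtain ⟨b₀, hb₀, rfl⟩ := hne
      have hpx : p ≠ c b₀ := by
        intro h
        apply hp
        conv_rhs => rw [h]
        rw [h, c.idempotent]
      have h1 := sum_mob_right p (c b₀)
      rw [if_neg hpx] at h1
      have hle : ∀ b, b ≤ c b₀ ↔ c b ≤ c b₀ := fun b =>
        ⟨fun h => by simpa using c.monotone h, fun h => (c.le_closure b).trans h⟩
      rw [← Finset.sum_fiberwise (s := Finset.univ.filter fun x => p ≤ x ∧ x ≤ c b₀) (g := c)] at h1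
      rw [Finset.sum_eq_single (c b₀)] at h1
      · rw [← h1, Finset.filter_filter]
        refine Finset.sum_congr ?_ fun _ _ => rfl
        ext b
        simp only [Finset.mem_filter, Finset.mem_univ, true_and]
        refine ⟨fun h => ⟨⟨h.1, (hle b).2 h.2.le⟩, h.2⟩, fun h => ⟨h.1.1, h.2⟩⟩
      · intro y _ hy
        rw [Finset.filter_filter]
        by_cases hlt : y < c b₀
        · rw [← ih y hlt]
          refine Finset.sum_congr ?_ fun _ _ => rfl
          ext b
          simp only [Finset.mem_filter, Finset.mem_univ, true_and]
          refine ⟨fun h => ⟨h.1.1, h.2⟩, fun h => ⟨⟨h.1, (hle b).2 (h.2.trans_le hlt.le)⟩, h.2⟩⟩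
        · refine Finset.sum_eq_zero fun b hb => ?_
          simp only [Finset.mem_filter, Finset.mem_univ, true_and] at hb
          exact absurd (lt_of_le_of_ne (hb.2 ▸ (hle b).1 hb.1.2) hy) hlt
      · simp
    · refine Finset.sum_eq_zero fun b hb => ?_
      simp only [Finset.mem_filter, Finset.mem_univ, true_and] at hb
      exact absurd ⟨b, hb⟩ hne

open Classical in
/-- A sum of `μ(p, b)` over a set of elements `b` that only depends on the closure of `b` vanishes. -/
theorem sum_mob_closure (c : ClosureOperator L) {p : L} (hp : c p ≠ p) (h : L → Prop) :
    ∑ b with p ≤ b ∧ h (c b), mob p b = 0 := by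
  rw [← Finset.sum_fiberwise (g := c)]
  refine Finset.sum_eq_zero fun x _ => ?_
  rw [Finset.filter_filter]
  by_cases hx : h x
  · rw [← sum_mob_closure_fiber c hp x]
    refine Finset.sum_congr ?_ fun _ _ => rfl
    ext b
    simp only [Finset.mem_filter, Finset.mem_univ, true_and]
    exact ⟨fun h' => ⟨h'.1.1, h'.2⟩, fun h' => ⟨⟨h'.1, h'.2 ▸ hx⟩, h'.2⟩⟩
  · refine Finset.sum_eq_zero fun b hb => ?_
    simp only [Finset.mem_filter, Finset.mem_univ, true_and] at hb
    exact absurd (hb.2 ▸ hb.1.2) hx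

open Classical in
/-- Weisner's theorem for the closure operator `b ↦ b ⊔ w`. -/
theorem sum_mob_sup {L : Type*} [Lattice L] [Fintype L] {p w : L} (hw : ¬ w ≤ p) (h : L → Prop) :
    ∑ b with p ≤ b ∧ h (b ⊔ w), mob p b = 0 := by
  let c : ClosureOperator L :=
    { toFun := fun b => b ⊔ w
      monotone' := fun _ _ h => sup_le_sup_right h w
      le_closure' := fun _ => le_sup_left
      idempotent' := fun b => by simp }
  exact sum_mob_closure c (fun h' => hw (sup_eq_left.1 h')) h

end Moebius

/-! ### Edge weights of a rank-like function -/

section PathEta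

variable {L : Type*} [Lattice L] [Fintype L]

open Classical in
/-- The weight of a pair `p ≤ q`: the sum of `μ(p, b)` over all `b ∈ [p, q]` with `ρ b = ρ p`. -/
noncomputable def pathEta (ρ : L → ℕ) (p q : L) : ℤ :=
  ∑ b with p ≤ b ∧ b ≤ q ∧ ρ b = ρ p, mob p b

open Classical in
/-- Möbius inversion inside the down-closed part of `[p, q]` on which `ρ` is constant. -/
theorem sum_pathEta {ρ : L → ℕ} (hρ : Monotone ρ) {p q : L} (hpq : p ≤ q) :
    ∑ F with p ≤ F ∧ F ≤ q ∧ ρ F = ρ p, pathEta ρ F q = 1 := by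
  calc ∑ F with p ≤ F ∧ F ≤ q ∧ ρ F = ρ p, pathEta ρ F q
      = ∑ F with p ≤ F ∧ F ≤ q ∧ ρ F = ρ p, ∑ b with F ≤ b ∧ b ≤ q ∧ ρ b = ρ p, mob F b := by
        refine Finset.sum_congr rfl fun F hF => ?_
        simp only [Finset.mem_filter, Finset.mem_univ, true_and] at hF
        rw [pathEta, hF.2.2]
    _ = ∑ b with b ≤ q ∧ ρ b = ρ p, ∑ F with p ≤ F ∧ F ≤ b, mob F b := by
        refine Finset.sum_comm' fun F b => ?_
        simp only [Finset.mem_filter, Finset.mem_univ, true_and]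
        constructor
        · rintro ⟨⟨h1, h2, h3⟩, h4, h5, h6⟩
          exact ⟨⟨h1, h4⟩, h5, h6⟩
        · rintro ⟨⟨h1, h4⟩, h5, h6⟩
          have := hρ h1
          have := hρ h4
          exact ⟨⟨h1, h4.trans h5, by omega⟩, h4, h5, h6⟩
    _ = 1 := by
        simp only [sum_mob_left]
        rw [Finset.sum_ite_eq, if_pos]
        simpa using hpq

theorem pathEta_eq_one {ρ : L → ℕ} {p q : L} (hpq : p ≤ q) (h : ∀ b, p < b → b ≤ q → ρ b ≠ ρ p) :
    pathEta ρ p q = 1 := by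
  classical
  rw [pathEta, ← mob_self p]
  rw [← Finset.sum_singleton (mob p) p]
  refine Finset.sum_congr ?_ fun _ _ => rfl
  ext b
  simp only [Finset.mem_filter, Finset.mem_univ, true_and, Finset.mem_singleton]
  constructor
  · rintro ⟨h1, h2, h3⟩
    by_contra h4
    exact h b (lt_of_le_of_ne h1 (Ne.symm h4)) h2 h3
  · rintro rfl
    exact ⟨le_rfl, hpq, rfl⟩

theorem pathEta_congr {ρ ρ' : L → ℕ} {p q : L}
    (h : ∀ b, p ≤ b → b ≤ q → (ρ b = ρ p ↔ ρ' b = ρ' p)) : pathEta ρ p q = pathEta ρ' p q := by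
  classical
  refine Finset.sum_congr ?_ fun _ _ => rfl
  ext b
  simp only [Finset.mem_filter, Finset.mem_univ, true_and]
  constructor
  · rintro ⟨h1, h2, h3⟩
    exact ⟨h1, h2, (h b h1 h2).1 h3⟩
  · rintro ⟨h1, h2, h3⟩
    exact ⟨h1, h2, (h b h1 h2).2 h3⟩

variable {ι : Type*} [BoundedOrder L]

/-- Monotone functions which grow by at most one under the join with a generator. -/
structure IsRankLike (at' : ι → L) (ρ : L → ℕ) : Prop where
  mono : Monotone ρ
  bot : ρ ⊥ = 0
  step : ∀ b i, ρ (b ⊔ at' i) ≤ ρ b + 1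

open Classical in
/-- A generator `i` of `[p, q]` outside `p` cuts out the same total weight, independently of `i`. -/
theorem sum_pathEta_mul_pathEta {at' : ι → L} {ρ : L → ℕ} (hρ : IsRankLike at' ρ)
    {p q : L} {i : ι} (hip : ¬ at' i ≤ p) (hiq : at' i ≤ q) :
    ∑ F with p ≤ F ∧ F ≤ q ∧ ρ F = ρ p + 1 ∧ at' i ≤ F, pathEta ρ p F * pathEta ρ F q
      = pathEta ρ p q := by
  -- the part of `pathEta ρ p q` where the join with the generator keeps the rank vanishes
  have h0 : ∑ b with p ≤ b ∧ (b ⊔ at' i ≤ q ∧ ρ (b ⊔ at' i) = ρ p), mob p b = 0 :=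
    (Finset.sum_congr (by ext; simp) fun _ _ => rfl).trans
      (sum_mob_sup hip fun x => x ≤ q ∧ ρ x = ρ p)
  have hR : pathEta ρ p q
      = ∑ b with p ≤ b ∧ b ≤ q ∧ ρ b = ρ p ∧ ρ (b ⊔ at' i) = ρ p + 1, mob p b := by
    rw [← sub_zero (pathEta ρ p q), ← h0, pathEta, sub_eq_iff_eq_add, ← Finset.sum_union]
    · refine Finset.sum_congr ?_ fun _ _ => rfl
      ext b
      simp only [Finset.mem_filter, Finset.mem_univ, true_and, Finset.mem_union]
      constructor
      · rintro ⟨h1, h2, h3⟩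
        have h4 := hρ.step b i
        have h5 := hρ.mono (le_sup_left : b ≤ b ⊔ at' i)
        rcases (by omega : ρ (b ⊔ at' i) = ρ p + 1 ∨ ρ (b ⊔ at' i) = ρ p) with h6 | h6
        · exact Or.inl ⟨h1, h2, h3, h6⟩
        · exact Or.inr ⟨h1, sup_le h2 hiq, h6⟩
      · rintro (⟨h1, h2, h3, h4⟩ | ⟨h1, h2, h3⟩)
        · exact ⟨h1, h2, h3⟩
        · have h5 := hρ.mono (le_sup_left : b ≤ b ⊔ at' i)
          exact ⟨h1, le_sup_left.trans h2, by have := hρ.mono h1; omega⟩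
    · rw [Finset.disjoint_filter]
      rintro b - ⟨_, _, _, h4⟩ ⟨_, _, h5⟩
      omega
  -- the inner sum over `F`, for fixed `b` and `c`
  have key : ∀ b, p ≤ b → ρ b = ρ p → ∀ c, c ≤ q → ρ c = ρ p + 1 →
      ∑ F with b ⊔ at' i ≤ F ∧ F ≤ c ∧ ρ F = ρ p + 1, mob F c =
      (if b ⊔ at' i = c then 1 else 0) -
        ∑ F with F ≤ c ∧ ρ F = ρ p ∧ b ⊔ at' i ≤ F, mob F c := by
    intro b hb hρb c hcq hρc
    rw [← sum_mob_left, eq_sub_iff_add_eq, ← Finset.sum_union]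
    · refine Finset.sum_congr ?_ fun _ _ => rfl
      ext F
      simp only [Finset.mem_filter, Finset.mem_univ, true_and, Finset.mem_union]
      constructor
      · rintro (⟨h1, h2, h3⟩ | ⟨h1, h2, h3⟩) <;> exact ⟨by assumption, by assumption⟩
      · rintro ⟨h1, h2⟩
        have h3 := hρ.mono h2
        have h4 := hρ.mono (le_sup_left.trans h1)
        rcases (by omega : ρ F = ρ p + 1 ∨ ρ F = ρ p) with h6 | h6
        · exact Or.inl ⟨h1, h2, h6⟩
        · exact Or.inr ⟨h2, h6, h1⟩
    · rw [Finset.disjoint_filter]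
      rintro b - ⟨_, _, h4⟩ ⟨_, h5, _⟩
      omega
  calc ∑ F with p ≤ F ∧ F ≤ q ∧ ρ F = ρ p + 1 ∧ at' i ≤ F, pathEta ρ p F * pathEta ρ F q
      = ∑ F, ∑ b, ∑ c, if (p ≤ F ∧ F ≤ q ∧ ρ F = ρ p + 1 ∧ at' i ≤ F) ∧
          (p ≤ b ∧ b ≤ F ∧ ρ b = ρ p) ∧ (F ≤ c ∧ c ≤ q ∧ ρ c = ρ F)
          then mob p b * mob F c else 0 := by
        rw [Finset.sum_filter]
        refine Finset.sum_congr rfl fun F _ => ?_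
        split_ifs with h
        · simp only [pathEta, Finset.sum_filter, Finset.sum_mul_sum]
          refine Finset.sum_congr rfl fun b _ => Finset.sum_congr rfl fun c _ => ?_
          by_cases hb : p ≤ b ∧ b ≤ F ∧ ρ b = ρ p
          · by_cases hc : F ≤ c ∧ c ≤ q ∧ ρ c = ρ F
            · rw [if_pos hb, if_pos hc, if_pos ⟨h, hb, hc⟩]
            · rw [if_neg hc, mul_zero, if_neg fun h' => hc h'.2.2]
          · rw [if_neg hb, zero_mul, if_neg fun h' => hb h'.2.1]
        · symm
          refine Finset.sum_eq_zero fun b _ => Finset.sum_eq_zero fun c _ => ?_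
          rw [if_neg fun h' => h h'.1]
    _ = ∑ c, ∑ b, ∑ F, if (p ≤ F ∧ F ≤ q ∧ ρ F = ρ p + 1 ∧ at' i ≤ F) ∧
          (p ≤ b ∧ b ≤ F ∧ ρ b = ρ p) ∧ (F ≤ c ∧ c ≤ q ∧ ρ c = ρ F)
          then mob p b * mob F c else 0 := by
        rw [Finset.sum_congr rfl fun F _ => Finset.sum_comm, Finset.sum_comm]
        exact Finset.sum_congr rfl fun c _ => Finset.sum_comm
    _ = ∑ c with c ≤ q ∧ ρ c = ρ p + 1, ∑ b with p ≤ b ∧ ρ b = ρ p, mob p b *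
          ∑ F with b ⊔ at' i ≤ F ∧ F ≤ c ∧ ρ F = ρ p + 1, mob F c := by
        rw [Finset.sum_filter]
        refine Finset.sum_congr rfl fun c _ => ?_
        split_ifs with hc
        · rw [Finset.sum_filter]
          refine Finset.sum_congr rfl fun b _ => ?_
          split_ifs with hb
          · rw [Finset.mul_sum, Finset.sum_filter]
            refine Finset.sum_congr rfl fun F _ => ?_
            refine if_congr ?_ rfl rfl
            constructor
            · rintro ⟨⟨h1, h2, h3, h4⟩, ⟨h5, h6, h7⟩, h8, h9, h10⟩
              exact ⟨sup_le h6 h4, h8, h3⟩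
            · rintro ⟨h1, h2, h3⟩
              exact ⟨⟨hb.1.trans (le_sup_left.trans h1), h2.trans hc.1, h3, le_sup_right.trans h1⟩,
                ⟨hb.1, le_sup_left.trans h1, hb.2⟩, h2, hc.1, by omega⟩
          · refine Finset.sum_eq_zero fun F _ => if_neg ?_
            rintro ⟨_, ⟨h5, h6, h7⟩, _⟩
            exact hb ⟨h5, h7⟩
        · refine Finset.sum_eq_zero fun b _ => Finset.sum_eq_zero fun F _ => if_neg ?_
          rintro ⟨h1, _, h2, h3, h4⟩
          exact hc ⟨h3, by omega⟩
    _ = ∑ c with c ≤ q ∧ ρ c = ρ p + 1, ∑ b with p ≤ b ∧ ρ b = ρ p,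
          mob p b * (if b ⊔ at' i = c then 1 else 0) := by
        refine Finset.sum_congr rfl fun c hc => ?_
        simp only [Finset.mem_filter, Finset.mem_univ, true_and] at hc
        rw [Finset.sum_congr rfl fun b hb => by
          simp only [Finset.mem_filter, Finset.mem_univ, true_and] at hb
          rw [key b hb.1 hb.2 c hc.1 hc.2, mul_sub]]
        rw [Finset.sum_sub_distrib, sub_eq_self]
        simp only [Finset.mul_sum]
        rw [Finset.sum_comm' (t' := Finset.univ.filter fun F => F ≤ c ∧ ρ F = ρ p)
          (s' := fun F => Finset.univ.filter fun b => p ≤ b ∧ b ⊔ at' i ≤ F)]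
        · refine Finset.sum_eq_zero fun F _ => ?_
          rw [← Finset.sum_mul]
          have h1 := sum_mob_sup hip (fun x => x ≤ F)
          rw [(Finset.sum_congr (by ext; simp) fun _ _ => rfl).trans h1, zero_mul]
        · intro b F
          simp only [Finset.mem_filter, Finset.mem_univ, true_and]
          constructor
          · rintro ⟨⟨h1, h2⟩, h3, h4, h5⟩
            exact ⟨⟨h1, h5⟩, h3, h4⟩
          · rintro ⟨⟨h1, h5⟩, h3, h4⟩
            refine ⟨⟨h1, ?_⟩, h3, h4, h5⟩
            have := hρ.mono h1
            have := hρ.mono (le_sup_left.trans h5)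
            omega
    _ = pathEta ρ p q := by
        rw [hR, Finset.sum_comm' (t' := Finset.univ.filter fun b => p ≤ b ∧ ρ b = ρ p)
          (s' := fun b => Finset.univ.filter fun c => c ≤ q ∧ ρ c = ρ p + 1)
          (by intros; simp only [Finset.mem_filter, Finset.mem_univ, true_and])]
        rw [Finset.sum_filter, Finset.sum_filter]
        refine Finset.sum_congr rfl fun b _ => ?_
        rw [← Finset.mul_sum, Finset.sum_ite_eq]
        simp only [Finset.mem_filter, Finset.mem_univ, true_and]
        by_cases hb : p ≤ b ∧ ρ b = ρ p
        · rw [if_pos hb]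
          by_cases h1 : b ⊔ at' i ≤ q ∧ ρ (b ⊔ at' i) = ρ p + 1
          · rw [if_pos h1, if_pos ⟨hb.1, le_sup_left.trans h1.1, hb.2, h1.2⟩, mul_one]
          · rw [if_neg h1, if_neg, mul_zero]
            rintro ⟨_, h3, _, h4⟩
            exact h1 ⟨sup_le h3 hiq, h4⟩
        · rw [if_neg hb, if_neg]
          rintro ⟨h2, _, h3, _⟩
          exact hb ⟨h2, h3⟩

end PathEta

/-! ### Maximal flags of ranked posets -/

section FullChains

variable {V : Type*} [PartialOrder V]

theorem strictMono_of_covBy [Finite V] {ρ : V → ℕ} (h : ∀ x y, x ⋖ y → ρ y = ρ x + 1) :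
    StrictMono ρ := by
  classical
  let _ : Fintype V := Fintype.ofFinite V
  let _ : LocallyFiniteOrder V := Fintype.toLocallyFiniteOrder
  rw [strictMono_iff_forall_covBy]
  intro a b hab
  rw [h a b hab]
  exact Nat.lt_succ_self _

variable [BoundedOrder V]

/-- A chain from `⊥` to `⊤` on which `ρ` takes every value between `0` and `ρ ⊤` exactly once. -/
structure IsFull (ρ : V → ℕ) (C : Set V) : Prop where
  chain : IsChain (· ≤ ·) C
  bot_mem : ⊥ ∈ C
  top_mem : ⊤ ∈ C
  inj : Set.InjOn ρ C
  surj : ∀ j ≤ ρ ⊤, ∃ x ∈ C, ρ x = j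

/-- A grading of a bounded poset: it starts at `0` and grows by one along covering pairs. -/
structure IsRanking (ρ : V → ℕ) : Prop where
  bot : ρ ⊥ = 0
  covBy : ∀ x y, x ⋖ y → ρ y = ρ x + 1

theorem IsRanking.strictMono [Finite V] {ρ : V → ℕ} (h : IsRanking ρ) : StrictMono ρ :=
  strictMono_of_covBy h.covBy

theorem IsFull.lt_of_lt {ρ : V → ℕ} (hρ : Monotone ρ) {C : Set V} (hC : IsFull ρ C) {x y : V}
    (hx : x ∈ C) (hy : y ∈ C) (h : ρ x < ρ y) : x < y := by
  rcases hC.chain.total hx hy with h1 | h1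
  · exact lt_of_le_of_ne h1 (by rintro rfl; exact lt_irrefl _ h)
  · exact absurd (hρ h1) (not_le.2 h)

theorem IsFull.le_of_le {ρ : V → ℕ} (hρ : Monotone ρ) {C : Set V} (hC : IsFull ρ C) {x y : V}
    (hx : x ∈ C) (hy : y ∈ C) (h : ρ x ≤ ρ y) : x ≤ y := by
  rcases h.eq_or_lt with h | h
  · exact (hC.inj hx hy h).le
  · exact (hC.lt_of_lt hρ hx hy h).le

theorem IsFull.ncard_eq {ρ : V → ℕ} (hρ : Monotone ρ)
    {C : Set V} (hC : IsFull ρ C) : C.ncard = ρ ⊤ + 1 := by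
  have : ρ '' C = Set.Iic (ρ ⊤) := by
    ext j
    constructor
    · rintro ⟨x, _, rfl⟩
      exact hρ le_top
    · intro hj
      obtain ⟨x, hx, hxj⟩ := hC.surj j hj
      exact ⟨x, hx, hxj⟩
  rw [← hC.inj.ncard_image, this, Set.ncard_eq_toFinset_card']
  simp

theorem IsFull.isMaxChain [Finite V] {ρ : V → ℕ} (hρ : IsRanking ρ) {C : Set V}
    (hC : IsFull ρ C) : IsMaxChain (· ≤ ·) C := by
  refine ⟨hC.chain, fun D hD hCD => Set.Subset.antisymm hCD fun x hx => ?_⟩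
  obtain ⟨y, hy, hyx⟩ := hC.surj (ρ x) (hρ.strictMono.monotone le_top)
  rcases hD.total hx (hCD hy) with h | h
  · rcases h.eq_or_lt with rfl | h
    · exact hy
    · exact absurd (hρ.strictMono h) (by omega)
  · rcases h.eq_or_lt with rfl | h
    · exact hy
    · exact absurd (hρ.strictMono h) (by omega)

theorem isFull_of_flag [Finite V] {ρ : V → ℕ} (hρ : IsRanking ρ) (c : Flag V) :
    IsFull ρ (c : Set V) := by
  refine ⟨c.chain_le, c.bot_mem, c.top_mem, ?_, ?_⟩
  · intro x hx y hy hxy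
    rcases c.le_or_le hx hy with h | h
    · rcases h.eq_or_lt with h | h
      · exact h
      · exact absurd (hρ.strictMono h) (by omega)
    · rcases h.eq_or_lt with h | h
      · exact h.symm
      · exact absurd (hρ.strictMono h) (by omega)
  · intro j hj
    -- the largest element of rank at most `j`, and the next one, form a covering pair
    obtain ⟨x, ⟨hxc, hxj⟩, hx⟩ := Set.Finite.exists_maximalFor ρ {x | x ∈ c ∧ ρ x ≤ j}
      (Set.toFinite _) ⟨⊥, c.bot_mem, by rw [hρ.bot]; exact Nat.zero_le _⟩
    refine ⟨x, hxc, ?_⟩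
    by_contra hne
    have hlt : ρ x < j := by omega
    obtain ⟨y, ⟨hyc, hyj⟩, hy⟩ := Set.Finite.exists_minimalFor ρ {y | y ∈ c ∧ ρ x < ρ y}
      (Set.toFinite _) ⟨⊤, c.top_mem, by omega⟩
    have hxy : x < y := by
      rcases c.le_or_le hxc hyc with h | h
      · exact lt_of_le_of_ne h (by rintro rfl; exact lt_irrefl _ hyj)
      · exact absurd (hρ.strictMono.monotone h) (not_le.2 hyj)
    have hyj' : j < ρ y := by
      by_contra h
      have := hx ⟨hyc, not_lt.1 h⟩ hyj.le
      omega
    have hcov : x ⋖ y := by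
      refine ⟨hxy, fun z hxz hzy => ?_⟩
      have hzc : z ∈ c := by
        have hch : IsChain (· ≤ ·) (insert z (c : Set V)) := by
          refine c.chain_le.insert fun w hw _ => ?_
          rcases lt_or_ge (ρ x) (ρ w) with h | h
          · left
            rcases c.le_or_le hyc hw with h' | h'
            · exact hzy.le.trans h'
            · have := hy ⟨hw, h⟩ (hρ.strictMono.monotone h')
              rcases h'.eq_or_lt with rfl | h''
              · exact hzy.le
              · exact absurd (hρ.strictMono h'') (by omega)
          · right
            rcases c.le_or_le hw hxc with h' | h'
            · exact h'.trans hxz.le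
            · rcases h'.eq_or_lt with rfl | h''
              · exact hxz.le
              · exact absurd (hρ.strictMono h'') (by omega)
        have := c.maxChain.2 hch (Set.subset_insert _ _)
        rw [← SetLike.mem_coe, this]
        exact Set.mem_insert _ _
      have h1 := hρ.strictMono hxz
      have h2 := hρ.strictMono hzy
      have := hy ⟨hzc, h1⟩ h2.le
      omega
    have := hρ.covBy x y hcov
    omega

open Classical in
/-- The maximal flags of a graded poset are the full chains. -/
theorem finsum_flag [Finite V] {ρ : V → ℕ} (hρ : IsRanking ρ) {A : Type*} [AddCommMonoid A]
    (g : Set V → A) :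
    ∑ᶠ c : Flag V, g c = ∑ᶠ C : Set V, if IsFull ρ C then g C else 0 := by
  have h := finsum_mem_range (f := g) (g := fun c : Flag V => (c : Set V)) SetLike.coe_injective
  rw [← h]
  refine finsum_congr fun C => ?_
  rw [finsum_eq_if]
  refine if_congr ?_ rfl rfl
  constructor
  · rintro ⟨c, rfl⟩
    exact isFull_of_flag hρ c
  · intro hC
    exact ⟨Flag.ofIsMaxChain C (hC.isMaxChain hρ), rfl⟩

theorem IsFull.covBy_iff [Finite V] {ρ : V → ℕ} (hρ : IsRanking ρ) {C : Set V} (hC : IsFull ρ C)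
    {x y : V} (hx : x ∈ C) (hy : y ∈ C) : x ⋖ y ↔ ρ y = ρ x + 1 := by
  refine ⟨hρ.covBy x y, fun h => ⟨hC.lt_of_lt hρ.strictMono.monotone hx hy (by omega), ?_⟩⟩
  intro z hxz hzy
  have h1 := hρ.strictMono hxz
  have h2 := hρ.strictMono hzy
  omega

/-- A full chain through `p` can be continued above `p` by the part of another full chain above an
element `q` covering `p`. -/
theorem IsFull.splice [Finite V] {ρ : V → ℕ} (hρ : IsRanking ρ) {C D : Set V} (hC : IsFull ρ C)
    (hD : IsFull ρ D) {p q : V} (hp : p ∈ C) (hq : q ∈ D) (hpq : p ⋖ q) :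
    IsFull ρ ({x | x ∈ C ∧ x ≤ p} ∪ {x | x ∈ D ∧ q ≤ x}) := by
  have hmono := hρ.strictMono.monotone
  have hr := hρ.covBy p q hpq
  refine ⟨?_, Or.inl ⟨hC.bot_mem, bot_le⟩, Or.inr ⟨hD.top_mem, le_top⟩, ?_, ?_⟩
  · rintro x (⟨hx, hxp⟩ | ⟨hx, hxq⟩) y (⟨hy, hyp⟩ | ⟨hy, hyq⟩) _
    · exact hC.chain.total hx hy
    · exact Or.inl (hxp.trans (hpq.le.trans hyq))
    · exact Or.inr (hyp.trans (hpq.le.trans hxq))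
    · exact hD.chain.total hx hy
  · rintro x (⟨hx, hxp⟩ | ⟨hx, hxq⟩) y (⟨hy, hyp⟩ | ⟨hy, hyq⟩) hxy
    · exact hC.inj hx hy hxy
    · have := hmono hxp
      have := hmono hyq
      omega
    · have := hmono hyp
      have := hmono hxq
      omega
    · exact hD.inj hx hy hxy
  · intro j hj
    by_cases h : j ≤ ρ p
    · obtain ⟨x, hx, rfl⟩ := hC.surj j hj
      exact ⟨x, Or.inl ⟨hx, hC.le_of_le hmono hx hp h⟩, rfl⟩
    · obtain ⟨x, hx, rfl⟩ := hD.surj j hj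
      exact ⟨x, Or.inr ⟨hx, hD.le_of_le hmono hq hx (by omega)⟩, rfl⟩

open Classical in
/-- If the edge weights `r` of a ranked poset have product `1` along every maximal flag, they are the
quotients of a function on the vertices: the product of the edge weights from `⊥` up to a vertex. -/
theorem exists_potential [Fintype V] {ρ : V → ℕ} (hρ : IsRanking ρ) (r : V → V → ℚ)
    (hr : ∀ x y, x ⋖ y → r x y ≠ 0)
    (hprod : ∀ c : Flag V, ∏ x : V × V with x.1 ∈ c ∧ x.2 ∈ c ∧ x.1 ⋖ x.2, r x.1 x.2 = 1) :
    ∃ c : V → ℚ, c ⊥ = 1 ∧ c ⊤ = 1 ∧ (∀ x, c x ≠ 0) ∧ ∀ x y, x ⋖ y → c x * r x y = c y := by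
  have hmono := hρ.strictMono.monotone
  have hex : ∀ v : V, ∃ C : Flag V, v ∈ C := fun v => by
    obtain ⟨C, hC⟩ := (Set.subsingleton_singleton (a := v)).isChain.exists_subset_flag
    exact ⟨C, hC (Set.mem_singleton v)⟩
  choose C hC using hex
  refine ⟨fun v => ∏ x : V × V with (x.1 ∈ C v ∧ x.2 ∈ C v ∧ x.1 ⋖ x.2) ∧ x.2 ≤ v, r x.1 x.2,
    ?_, ?_, ?_, ?_⟩
  · refine Finset.prod_eq_one fun x hx => ?_
    simp only [Finset.mem_filter, Finset.mem_univ, true_and] at hx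
    exact absurd (hx.1.2.2.lt.trans_le hx.2) not_lt_bot
  · simp only [le_top, and_true]
    exact hprod (C ⊤)
  · intro v
    refine Finset.prod_ne_zero_iff.2 fun x hx => ?_
    simp only [Finset.mem_filter, Finset.mem_univ, true_and] at hx
    exact hr _ _ hx.1.2.2
  · intro p q hpq
    have hCp := isFull_of_flag hρ (C p)
    have hCq := isFull_of_flag hρ (C q)
    have hpr := hρ.covBy p q hpq
    set t : ℚ := ∏ x : V × V with (x.1 ∈ C q ∧ x.2 ∈ C q ∧ x.1 ⋖ x.2) ∧ ¬ x.2 ≤ q, r x.1 x.2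
    have ht : t ≠ 0 := by
      refine Finset.prod_ne_zero_iff.2 fun x hx => ?_
      simp only [Finset.mem_filter, Finset.mem_univ, true_and] at hx
      exact hr _ _ hx.1.2.2
    have h1 : (∏ x : V × V with (x.1 ∈ C q ∧ x.2 ∈ C q ∧ x.1 ⋖ x.2) ∧ x.2 ≤ q, r x.1 x.2) * t
        = 1 := by
      have h := Finset.prod_filter_mul_prod_filter_not
        (Finset.univ.filter fun x : V × V => x.1 ∈ C q ∧ x.2 ∈ C q ∧ x.1 ⋖ x.2)
        (fun x => x.2 ≤ q) (fun x => r x.1 x.2)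
      rwa [Finset.filter_filter, Finset.filter_filter, hprod] at h
    have h2 : (∏ x : V × V with (x.1 ∈ C p ∧ x.2 ∈ C p ∧ x.1 ⋖ x.2) ∧ x.2 ≤ p, r x.1 x.2) *
        r p q * t = 1 := by
      have hD := hCp.splice hρ hCq (hC p) (hC q) hpq
      set D := Flag.ofIsMaxChain _ (hD.isMaxChain hρ)
      have h3 := Finset.prod_filter_mul_prod_filter_not
        (Finset.univ.filter fun x : V × V => x.1 ∈ D ∧ x.2 ∈ D ∧ x.1 ⋖ x.2)
        (fun x => x.2 ≤ q) (fun x => r x.1 x.2)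
      have h4 := Finset.prod_filter_mul_prod_filter_not
        (Finset.univ.filter fun x : V × V => (x.1 ∈ D ∧ x.2 ∈ D ∧ x.1 ⋖ x.2) ∧ x.2 ≤ q)
        (fun x => x.2 ≤ p) (fun x => r x.1 x.2)
      rw [Finset.filter_filter, Finset.filter_filter, hprod] at h3
      rw [Finset.filter_filter, Finset.filter_filter] at h4
      rw [← h3, ← h4]
      have hmem : ∀ x, x ∈ D ↔ (x ∈ C p ∧ x ≤ p) ∨ (x ∈ C q ∧ q ≤ x) := fun x => Iff.rfl
      have hqp : ¬ q ≤ p := not_le_of_gt hpq.lt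
      congr 1
      · congr 1
        · refine Finset.prod_congr ?_ fun _ _ => rfl
          ext ⟨x, y⟩
          simp only [Finset.mem_filter, Finset.mem_univ, true_and, hmem]
          constructor
          · rintro ⟨⟨hx, hy, hxy⟩, hyp⟩
            exact ⟨⟨⟨Or.inl ⟨hx, hxy.le.trans hyp⟩, Or.inl ⟨hy, hyp⟩, hxy⟩, hyp.trans hpq.le⟩, hyp⟩
          · rintro ⟨⟨⟨hx, hy, hxy⟩, -⟩, hyp⟩
            refine ⟨⟨?_, ?_, hxy⟩, hyp⟩
            · rcases hx with hx | hx
              · exact hx.1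
              · exact absurd (hx.2.trans (hxy.le.trans hyp)) hqp
            · rcases hy with hy | hy
              · exact hy.1
              · exact absurd (hy.2.trans hyp) hqp
        · rw [← Finset.prod_singleton (fun x : V × V => r x.1 x.2) (p, q)]
          refine Finset.prod_congr ?_ fun _ _ => rfl
          ext ⟨x, y⟩
          simp only [Finset.mem_filter, Finset.mem_univ, true_and, hmem, Finset.mem_singleton,
            Prod.mk.injEq]
          constructor
          · rintro ⟨rfl, rfl⟩
            exact ⟨⟨⟨Or.inl ⟨hC x, le_rfl⟩, Or.inr ⟨hC y, le_rfl⟩, hpq⟩, le_rfl⟩, hqp⟩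
          · rintro ⟨⟨⟨hx, hy, hxy⟩, hyq⟩, hyp⟩
            have hyq' : y = q := by
              rcases hy with hy | hy
              · exact absurd hy.2 hyp
              · exact le_antisymm hyq hy.2
            subst hyq'
            refine ⟨?_, rfl⟩
            rcases hx with hx | hx
            · have := hρ.covBy x y hxy
              exact hCp.inj hx.1 (hC p) (by omega)
            · exact absurd hxy.lt (not_lt_of_ge hx.2)
      · refine Finset.prod_congr ?_ fun _ _ => rfl
        ext ⟨x, y⟩
        simp only [Finset.mem_filter, Finset.mem_univ, true_and, hmem]
        constructor
        · rintro ⟨⟨hx, hy, hxy⟩, hyq⟩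
          have hqy : q ≤ y := ((C q).le_or_le hy (hC q)).resolve_left hyq
          have hqx : q ≤ x := by
            rcases (C q).le_or_le hx (hC q) with h | h
            · rcases h.eq_or_lt with rfl | h
              · exact le_rfl
              · exact absurd (lt_of_le_of_ne hqy (by rintro rfl; exact hyq le_rfl)) (hxy.2 h)
            · exact h
          exact ⟨⟨Or.inr ⟨hx, hqx⟩, Or.inr ⟨hy, hqy⟩, hxy⟩, hyq⟩
        · rintro ⟨⟨hx, hy, hxy⟩, hyq⟩
          have hy' : y ∈ C q ∧ q ≤ y := by
            rcases hy with hy | hy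
            · exact absurd (hy.2.trans hpq.le) hyq
            · exact hy
          refine ⟨⟨?_, hy'.1, hxy⟩, hyq⟩
          rcases hx with hx | hx
          · have h3 := hmono hx.2
            have h4 := hρ.covBy x y hxy
            have h5 : q = y := hCq.inj (hC q) hy'.1 (by have := hmono hy'.2; omega)
            exact absurd h5.ge hyq
          · exact hx.1
    exact mul_right_cancel₀ ht (h2.trans h1.symm)

end FullChains

open Set

/-! ### Cones of flags -/

section Cones

variable {ι : Type*}

theorem chi_apply_mem {S : Set ι} {i : ι} (h : i ∈ S) : chi S i = 1 := if_pos h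

theorem chi_apply_notMem {S : Set ι} {i : ι} (h : i ∉ S) : chi S i = 0 := if_neg h

theorem chi_injective : Function.Injective (chi : Set ι → ι → ℤ) := by
  intro S T h
  ext i
  have := congrFun h i
  by_cases h1 : i ∈ S <;> by_cases h2 : i ∈ T <;> simp_all [chi]

theorem chi_empty : chi (∅ : Set ι) = 0 := by
  ext i
  simp [chi]

open Classical in
/-- The generator of the ray of `S` in the cones of sign `s`: it is `e_S`, except that the generator
of the lineality direction carries the sign. -/
noncomputable def rayVec (s : ℤ) (S : Set ι) : ι → ℤ := if S = univ then s • chi univ else chi S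

theorem rayVec_univ (s : ℤ) : rayVec s (univ : Set ι) = s • chi univ := if_pos rfl

theorem rayVec_of_ne {s : ℤ} {S : Set ι} (h : S ≠ univ) : rayVec s S = chi S := if_neg h

open Classical in
theorem rayVec_eq_smul (s : ℤ) (S : Set ι) :
    rayVec s S = (if S = univ then s else 1) • chi S := by
  unfold rayVec
  split_ifs with h
  · rw [h]
  · rw [one_smul]

theorem chi_eq_smul_rayVec {s : ℤ} (hs : s = 1 ∨ s = -1) (S : Set ι) :
    ∃ c : ℤ, chi S = c • rayVec s S := by
  classical
  refine ⟨if S = univ then s else 1, ?_⟩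
  rw [rayVec_eq_smul, smul_smul]
  rcases hs with rfl | rfl <;> split_ifs <;> simp

theorem chi_ne_smul_univ {s : ℤ} (hs : s = 1 ∨ s = -1) {S : Set ι} (hS : S ≠ univ) :
    chi S ≠ s • chi univ := by
  intro h
  apply hS
  rw [eq_univ_iff_forall]
  intro i
  by_contra hi
  have := congrFun h i
  rw [chi_apply_notMem hi] at this
  rcases hs with rfl | rfl <;> simp [chi] at this

theorem rayVec_injective {s : ℤ} (hs : s = 1 ∨ s = -1) :
    Function.Injective (rayVec s : Set ι → ι → ℤ) := by
  intro S T h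
  by_cases hS : S = univ
  · by_cases hT : T = univ
    · rw [hS, hT]
    · rw [hS, rayVec_univ, rayVec_of_ne hT] at h
      exact absurd h.symm (chi_ne_smul_univ hs hT)
  · by_cases hT : T = univ
    · rw [hT, rayVec_univ, rayVec_of_ne hS] at h
      exact absurd h (chi_ne_smul_univ hs hS)
    · rw [rayVec_of_ne hS, rayVec_of_ne hT] at h
      exact chi_injective h

variable [Nonempty ι]

theorem smul_univ_inj {s s' : ℤ} (h : s • chi (univ : Set ι) = s' • chi univ) : s = s' := by
  obtain ⟨i⟩ := ‹Nonempty ι›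
  simpa [chi] using congrFun h i

theorem rayVec_empty (s : ℤ) : rayVec s (∅ : Set ι) = 0 := by
  rw [rayVec_of_ne empty_ne_univ, chi_empty]

theorem rayVec_ne_zero {s : ℤ} (hs : s = 1 ∨ s = -1) {S : Set ι} (hS : S ≠ ∅) :
    rayVec s S ≠ 0 := by
  rw [← rayVec_empty s]
  exact fun h => hS (rayVec_injective hs h)

variable [Finite ι]

theorem mem_flagCone {C : Set (Set ι)} (hC : univ ∈ C) {s : ℤ} (hs : s = 1 ∨ s = -1)
    {v : ι → ℤ} : v ∈ flagCone C s ↔ ∃ S ∈ C, S ≠ ∅ ∧ rayVec s S = v := by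
  classical
  simp only [flagCone, Finset.mem_erase, Set.Finite.mem_toFinset, Set.mem_union, Set.mem_image,
    Set.mem_sdiff, Set.mem_singleton_iff]
  constructor
  · rintro ⟨h0, ⟨S, ⟨hS, hSu⟩, rfl⟩ | rfl⟩
    · exact ⟨S, hS, by rintro rfl; exact h0 chi_empty, rayVec_of_ne hSu⟩
    · exact ⟨univ, hC, univ_nonempty.ne_empty, rayVec_univ s⟩
  · rintro ⟨S, hS, hne, rfl⟩
    refine ⟨rayVec_ne_zero hs hne, ?_⟩
    by_cases h : S = univ
    · right
      rw [h, rayVec_univ]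
    · left
      exact ⟨S, ⟨hS, h⟩, (rayVec_of_ne h).symm⟩

theorem rayVec_mem_flagCone {C : Set (Set ι)} (hC : univ ∈ C) {s : ℤ} (hs : s = 1 ∨ s = -1)
    {S : Set ι} (hS : S ≠ ∅) : rayVec s S ∈ flagCone C s ↔ S ∈ C := by
  rw [mem_flagCone hC hs]
  constructor
  · rintro ⟨T, hT, _, h⟩
    rwa [← rayVec_injective hs h]
  · exact fun h => ⟨S, h, hS, rfl⟩

theorem sign_eq_of_mem_flagCone {C : Set (Set ι)} (hC : univ ∈ C) {s s' : ℤ}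
    (hs : s = 1 ∨ s = -1) (hs' : s' = 1 ∨ s' = -1) (h : rayVec s univ ∈ flagCone C s') :
    s = s' := by
  rw [mem_flagCone hC hs'] at h
  obtain ⟨T, _, _, h⟩ := h
  rw [rayVec_univ] at h
  by_cases hT : T = univ
  · rw [hT, rayVec_univ] at h
    exact smul_univ_inj h.symm
  · rw [rayVec_of_ne hT] at h
    exact absurd h (chi_ne_smul_univ hs hT)

theorem flagCone_inj {C C' : Set (Set ι)} (hC : univ ∈ C) (hC' : univ ∈ C') (h0 : ∅ ∈ C)
    (h0' : ∅ ∈ C') {s s' : ℤ} (hs : s = 1 ∨ s = -1) (hs' : s' = 1 ∨ s' = -1)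
    (h : flagCone C s = flagCone C' s') : C = C' ∧ s = s' := by
  have hss : s = s' := by
    apply sign_eq_of_mem_flagCone hC' hs hs'
    rw [← h, rayVec_mem_flagCone hC hs univ_nonempty.ne_empty]
    exact hC
  subst hss
  refine ⟨?_, rfl⟩
  ext S
  by_cases hS : S = ∅
  · rw [hS]
    exact iff_of_true h0 h0'
  · rw [← rayVec_mem_flagCone hC hs hS, h, rayVec_mem_flagCone hC' hs hS]

theorem flagCones_eq {C : Set (Set ι)} (hC : univ ∈ C) (w : ℤ) :
    flagCones C w = Finsupp.single (flagCone C 1) w + Finsupp.single (flagCone C (-1)) w := by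
  classical
  unfold flagCones
  rw [Finset.sum_pair]
  intro h
  have h1 : rayVec 1 (univ : Set ι) ∈ flagCone C (-1) := by
    rw [← h, rayVec_mem_flagCone hC (Or.inl rfl) univ_nonempty.ne_empty]
    exact hC
  have := sign_eq_of_mem_flagCone hC (Or.inl rfl) (Or.inr rfl) h1
  norm_num at this

end Cones

/-! ### Unimodularity of the cones of a flag -/

section Dual

variable {ι : Type*}

/-- A dual system for a set of lattice vectors: every member has an integral linear functional which
takes the value `1` on it and `0` on the other members. -/
def HasDual (σ : Finset (ι → ℤ)) : Prop :=
  ∀ v ∈ σ, ∃ (a : (ι → ℤ) →ₗ[ℤ] ℤ) (b : (ι → ℝ) →ₗ[ℝ] ℝ), (∀ w, b (toReal w) = a w) ∧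
    a v = 1 ∧ ∀ w ∈ σ, w ≠ v → a w = 0

theorem toReal_injective : Function.Injective (toReal : (ι → ℤ) → ι → ℝ) := by
  intro v w h
  ext i
  have := congrFun h i
  simpa [toReal] using this

theorem toReal_add (v w : ι → ℤ) : toReal (v + w) = toReal v + toReal w := by
  ext i
  simp [toReal]

theorem toReal_zsmul (c : ℤ) (v : ι → ℤ) : toReal (c • v) = (c : ℝ) • toReal v := by
  ext i
  simp [toReal]

theorem toReal_zero : toReal (0 : ι → ℤ) = 0 := by
  ext i
  simp [toReal]

theorem toReal_sum {κ : Type*} (s : Finset κ) (g : κ → ι → ℤ) :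
    toReal (∑ k ∈ s, g k) = ∑ k ∈ s, toReal (g k) := by
  classical
  induction s using Finset.induction_on with
  | empty => simp [toReal_zero]
  | insert a s ha ih => rw [Finset.sum_insert ha, Finset.sum_insert ha, toReal_add, ih]

theorem HasDual.isUnimodular {σ : Finset (ι → ℤ)} (h : HasDual σ) : IsUnimodular σ := by
  classical
  constructor
  · rw [Fintype.linearIndependent_iff]
    intro g hg v
    obtain ⟨a, b, hab, h1, h0⟩ := h v.1 v.2
    have := congrArg b hg
    rw [map_sum, map_zero, Finset.sum_eq_single v] at this
    · simpa [hab, h1] using this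
    · intro w _ hw
      rw [map_smul, hab, h0 w.1 w.2 (fun h => hw (Subtype.ext h))]
      simp
    · simp
  · intro w hw
    rw [← Finset.coe_image, Submodule.mem_span_finset] at hw
    obtain ⟨g, -, hg⟩ := hw
    rw [Finset.sum_image (fun _ _ _ _ h => toReal_injective h)] at hg
    have hc : ∀ v ∈ σ, ∃ c : ℤ, (c : ℝ) = g (toReal v) := by
      intro v hv
      obtain ⟨a, b, hab, h1, h0⟩ := h v hv
      refine ⟨a w, ?_⟩
      rw [← hab, ← hg, map_sum, Finset.sum_eq_single v]
      · simp [hab, h1]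
      · intro u hu huv
        simp [hab, h0 u hu huv]
      · exact fun h => absurd hv h
    choose! c hc using hc
    have hw' : w = ∑ v ∈ σ, c v • v := by
      apply toReal_injective
      rw [← hg, toReal_sum]
      refine Finset.sum_congr rfl fun v hv => ?_
      rw [toReal_zsmul, hc v hv]
    rw [hw']
    exact Submodule.sum_mem _ fun v hv => Submodule.smul_mem _ _ (Submodule.subset_span hv)

theorem HasDual.exists_linExt {σ : Finset (ι → ℤ)} (h : HasDual σ) (φ : (ι → ℤ) → ℤ) :
    ∃ l : (ι → ℤ) →ₗ[ℤ] ℤ, (∀ v ∈ σ, l v = φ v) ∧ ∀ w, linExt φ σ w = l w := by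
  classical
  have hex : ∃ l : (ι → ℤ) →ₗ[ℤ] ℤ, ∀ v ∈ σ, l v = φ v := by
    choose! a b _ h1 h0 using h
    refine ⟨∑ v ∈ σ, φ v • a v, fun v hv => ?_⟩
    rw [LinearMap.sum_apply, Finset.sum_eq_single v]
    · simp [h1 v hv]
    · intro u hu huv
      simp [h0 u hu v hv huv.symm]
    · exact fun h => absurd hv h
  refine ⟨hex.choose, hex.choose_spec, fun w => ?_⟩
  unfold linExt
  rw [dif_pos hex]

/-- In a finite chain of sets, every nonempty set has an element that is not in any smaller set. -/
theorem exists_mem_notMem_of_isChain {C : Set (Set ι)} (hfin : C.Finite) (hC : IsChain (· ⊆ ·) C)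
    {S : Set ι} (hS : S ∈ C) (hne : S ≠ ∅) : ∃ i, ∀ T ∈ C, i ∈ T ↔ S ⊆ T := by
  suffices h : ∃ i ∈ S, ∀ T ∈ C, T ⊂ S → i ∉ T by
    obtain ⟨i, hi, h⟩ := h
    refine ⟨i, fun T hT => ⟨fun hiT => ?_, fun hST => hST hi⟩⟩
    rcases hC.total hT hS with h1 | h1
    · by_contra h2
      exact h T hT ⟨h1, h2⟩ hiT
    · exact h1
  rcases {T | T ∈ C ∧ T ⊂ S}.eq_empty_or_nonempty with h | h
  · obtain ⟨i, hi⟩ := nonempty_iff_ne_empty.2 hne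
    refine ⟨i, hi, fun T hT hTS => ?_⟩
    have : T ∈ {T | T ∈ C ∧ T ⊂ S} := ⟨hT, hTS⟩
    rw [h] at this
    exact this.elim
  · obtain ⟨T₀, ⟨hT₀, hT₀S⟩, hmax⟩ := (hfin.subset fun T hT => hT.1 :
      {T | T ∈ C ∧ T ⊂ S}.Finite).exists_maximal h
    obtain ⟨i, hi, hi'⟩ := exists_of_ssubset hT₀S
    refine ⟨i, hi, fun T hT hTS hiT => hi' ?_⟩
    rcases hC.total hT hT₀ with h1 | h1
    · exact h1 hiT
    · exact hmax ⟨hT, hTS⟩ h1 hiT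

variable [Nonempty ι] [Finite ι]

theorem hasDual_flagCone {C : Set (Set ι)} (hu : univ ∈ C) (hC : IsChain (· ⊆ ·) C)
    {s : ℤ} (hs : s = 1 ∨ s = -1) : HasDual (flagCone C s) := by
  classical
  have hfin : C.Finite := Set.toFinite C
  -- a difference of two coordinate functions is dual to `S` among the sets of the flag
  have key : ∀ S ∈ C, S ≠ ∅ → ∃ (a : (ι → ℤ) →ₗ[ℤ] ℤ) (b : (ι → ℝ) →ₗ[ℝ] ℝ),
      (∀ w, b (toReal w) = a w) ∧ ∀ T ∈ C, a (chi T) = if T = S then 1 else 0 := by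
    intro S hS hne
    obtain ⟨i, hi⟩ := exists_mem_notMem_of_isChain hfin hC hS hne
    rcases {T | T ∈ C ∧ S ⊂ T}.eq_empty_or_nonempty with h | h
    · refine ⟨LinearMap.proj i, LinearMap.proj i, fun w => rfl, fun T hT => ?_⟩
      have h1 : S ⊆ T ↔ T = S := by
        constructor
        · intro hST
          by_contra hne'
          have : T ∈ {T | T ∈ C ∧ S ⊂ T} := ⟨hT, hST.ssubset_of_ne (Ne.symm hne')⟩
          rw [h] at this
          exact this.elim
        · rintro rfl
          exact Subset.rfl
      simp [chi, hi T hT, h1]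
    · obtain ⟨S', ⟨hS', hSS'⟩, hmin⟩ := (hfin.subset fun T hT => hT.1 :
        {T | T ∈ C ∧ S ⊂ T}.Finite).exists_minimal h
      obtain ⟨j, hj⟩ := exists_mem_notMem_of_isChain hfin hC hS'
        (fun h0 => hSS'.2 (h0 ▸ Set.empty_subset S))
      refine ⟨(LinearMap.proj i : (ι → ℤ) →ₗ[ℤ] ℤ) - LinearMap.proj j,
        (LinearMap.proj i : (ι → ℝ) →ₗ[ℝ] ℝ) - LinearMap.proj j,
        fun w => (Int.cast_sub (w i) (w j)).symm,
        fun T hT => ?_⟩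
      have h1 : S' ⊆ T ↔ S ⊂ T := by
        refine ⟨fun h => hSS'.trans_subset h, fun h => ?_⟩
        rcases hC.total hS' hT with h2 | h2
        · exact h2
        · exact hmin ⟨hT, h⟩ h2
      rw [LinearMap.sub_apply, LinearMap.proj_apply, LinearMap.proj_apply]
      simp only [chi, hi T hT, hj T hT, h1]
      by_cases hTS : T = S
      · subst hTS
        simp
      · by_cases hST : S ⊆ T
        · simp [hST, hTS, hST.ssubset_of_ne (Ne.symm hTS)]
        · have : ¬ S ⊂ T := fun h => hST h.subset
          simp [hST, hTS, this]
  intro v hv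
  obtain ⟨S, hS, hne, rfl⟩ := (mem_flagCone hu hs).1 hv
  obtain ⟨a, b, hab, ha⟩ := key S hS hne
  set t : ℤ := if S = univ then s else 1 with ht
  have htt : t * t = 1 := by
    rw [ht]
    rcases hs with rfl | rfl <;> split_ifs <;> norm_num
  refine ⟨t • a, (t : ℝ) • b, fun w => by simp [hab], ?_, ?_⟩
  · rw [rayVec_eq_smul, ← ht, map_smul, LinearMap.smul_apply, ha S hS, if_pos rfl, smul_smul, htt,
      one_smul]
  · intro w hw hwS
    obtain ⟨T, hT, _, rfl⟩ := (mem_flagCone hu hs).1 hw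
    have hTS : T ≠ S := fun h => hwS (by rw [h])
    rw [rayVec_eq_smul, map_smul, LinearMap.smul_apply, ha T hT, if_neg hTS, smul_zero, smul_zero]

end Dual

/-! ### Fans of weighted chains -/

section ChainFan

variable {ι : Type*} {A : Type*} [AddCommGroup A]

open Classical in
/-- The sum over the star of `τ`, as an additive map in the fan. -/
noncomputable def starHom (τ : Finset (ι → ℤ)) (g : (ι → ℤ) → A) : Fan ι →+ A :=
  Finsupp.liftAddHom fun σ =>
    if τ ⊂ σ ∧ σ.card = τ.card + 1 then
      (AddMonoidHom.flip (smulAddHom ℤ A)) (∑ v ∈ σ \ τ, g v) else 0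

theorem starHom_apply (X : Fan ι) (τ : Finset (ι → ℤ)) (g : (ι → ℤ) → A) :
    starHom τ g X = starSum X τ g := by
  classical
  unfold starSum starHom
  rw [Finsupp.liftAddHom_apply, Finsupp.sum, Finset.sum_filter]
  refine Finset.sum_congr rfl fun σ _ => ?_
  split_ifs with h
  · simp [Finset.smul_sum]
  · simp

open Classical in
theorem starHom_single (σ : Finset (ι → ℤ)) (w : ℤ) (τ : Finset (ι → ℤ)) (g : (ι → ℤ) → A) :
    starHom τ g (Finsupp.single σ w) =
      if τ ⊂ σ ∧ σ.card = τ.card + 1 then w • ∑ v ∈ σ \ τ, g v else 0 := by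
  unfold starHom
  rw [Finsupp.liftAddHom_apply_single]
  split_ifs with h
  · simp [Finset.smul_sum]
  · simp

variable {L : Type*} [PartialOrder L] [BoundedOrder L]

/-- `S` maps the least and the greatest element to the empty set and the whole ground set. -/
structure IsBounded (S : L → Set ι) : Prop where
  bot : S ⊥ = ∅
  top : S ⊤ = univ

/-- The weight function `W` vanishes on the sets which do not contain both `⊥` and `⊤`. -/
def IsBoundedWeight (W : Set L → ℤ) : Prop := ∀ C, W C ≠ 0 → ⊥ ∈ C ∧ ⊤ ∈ C

variable {S : L ↪o Set ι} {W : Set L → ℤ}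

theorem univ_mem_image (hS : IsBounded S) {C : Set L} (h : ⊤ ∈ C) : univ ∈ S '' C := ⟨⊤, h, hS.top⟩

theorem empty_mem_image (hS : IsBounded S) {C : Set L} (h : ⊥ ∈ C) : ∅ ∈ S '' C := ⟨⊥, h, hS.bot⟩

variable [Finite ι]

theorem flagCones_zero (C : Set (Set ι)) : flagCones C 0 = 0 := by
  simp [flagCones]

variable [Nonempty ι]

theorem mem_flagCone_image (hS : IsBounded S) {C : Set L} (h1 : ⊤ ∈ C) {s : ℤ} (hs : s = 1 ∨ s = -1)
    {v : ι → ℤ} :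
    v ∈ flagCone (S '' C) s ↔ ∃ p ∈ C, p ≠ ⊥ ∧ rayVec s (S p) = v := by
  rw [mem_flagCone (univ_mem_image hS h1) hs]
  constructor
  · rintro ⟨_, ⟨p, hp, rfl⟩, hne, h⟩
    exact ⟨p, hp, by rintro rfl; exact hne hS.bot, h⟩
  · rintro ⟨p, hp, hne, h⟩
    exact ⟨S p, ⟨p, hp, rfl⟩, fun h' => hne (S.injective (h'.trans hS.bot.symm)), h⟩

theorem rayVec_mem_flagCone_image (hS : IsBounded S) {C : Set L} (h1 : ⊤ ∈ C) {s : ℤ}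
    (hs : s = 1 ∨ s = -1) {p : L} (hp : p ≠ ⊥) : rayVec s (S p) ∈ flagCone (S '' C) s ↔ p ∈ C := by
  rw [mem_flagCone_image hS h1 hs]
  constructor
  · rintro ⟨q, hq, _, h⟩
    rwa [← S.injective (rayVec_injective hs h)]
  · exact fun h => ⟨p, h, hp, rfl⟩

variable [Fintype L]

open Classical in
/-- The fan with a pair of cones for every set `C` of elements of `L`, weighted by `W C`; the cone of
`C` is spanned by the sets `S p`, `p ∈ C`. -/
noncomputable def chainFan (S : L ↪o Set ι) (W : Set L → ℤ) : Fan ι :=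
  ∑ C : Set L, flagCones (S '' C) (W C)

theorem chainFan_apply_cone (hS : IsBounded S) (hW : IsBoundedWeight W) {C : Set L}
    (h0 : ⊥ ∈ C) (h1 : ⊤ ∈ C) {s : ℤ} (hs : s = 1 ∨ s = -1) : chainFan S W (flagCone (S '' C) s) = W C := by
  classical
  unfold chainFan
  rw [Finsupp.finsetSum_apply, Finset.sum_eq_single C]
  · rw [flagCones_eq (univ_mem_image hS h1), Finsupp.add_apply, Finsupp.single_apply,
      Finsupp.single_apply]
    have hne : flagCone (S '' C) 1 ≠ flagCone (S '' C) (-1) := by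
      intro h
      have := (flagCone_inj (univ_mem_image hS h1) (univ_mem_image hS h1)
        (empty_mem_image hS h0) (empty_mem_image hS h0) (Or.inl rfl) (Or.inr rfl) h).2
      norm_num at this
    rcases hs with rfl | rfl
    · rw [if_pos rfl, if_neg hne.symm, add_zero]
    · rw [if_pos rfl, if_neg hne, zero_add]
  · intro D _ hDC
    by_cases hD : W D = 0
    · rw [hD, flagCones_zero, Finsupp.zero_apply]
    · obtain ⟨hD0, hD1⟩ := hW D hD
      have : ∀ t : ℤ, t = 1 ∨ t = -1 → flagCone (S '' D) t ≠ flagCone (S '' C) s := by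
        intro t ht h
        have := (flagCone_inj (univ_mem_image hS hD1) (univ_mem_image hS h1)
          (empty_mem_image hS hD0) (empty_mem_image hS h0) ht hs h).1
        exact hDC (S.injective.image_injective this)
      rw [flagCones_eq (univ_mem_image hS hD1), Finsupp.add_apply, Finsupp.single_apply,
        Finsupp.single_apply, if_neg (this 1 (Or.inl rfl)), if_neg (this (-1) (Or.inr rfl)),
        add_zero]
  · simp

theorem exists_of_chainFan_apply_ne_zero (hS : IsBounded S) (hW : IsBoundedWeight W)
    {σ : Finset (ι → ℤ)} (h : chainFan S W σ ≠ 0) :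
    ∃ (C : Set L) (s : ℤ), ⊥ ∈ C ∧ ⊤ ∈ C ∧ (s = 1 ∨ s = -1) ∧ W C ≠ 0 ∧
      σ = flagCone (S '' C) s := by
  classical
  unfold chainFan at h
  rw [Finsupp.finsetSum_apply] at h
  obtain ⟨C, _, hC⟩ := Finset.exists_ne_zero_of_sum_ne_zero h
  by_cases hw : W C = 0
  · rw [hw, flagCones_zero, Finsupp.zero_apply] at hC
    exact absurd rfl hC
  obtain ⟨h0, h1⟩ := hW C hw
  rw [flagCones_eq (univ_mem_image hS h1), Finsupp.add_apply, Finsupp.single_apply,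
    Finsupp.single_apply] at hC
  by_cases h2 : flagCone (S '' C) 1 = σ
  · exact ⟨C, 1, h0, h1, Or.inl rfl, hw, h2.symm⟩
  · by_cases h3 : flagCone (S '' C) (-1) = σ
    · exact ⟨C, -1, h0, h1, Or.inr rfl, hw, h3.symm⟩
    · rw [if_neg h2, if_neg h3] at hC
      exact absurd rfl hC

open Classical in
theorem card_flagCone_image (hS : IsBounded S) {C : Set L} (h0 : ⊥ ∈ C) (h1 : ⊤ ∈ C) {s : ℤ}
    (hs : s = 1 ∨ s = -1) : (flagCone (S '' C) s).card + 1 = C.ncard := by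
  have : flagCone (S '' C) s
      = (C.toFinset.erase ⊥).image (fun p => rayVec s (S p)) := by
    ext v
    rw [mem_flagCone_image hS h1 hs]
    simp only [Finset.mem_image, Finset.mem_erase, Set.mem_toFinset]
    constructor
    · rintro ⟨p, hp, h2, h3⟩
      exact ⟨p, ⟨h2, hp⟩, h3⟩
    · rintro ⟨p, ⟨h2, hp⟩, h3⟩
      exact ⟨p, hp, h2, h3⟩
  rw [this, Finset.card_image_of_injective _ fun p q h => S.injective (rayVec_injective hs h),
    Finset.card_erase_add_one (by simpa using h0), Set.ncard_eq_toFinset_card']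

open Classical in
/-- The star of the cone of a chain consists of the cones of the chains with one more element. -/
theorem starSum_chainFan (hS : IsBounded S) (hW : IsBoundedWeight W) {C₀ : Set L}
    (h0 : ⊥ ∈ C₀) (h1 : ⊤ ∈ C₀) {s : ℤ} (hs : s = 1 ∨ s = -1) (g : (ι → ℤ) → A) :
    starSum (chainFan S W) (flagCone (S '' C₀) s) g =
      ∑ F with F ∉ C₀, W (insert F C₀) • g (rayVec s (S F)) := by
  have hne : ∀ F ∉ C₀, F ≠ ⊥ := fun F hF h => hF (h ▸ h0)
  -- a cone of the fan has `C₀` as a facet exactly if its chain has one more element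
  have hstar : ∀ C : Set L, ⊥ ∈ C → ⊤ ∈ C → ∀ t : ℤ, t = 1 ∨ t = -1 →
      (flagCone (S '' C₀) s ⊂ flagCone (S '' C) t ∧
        (flagCone (S '' C) t).card = (flagCone (S '' C₀) s).card + 1 ↔
      t = s ∧ ∃ F ∉ C₀, C = insert F C₀) := by
    intro C hC0 hC1 t ht
    have hcard := card_flagCone_image hS hC0 hC1 ht
    have hcard₀ := card_flagCone_image hS h0 h1 hs
    constructor
    · rintro ⟨hsub, hc⟩
      have hts : s = t := by
        apply sign_eq_of_mem_flagCone (univ_mem_image hS hC1) hs ht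
        apply hsub.subset
        rw [rayVec_mem_flagCone (univ_mem_image hS h1) hs univ_nonempty.ne_empty]
        exact univ_mem_image hS h1
      subst hts
      refine ⟨rfl, ?_⟩
      have hCC : C₀ ⊆ C := by
        intro p hp
        by_cases hpb : p = ⊥
        · rwa [hpb]
        · rw [← rayVec_mem_flagCone_image hS hC1 hs hpb]
          apply hsub.subset
          rwa [rayVec_mem_flagCone_image hS h1 hs hpb]
      have : C.ncard = C₀.ncard + 1 := by omega
      have h2 : (C \ C₀).ncard = 1 := by
        have := Set.ncard_sdiff_add_ncard_of_subset hCC (Set.toFinite C)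
        omega
      obtain ⟨F, hF⟩ := Set.ncard_eq_one.1 h2
      have hFm : F ∈ C \ C₀ := by rw [hF]; exact Set.mem_singleton F
      refine ⟨F, hFm.2, ?_⟩
      rw [← Set.sdiff_union_of_subset hCC, hF, Set.singleton_union]
    · rintro ⟨rfl, F, hF, rfl⟩
      rw [Set.ncard_insert_of_notMem hF (Set.toFinite C₀)] at hcard
      refine ⟨?_, by omega⟩
      have hsub : flagCone (S '' C₀) t ⊆ flagCone (S '' insert F C₀) t := by
        intro v hv
        rw [mem_flagCone_image hS h1 ht] at hv
        obtain ⟨p, hp, hpb, rfl⟩ := hv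
        rw [rayVec_mem_flagCone_image hS hC1 ht hpb]
        exact Set.mem_insert_of_mem F hp
      refine hsub.ssubset_of_ne fun h => ?_
      rw [h] at hcard₀
      omega
  have hdiff : ∀ F ∉ C₀, flagCone (S '' insert F C₀) s \ flagCone (S '' C₀) s
      = {rayVec s (S F)} := by
    intro F hF
    have hF1 : ⊤ ∈ insert F C₀ := Set.mem_insert_of_mem F h1
    ext v
    rw [Finset.mem_sdiff, mem_flagCone_image hS hF1 hs, Finset.mem_singleton]
    constructor
    · rintro ⟨⟨p, hp, hpb, rfl⟩, h⟩
      rw [rayVec_mem_flagCone_image hS h1 hs hpb] at h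
      rcases hp with rfl | hp
      · rfl
      · exact absurd hp h
    · rintro rfl
      refine ⟨⟨F, Set.mem_insert F C₀, hne F hF, rfl⟩, ?_⟩
      rwa [rayVec_mem_flagCone_image hS h1 hs (hne F hF)]
  have hterm : ∀ C : Set L, starHom (flagCone (S '' C₀) s) g (flagCones (S '' C) (W C)) =
      ∑ F with F ∉ C₀, if insert F C₀ = C then W C • g (rayVec s (S F)) else 0 := by
    intro C
    by_cases hw : W C = 0
    · rw [hw, flagCones_zero, map_zero]
      simp
    obtain ⟨hC0, hC1⟩ := hW C hw
    rw [flagCones_eq (univ_mem_image hS hC1), map_add, starHom_single, starHom_single]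
    simp only [hstar C hC0 hC1 1 (Or.inl rfl), hstar C hC0 hC1 (-1) (Or.inr rfl)]
    by_cases hF : ∃ F ∉ C₀, C = insert F C₀
    · have h2 : ∑ F with F ∉ C₀, (if insert F C₀ = C then W C • g (rayVec s (S F)) else 0) =
          W C • ∑ v ∈ flagCone (S '' C) s \ flagCone (S '' C₀) s, g v := by
        obtain ⟨F, hF, rfl⟩ := hF
        rw [hdiff F hF, Finset.sum_singleton, Finset.sum_eq_single F, if_pos rfl]
        · intro G hG hGF
          rw [if_neg]
          intro h
          have : G ∈ insert F C₀ := h ▸ Set.mem_insert G C₀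
          simp only [Finset.mem_filter, Finset.mem_univ, true_and] at hG
          rcases this with h3 | h3
          · exact hGF h3
          · exact hG h3
        · intro h
          simp [hF] at h
      rw [h2]
      rcases hs with rfl | rfl
      · rw [if_pos ⟨rfl, hF⟩, if_neg (by norm_num), add_zero]
      · rw [if_neg (by norm_num), if_pos ⟨rfl, hF⟩, zero_add]
    · rw [if_neg fun h => hF h.2, if_neg fun h => hF h.2, add_zero]
      symm
      refine Finset.sum_eq_zero fun F hF' => if_neg fun h => hF ⟨F, ?_, h.symm⟩
      simpa using hF'
  rw [← starHom_apply, chainFan, map_sum, Finset.sum_congr rfl fun C _ => hterm C, Finset.sum_comm]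
  refine Finset.sum_congr rfl fun F _ => ?_
  rw [Finset.sum_ite_eq, if_pos (Finset.mem_univ _)]

/-- At a cone which does not come from a chain, the two signs of the lineality direction cancel. -/
theorem starSum_chainFan_of_odd (hS : IsBounded S) (hW : IsBoundedWeight W) {τ : Finset (ι → ℤ)}
    (hτ : ∀ (C : Set L) (s : ℤ), ⊥ ∈ C → ⊤ ∈ C → (s = 1 ∨ s = -1) → τ ≠ flagCone (S '' C) s)
    (g : (ι → ℤ) → A) (hg : g (-chi univ) = -g (chi univ)) : starSum (chainFan S W) τ g = 0 := by
  classical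
  have hbt : (⊤ : L) ≠ ⊥ := by
    intro h
    have := hS.top
    rw [h, hS.bot] at this
    exact empty_ne_univ this
  rw [← starHom_apply, chainFan, map_sum]
  refine Finset.sum_eq_zero fun C _ => ?_
  by_cases hw : W C = 0
  · rw [hw, flagCones_zero, map_zero]
  obtain ⟨hC0, hC1⟩ := hW C hw
  -- a facet of a cone of `C` containing the lineality generator comes from a chain
  have hnot : ∀ s : ℤ, s = 1 ∨ s = -1 → τ ⊆ flagCone (S '' C) s → rayVec s univ ∉ τ := by
    intro s hs hsub hmem
    have htop : ⊤ ∈ {p | p ∈ C ∧ (p = ⊥ ∨ rayVec s (S p) ∈ τ)} :=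
      ⟨hC1, Or.inr (by rwa [hS.top])⟩
    refine hτ {p | p ∈ C ∧ (p = ⊥ ∨ rayVec s (S p) ∈ τ)} s ⟨hC0, Or.inl rfl⟩ htop hs ?_
    ext v
    rw [mem_flagCone_image hS htop hs]
    constructor
    · intro hv
      obtain ⟨p, hp, hpb, rfl⟩ := (mem_flagCone_image hS hC1 hs).1 (hsub hv)
      exact ⟨p, ⟨hp, Or.inr hv⟩, hpb, rfl⟩
    · rintro ⟨p, ⟨hp, h | h⟩, hpb, rfl⟩
      · exact absurd h hpb
      · exact h
  -- so the facet is the common facet of the two cones of `C`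
  have hfacet : ∀ s : ℤ, s = 1 ∨ s = -1 → (τ ⊂ flagCone (S '' C) s ∧
      (flagCone (S '' C) s).card = τ.card + 1 ↔
      ∀ v, v ∈ τ ↔ ∃ p ∈ C, p ≠ ⊥ ∧ p ≠ ⊤ ∧ chi (S p) = v) := by
    intro s hs
    have hmem : rayVec s univ ∈ flagCone (S '' C) s := by
      rw [← hS.top, rayVec_mem_flagCone_image hS hC1 hs hbt]
      exact hC1
    have herase : ∀ v, v ∈ (flagCone (S '' C) s).erase (rayVec s univ) ↔
        ∃ p ∈ C, p ≠ ⊥ ∧ p ≠ ⊤ ∧ chi (S p) = v := by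
      intro v
      rw [Finset.mem_erase, mem_flagCone_image hS hC1 hs]
      constructor
      · rintro ⟨hv, p, hp, hpb, rfl⟩
        have hpt : p ≠ ⊤ := by
          rintro rfl
          exact hv (by rw [hS.top])
        refine ⟨p, hp, hpb, hpt, (rayVec_of_ne fun h => hpt ?_).symm⟩
        exact S.injective (h.trans hS.top.symm)
      · rintro ⟨p, hp, hpb, hpt, rfl⟩
        have hpu : S p ≠ univ := fun h => hpt (S.injective (h.trans hS.top.symm))
        rw [← rayVec_of_ne (s := s) hpu]
        exact ⟨fun h => hpu (rayVec_injective hs h), p, hp, hpb, rfl⟩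
    constructor
    · rintro ⟨hsub, hcard⟩ v
      rw [← herase]
      have hsub' : τ ⊆ (flagCone (S '' C) s).erase (rayVec s univ) :=
        Finset.subset_erase.2 ⟨hsub.subset, hnot s hs hsub.subset⟩
      rw [Finset.eq_of_subset_of_card_le hsub' (by rw [Finset.card_erase_of_mem hmem]; omega)]
    · intro h
      have : τ = (flagCone (S '' C) s).erase (rayVec s univ) := by
        ext v
        rw [h, herase]
      rw [this]
      exact ⟨Finset.erase_ssubset hmem, (Finset.card_erase_add_one hmem).symm⟩
  rw [flagCones_eq (univ_mem_image hS hC1), map_add, starHom_single, starHom_single]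
  simp only [hfacet 1 (Or.inl rfl), hfacet (-1) (Or.inr rfl)]
  split_ifs with h
  · have hdiff : ∀ s : ℤ, s = 1 ∨ s = -1 → flagCone (S '' C) s \ τ = {rayVec s univ} := by
      intro s hs
      obtain ⟨h1, h2⟩ := (hfacet s hs).2 h
      have hmem : rayVec s univ ∈ flagCone (S '' C) s := by
        rw [← hS.top, rayVec_mem_flagCone_image hS hC1 hs hbt]
        exact hC1
      symm
      refine Finset.eq_of_subset_of_card_le ?_ ?_
      · rw [Finset.singleton_subset_iff, Finset.mem_sdiff]
        exact ⟨hmem, hnot s hs h1.subset⟩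
      · rw [Finset.card_sdiff_of_subset h1.subset, Finset.card_singleton]
        omega
    rw [hdiff 1 (Or.inl rfl), hdiff (-1) (Or.inr rfl), Finset.sum_singleton, Finset.sum_singleton,
      rayVec_univ, rayVec_univ, one_smul, neg_one_smul, hg, smul_neg, add_neg_cancel]
  · rw [add_zero]

end ChainFan

/-! ### The fan of a rank-like function -/

section RankFan

variable {L : Type*} [Lattice L] [BoundedOrder L]

/-- A chain that becomes full by inserting one element has exactly one gap `p < q`, and it becomes full
by inserting any element of the right rank between `p` and `q`. -/
theorem exists_gap {ρ : L → ℕ} (hρ : Monotone ρ) {C₀ : Set L} (h0 : ⊥ ∈ C₀)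
    (h1 : ⊤ ∈ C₀) {F₀ : L} (hF₀ : F₀ ∉ C₀) (hfull : IsFull ρ (insert F₀ C₀)) :
    ∃ p ∈ C₀, ∃ q ∈ C₀, p ≤ q ∧ ρ q = ρ p + 2 ∧ ρ F₀ = ρ p + 1 ∧
      (∀ x ∈ C₀, x ≤ p ∨ q ≤ x) ∧ (∀ x ∈ C₀, ρ x ≠ ρ p + 1) ∧
      ∀ F, (F ∉ C₀ ∧ IsFull ρ (insert F C₀)) ↔ p ≤ F ∧ F ≤ q ∧ ρ F = ρ p + 1 := by
  have hin : ∀ {x}, x ∈ C₀ → x ∈ insert F₀ C₀ := fun hx => Set.mem_insert_of_mem F₀ hx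
  have hF₀m : F₀ ∈ insert F₀ C₀ := Set.mem_insert F₀ C₀
  have hne : ∀ x ∈ C₀, ρ x ≠ ρ F₀ := fun x hx h => hF₀ (hfull.inj (hin hx) hF₀m h ▸ hx)
  have hpos : ρ ⊥ < ρ F₀ := lt_of_le_of_ne (hρ bot_le) (hne ⊥ h0)
  have hlt : ρ F₀ < ρ ⊤ := lt_of_le_of_ne (hρ le_top) (hne ⊤ h1).symm
  obtain ⟨p, hp, hpj⟩ := hfull.surj (ρ F₀ - 1) (by omega)
  obtain ⟨q, hq, hqj⟩ := hfull.surj (ρ F₀ + 1) (by omega)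
  have hp' : p ∈ C₀ := by
    rcases hp with rfl | hp
    · omega
    · exact hp
  have hq' : q ∈ C₀ := by
    rcases hq with rfl | hq
    · omega
    · exact hq
  have hsplit : ∀ x ∈ C₀, x ≤ p ∨ q ≤ x := by
    intro x hx
    have := hne x hx
    rcases lt_or_gt_of_ne this with h | h
    · exact Or.inl (hfull.le_of_le hρ (hin hx) hp (by omega))
    · exact Or.inr (hfull.le_of_le hρ hq (hin hx) (by omega))
  refine ⟨p, hp', q, hq', hfull.le_of_le hρ hp hq (by omega), by omega, by omega, hsplit,
    fun x hx h => hne x hx (by omega), fun F => ⟨?_, ?_⟩⟩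
  · rintro ⟨hF, hfF⟩
    have hFj : ρ F = ρ F₀ := by
      obtain ⟨y, hy, hyj⟩ := hfF.surj (ρ F₀) hlt.le
      rcases hy with rfl | hy
      · exact hyj
      · exact absurd hyj (hne y hy)
    refine ⟨?_, ?_, by omega⟩
    · exact hfF.le_of_le hρ (Set.mem_insert_of_mem F hp') (Set.mem_insert F C₀) (by omega)
    · exact hfF.le_of_le hρ (Set.mem_insert F C₀) (Set.mem_insert_of_mem F hq') (by omega)
  · rintro ⟨hpF, hFq, hFj⟩
    have hFj' : ρ F = ρ F₀ := by omega
    have hF : F ∉ C₀ := fun h => hne F h hFj'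
    refine ⟨hF, ?_, Set.mem_insert_of_mem F h0, Set.mem_insert_of_mem F h1, ?_, ?_⟩
    · refine (hfull.chain.mono (Set.subset_insert F₀ C₀)).insert fun x hx _ => ?_
      rcases hsplit x hx with h | h
      · exact Or.inr (h.trans hpF)
      · exact Or.inl (hFq.trans h)
    · rintro x (rfl | hx) y (rfl | hy) hxy
      · rfl
      · exact absurd (hxy.symm.trans hFj') (hne y hy)
      · exact absurd (hxy.trans hFj') (hne x hx)
      · exact hfull.inj (hin hx) (hin hy) hxy
    · intro j hj
      obtain ⟨y, rfl | hy, hyj⟩ := hfull.surj j hj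
      · exact ⟨F, Set.mem_insert F C₀, hFj'.trans hyj⟩
      · exact ⟨y, Set.mem_insert_of_mem F hy, hyj⟩

variable [Fintype L]

open Classical in
/-- The product of the edge weights along a chain which `ρ` maps bijectively to `{0, …, ρ ⊤}`. -/
noncomputable def chainWeight (ρ : L → ℕ) (C : Set L) : ℤ :=
  if IsFull ρ C then
    ∏ x : L × L with x.1 ∈ C ∧ x.2 ∈ C ∧ ρ x.2 = ρ x.1 + 1, pathEta ρ x.1 x.2
  else 0

theorem isFull_of_chainWeight_ne_zero {ρ : L → ℕ} {C : Set L} (h : chainWeight ρ C ≠ 0) :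
    IsFull ρ C := by
  by_contra hC
  exact h (if_neg hC)

theorem isBoundedWeight_chainWeight (ρ : L → ℕ) : IsBoundedWeight (chainWeight ρ) := fun _ h =>
  ⟨(isFull_of_chainWeight_ne_zero h).bot_mem, (isFull_of_chainWeight_ne_zero h).top_mem⟩

open Classical in
theorem chainWeight_insert {ρ : L → ℕ} {C₀ : Set L} {p q F : L} (hp : p ∈ C₀) (hq : q ∈ C₀)
    (hpq : ρ q = ρ p + 2) (hF : F ∉ C₀) (hρF : ρ F = ρ p + 1) (hfull : IsFull ρ (insert F C₀)) :
    chainWeight ρ (insert F C₀) =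
      (∏ x : L × L with x.1 ∈ C₀ ∧ x.2 ∈ C₀ ∧ ρ x.2 = ρ x.1 + 1, pathEta ρ x.1 x.2) *
        (pathEta ρ p F * pathEta ρ F q) := by
  have hin : ∀ {x}, x ∈ C₀ → x ∈ insert F C₀ := fun hx => Set.mem_insert_of_mem F hx
  have hpF : (p, F) ≠ (F, q) := by
    intro h
    have h1 : p = F := congrArg Prod.fst h
    exact hF (h1 ▸ hp)
  rw [chainWeight, if_pos hfull,
    ← Finset.prod_pair (f := fun x : L × L => pathEta ρ x.1 x.2) hpF, ← Finset.prod_union]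
  · refine Finset.prod_congr ?_ fun _ _ => rfl
    ext ⟨x, y⟩
    simp only [Finset.mem_filter, Finset.mem_univ, true_and, Finset.mem_union, Finset.mem_insert,
      Finset.mem_singleton, Prod.mk.injEq]
    constructor
    · rintro ⟨rfl | hx, rfl | hy, h⟩
      · omega
      · exact Or.inr (Or.inr ⟨rfl, hfull.inj (hin hy) (hin hq) (by omega)⟩)
      · exact Or.inr (Or.inl ⟨hfull.inj (hin hx) (hin hp) (by omega), rfl⟩)
      · exact Or.inl ⟨hx, hy, h⟩
    · rintro (⟨hx, hy, h⟩ | ⟨rfl, rfl⟩ | ⟨rfl, rfl⟩)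
      · exact ⟨hin hx, hin hy, h⟩
      · exact ⟨hin hp, Set.mem_insert _ _, hρF⟩
      · exact ⟨Set.mem_insert _ _, hin hq, by omega⟩
  · rw [Finset.disjoint_left]
    rintro ⟨x, y⟩ h h'
    simp only [Finset.mem_filter, Finset.mem_univ, true_and, Finset.mem_insert,
      Finset.mem_singleton, Prod.mk.injEq] at h h'
    rcases h' with ⟨rfl, rfl⟩ | ⟨rfl, rfl⟩
    · exact hF h.2.1
    · exact hF h.1

variable {ι : Type*} {at' : ι → L} {S : L ↪o Set ι}

/-- The elements of the set `S p` are the generators below `p`. -/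
def IsSupport (at' : ι → L) (S : L → Set ι) : Prop := ∀ i p, i ∈ S p ↔ at' i ≤ p

open Classical in
/-- The rays between `p` and `q` balance each other modulo the rays of `p` and `q`. -/
theorem sum_smul_chi {ρ : L → ℕ} (hat : IsSupport at' S) (hρ : IsRankLike at' ρ) {p q : L}
    (hpq : p ≤ q) :
    ∑ F with p ≤ F ∧ F ≤ q ∧ ρ F = ρ p + 1, (pathEta ρ p F * pathEta ρ F q) • chi (S F) =
      pathEta ρ p q • (chi (S q) - chi (S p)) +
      (∑ F with p ≤ F ∧ F ≤ q ∧ ρ F = ρ p + 1, pathEta ρ p F * pathEta ρ F q) • chi (S p) := by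
  ext i
  rw [Finset.sum_apply]
  simp only [Pi.smul_apply, Pi.add_apply, Pi.sub_apply, smul_eq_mul]
  by_cases hip : i ∈ S p
  · have hiq : i ∈ S q := S.monotone hpq hip
    rw [chi_apply_mem hip, chi_apply_mem hiq, sub_self, mul_zero, zero_add, mul_one]
    refine Finset.sum_congr rfl fun F hF => ?_
    simp only [Finset.mem_filter, Finset.mem_univ, true_and] at hF
    rw [chi_apply_mem (S.monotone hF.1 hip), mul_one]
  · rw [chi_apply_notMem hip, mul_zero, add_zero, sub_zero]
    by_cases hiq : i ∈ S q
    · rw [chi_apply_mem hiq, mul_one, ← sum_pathEta_mul_pathEta hρ (mt (hat i p).2 hip)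
        ((hat i q).1 hiq), Finset.sum_filter, Finset.sum_filter]
      refine Finset.sum_congr rfl fun F _ => ?_
      by_cases hiF : i ∈ S F
      · have h1 := (hat i F).1 hiF
        simp only [h1, and_true, chi_apply_mem hiF, mul_one]
      · have h1 := mt (hat i F).2 hiF
        simp only [h1, and_false, chi_apply_notMem hiF, mul_zero, ite_self, if_false]
    · rw [chi_apply_notMem hiq, mul_zero]
      refine Finset.sum_eq_zero fun F hF => ?_
      simp only [Finset.mem_filter, Finset.mem_univ, true_and] at hF
      rw [chi_apply_notMem fun h => hiq (S.monotone hF.2.1 h), mul_zero]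

theorem isChain_image_embedding {V : Type*} [PartialOrder V] {S : V ↪o Set ι} {C : Set V}
    (hC : IsChain (· ≤ ·) C) : IsChain (· ⊆ ·) (S '' C) := by
  rintro _ ⟨p, hp, rfl⟩ _ ⟨q, hq, rfl⟩ _
  exact (hC.total hp hq).imp (fun h => S.monotone h) fun h => S.monotone h

variable [Finite ι]

/-- The fan of all chains on which `ρ` is a bijection to `{0, …, ρ ⊤}`. -/
noncomputable def rankFan (S : L ↪o Set ι) (ρ : L → ℕ) : Fan ι := chainFan S (chainWeight ρ)

variable [Nonempty ι]

open Classical in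
/-- The star of a cone whose chain has the gap `p < q`. -/
theorem starSum_rankFan {A : Type*} [AddCommGroup A] {ρ : L → ℕ}
    (hS : IsBounded S) {C₀ : Set L} (h0 : ⊥ ∈ C₀) (h1 : ⊤ ∈ C₀)
    {s : ℤ} (hs : s = 1 ∨ s = -1) {p q : L} (hp : p ∈ C₀) (hq : q ∈ C₀) (hpq : ρ q = ρ p + 2)
    (hgap : ∀ F, (F ∉ C₀ ∧ IsFull ρ (insert F C₀)) ↔ p ≤ F ∧ F ≤ q ∧ ρ F = ρ p + 1)
    (g : (ι → ℤ) → A) :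
    starSum (rankFan S ρ) (flagCone (S '' C₀) s) g =
      (∏ x : L × L with x.1 ∈ C₀ ∧ x.2 ∈ C₀ ∧ ρ x.2 = ρ x.1 + 1, pathEta ρ x.1 x.2) •
        ∑ F with p ≤ F ∧ F ≤ q ∧ ρ F = ρ p + 1,
          (pathEta ρ p F * pathEta ρ F q) • g (chi (S F)) := by
  rw [rankFan, starSum_chainFan hS (isBoundedWeight_chainWeight ρ) h0 h1 hs, Finset.smul_sum,
    Finset.sum_filter, Finset.sum_filter]
  refine Finset.sum_congr rfl fun F _ => ?_
  by_cases hF : p ≤ F ∧ F ≤ q ∧ ρ F = ρ p + 1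
  · obtain ⟨h2, h3⟩ := (hgap F).2 hF
    have hne : S F ≠ univ := by
      intro h
      rw [S.injective (h.trans hS.top.symm)] at h2
      exact h2 h1
    rw [if_pos h2, if_pos hF, chainWeight_insert hp hq hpq h2 hF.2.2 h3, rayVec_of_ne hne, smul_smul]
  · rw [if_neg hF]
    by_cases h2 : F ∉ C₀
    · rw [if_pos h2, chainWeight, if_neg fun h3 => hF ((hgap F).1 ⟨h2, h3⟩), zero_smul]
    · rw [if_neg h2]

theorem starSum_rankFan_eq_zero {A : Type*} [AddCommGroup A] {ρ : L → ℕ}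
    (hS : IsBounded S) {C₀ : Set L} (h0 : ⊥ ∈ C₀) (h1 : ⊤ ∈ C₀)
    {s : ℤ} (hs : s = 1 ∨ s = -1) (h : ∀ F ∉ C₀, ¬ IsFull ρ (insert F C₀)) (g : (ι → ℤ) → A) :
    starSum (rankFan S ρ) (flagCone (S '' C₀) s) g = 0 := by
  classical
  rw [rankFan, starSum_chainFan hS (isBoundedWeight_chainWeight ρ) h0 h1 hs]
  refine Finset.sum_eq_zero fun F hF => ?_
  rw [chainWeight, if_neg (h F (by simpa using hF)), zero_smul]

/-- The fan of a rank-like function is balanced. -/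
theorem isTropicalFan_rankFan {ρ : L → ℕ} (hS : IsBounded S) (hat : IsSupport at' S)
    (hρ : IsRankLike at' ρ) : IsTropicalFan (ρ ⊤) (rankFan S ρ) := by
  classical
  constructor
  · intro σ hσ
    obtain ⟨C, s, h0, h1, hs, hw, rfl⟩ := exists_of_chainFan_apply_ne_zero hS
      (isBoundedWeight_chainWeight ρ) (Finsupp.mem_support_iff.1 hσ)
    have hfull := isFull_of_chainWeight_ne_zero hw
    constructor
    · have := card_flagCone_image hS h0 h1 hs
      rw [hfull.ncard_eq hρ.mono] at this
      omega
    · exact (hasDual_flagCone (univ_mem_image hS h1) (isChain_image_embedding hfull.chain)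
        hs).isUnimodular
  · intro τ _
    by_cases hτ : ∃ (C₀ : Set L) (s : ℤ), ⊥ ∈ C₀ ∧ ⊤ ∈ C₀ ∧ (s = 1 ∨ s = -1) ∧
        τ = flagCone (S '' C₀) s
    · obtain ⟨C₀, s, h0, h1, hs, rfl⟩ := hτ
      by_cases hex : ∃ F₀ ∉ C₀, IsFull ρ (insert F₀ C₀)
      · obtain ⟨F₀, hF₀, hfull⟩ := hex
        obtain ⟨p, hp, q, hq, hle, hpq, -, -, -, hgap⟩ := exists_gap hρ.mono h0 h1 hF₀ hfull
        rw [starSum_rankFan hS h0 h1 hs hp hq hpq hgap, sum_smul_chi hat hρ hle]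
        have hspan : ∀ x ∈ C₀, toReal (chi (S x)) ∈
            Submodule.span ℝ (toReal '' (flagCone (S '' C₀) s : Set (ι → ℤ))) := by
          intro x hx
          by_cases hxb : x = ⊥
          · rw [hxb, hS.bot, chi_empty, toReal_zero]
            exact Submodule.zero_mem _
          · obtain ⟨c, hc⟩ := chi_eq_smul_rayVec hs (S x)
            rw [hc, toReal_zsmul]
            refine Submodule.smul_mem _ _ (Submodule.subset_span ⟨_, ?_, rfl⟩)
            rw [Finset.mem_coe, rayVec_mem_flagCone_image hS h1 hs hxb]
            exact hx
        rw [sub_eq_add_neg, ← neg_one_smul ℤ, toReal_zsmul, toReal_add, toReal_zsmul, toReal_add,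
          toReal_zsmul, toReal_zsmul]
        exact Submodule.smul_mem _ _ (Submodule.add_mem _ (Submodule.smul_mem _ _
          (Submodule.add_mem _ (hspan q hq) (Submodule.smul_mem _ _ (hspan p hp))))
          (Submodule.smul_mem _ _ (hspan p hp)))
      · push Not at hex
        rw [starSum_rankFan_eq_zero hS h0 h1 hs hex, toReal_zero]
        exact Submodule.zero_mem _
    · push Not at hτ
      rw [rankFan, starSum_chainFan_of_odd hS (isBoundedWeight_chainWeight ρ) hτ (fun v => v) rfl,
        toReal_zero]
      exact Submodule.zero_mem _

end RankFan

/-! ### Weil divisors of the fans of rank-like functions -/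

section Divisor

variable {L : Type*} [Lattice L] [BoundedOrder L] {ι : Type*} {at' : ι → L} {S : L ↪o Set ι}

/-- `ρ'` arises from the rank-like function `ρ` by lowering it by one on the upper set `U`, and `ρ` is
strictly increasing outside `U`. -/
structure IsLowering (at' : ι → L) (ρ ρ' : L → ℕ) (U : Set L) : Prop where
  rankLike : IsRankLike at' ρ
  mono : Monotone ρ'
  upper : IsUpperSet U
  top_mem : ⊤ ∈ U
  bot_notMem : ⊥ ∉ U
  of_mem : ∀ p ∈ U, ρ p = ρ' p + 1
  of_notMem : ∀ p ∉ U, ρ p = ρ' p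
  strict : ∀ p F, F ∉ U → p < F → ρ p < ρ F

variable {ρ ρ' : L → ℕ} {U : Set L}

theorem IsLowering.notMem_of_le (h : IsLowering at' ρ ρ' U) {p q : L} (hpq : p ≤ q) (hq : q ∉ U) :
    p ∉ U := fun hp => hq (h.upper hpq hp)

/-- The chains for `ρ'` enter `U` by a step over which `ρ` grows by two. -/
theorem IsLowering.exists_crossing (h : IsLowering at' ρ ρ' U) {C : Set L} (hC : IsFull ρ' C) :
    ∃ p ∈ C, ∃ q ∈ C, p ∉ U ∧ q ∈ U ∧ p < q ∧ ρ q = ρ p + 2 ∧ (∀ x ∈ C, x ∉ U → x ≤ p) ∧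
      ∀ x ∈ C, x ∈ U → q ≤ x := by
  classical
  have hfin : {x | x ∈ C ∧ x ∉ U}.Nonempty := ⟨⊥, hC.bot_mem, h.bot_notMem⟩
  have hbdd : ∃ n, ∀ j, (∃ x, (x ∈ C ∧ x ∉ U) ∧ ρ' x = j) → j ≤ n :=
    ⟨ρ' ⊤, by rintro _ ⟨x, _, rfl⟩; exact h.mono le_top⟩
  obtain ⟨n, hn⟩ := hbdd
  obtain ⟨x₀, hx₀⟩ := hfin
  -- the element of `C` outside `U` of the largest rank
  obtain ⟨p, ⟨hp, hpU⟩, hpj⟩ := Nat.findGreatest_spec (P := fun j => ∃ x, (x ∈ C ∧ x ∉ U) ∧ ρ' x = j)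
    (hn _ ⟨x₀, hx₀, rfl⟩) ⟨x₀, hx₀, rfl⟩
  have hmax : ∀ x ∈ C, x ∉ U → x ≤ p := by
    intro x hx hxU
    apply hC.le_of_le h.mono hx hp
    rw [hpj]
    exact Nat.le_findGreatest (hn _ ⟨x, ⟨hx, hxU⟩, rfl⟩) ⟨x, ⟨hx, hxU⟩, rfl⟩
  have hpt : p < ⊤ := lt_top_iff_ne_top.2 fun h' => hpU (h' ▸ h.top_mem)
  have hlt : ρ' p < ρ' ⊤ := lt_of_le_of_ne (h.mono le_top)
    fun h' => hpt.ne (hC.inj hp hC.top_mem h')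
  obtain ⟨q, hq, hqj⟩ := hC.surj (ρ' p + 1) hlt
  have hpq : p < q := hC.lt_of_lt h.mono hp hq (by omega)
  have hqU : q ∈ U := by
    by_contra hqU
    exact absurd (hmax q hq hqU) (not_le_of_gt hpq)
  refine ⟨p, hp, q, hq, hpU, hqU, hpq, ?_, hmax, ?_⟩
  · rw [h.of_mem q hqU, h.of_notMem p hpU, hqj]
  · intro x hx hxU
    rcases hC.chain.total hq hx with h' | h'
    · exact h'
    · have h1 : p < x := by
        rcases hC.chain.total hx hp with h2 | h2
        · exact absurd hxU (h.notMem_of_le h2 hpU)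
        · exact lt_of_le_of_ne h2 (by rintro rfl; exact hpU hxU)
      have h2 : ρ' p ≠ ρ' x := fun h' => h1.ne (hC.inj hp hx h')
      exact hC.le_of_le h.mono hq hx (by have := h.mono h1.le; omega)

/-- Outside `U`, `ρ` grows strictly, hence so it does over every step starting outside `U`. -/
theorem IsLowering.lt_of_lt (h : IsLowering at' ρ ρ' U) {p b : L} (hp : p ∉ U) (hpb : p < b) :
    ρ p < ρ b := by
  by_cases hb : b ∈ U
  · have := h.mono hpb.le
    rw [h.of_mem b hb, h.of_notMem p hp]
    omega
  · exact h.strict p b hb hpb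

/-- Every full chain for `ρ'` is a facet of a full chain for `ρ`. -/
theorem IsLowering.exists_isFull_insert (hS : IsSupport at' S) (h : IsLowering at' ρ ρ' U)
    {C : Set L} (hC : IsFull ρ' C) : ∃ F ∉ C, IsFull ρ (insert F C) := by
  obtain ⟨p, hp, q, hq, hpU, hqU, hpq, hρ, hle, hge⟩ := h.exists_crossing hC
  obtain ⟨i, hiq, hip⟩ := exists_of_ssubset (S.strictMono hpq)
  have hpF : p < p ⊔ at' i := left_lt_sup.2 (mt (hS i p).2 hip)
  have hFq : p ⊔ at' i ≤ q := sup_le hpq.le ((hS i q).1 hiq)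
  have hρF : ρ (p ⊔ at' i) = ρ p + 1 := by
    have h1 := h.lt_of_lt hpU hpF
    have h2 := h.rankLike.step p i
    omega
  generalize p ⊔ at' i = F at hpF hFq hρF
  have hlow : ∀ x ∈ C, x ∉ U → ρ x ≤ ρ p := fun x hx hxU => h.rankLike.mono (hle x hx hxU)
  have hup : ∀ x ∈ C, x ∈ U → ρ q ≤ ρ x := fun x hx hxU => h.rankLike.mono (hge x hx hxU)
  have hne : ∀ x ∈ C, ρ x ≠ ρ F := by
    intro x hx hxF
    by_cases hxU : x ∈ U
    · have := hup x hx hxU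
      omega
    · have := hlow x hx hxU
      omega
  refine ⟨F, fun hF => hne F hF rfl, ?_, Set.mem_insert_of_mem F hC.bot_mem,
    Set.mem_insert_of_mem F hC.top_mem, ?_, ?_⟩
  · refine hC.chain.insert fun x hx _ => ?_
    by_cases hxU : x ∈ U
    · exact Or.inl (hFq.trans (hge x hx hxU))
    · exact Or.inr ((hle x hx hxU).trans hpF.le)
  · rintro x (rfl | hx) y (rfl | hy) hxy
    · rfl
    · exact absurd hxy.symm (hne y hy)
    · exact absurd hxy (hne x hx)
    · apply hC.inj hx hy
      by_cases hxU : x ∈ U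
      · have h1 := hup x hx hxU
        by_cases hyU : y ∈ U
        · have h2 := h.of_mem x hxU
          have h3 := h.of_mem y hyU
          omega
        · have := hlow y hy hyU
          omega
      · have h1 := hlow x hx hxU
        by_cases hyU : y ∈ U
        · have := hup y hy hyU
          omega
        · rw [← h.of_notMem x hxU, ← h.of_notMem y hyU, hxy]
  · intro j hj
    have htop := h.of_mem ⊤ h.top_mem
    have hqt : ρ q ≤ ρ ⊤ := h.rankLike.mono le_top
    rcases lt_trichotomy j (ρ p + 1) with hjp | rfl | hjp
    · obtain ⟨x, hx, hxj⟩ := hC.surj j (by omega)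
      refine ⟨x, Set.mem_insert_of_mem F hx, ?_⟩
      by_cases hxU : x ∈ U
      · have := hup x hx hxU
        have := h.of_mem x hxU
        omega
      · rw [h.of_notMem x hxU, hxj]
    · exact ⟨F, Set.mem_insert F C, hρF⟩
    · obtain ⟨x, hx, hxj⟩ := hC.surj (j - 1) (by omega)
      refine ⟨x, Set.mem_insert_of_mem F hx, ?_⟩
      by_cases hxU : x ∈ U
      · have := h.of_mem x hxU
        omega
      · have := hlow x hx hxU
        have := h.of_notMem x hxU
        omega

/-- Filling the gap over which a chain for `ρ` enters `U` yields a chain for `ρ'`. -/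
theorem IsLowering.isFull_of_gap (h : IsLowering at' ρ ρ' U) {C : Set L} (h0 : ⊥ ∈ C)
    (h1 : ⊤ ∈ C) {F₀ p q : L} (hpU : p ∉ U) (hqU : q ∈ U)
    (hpq : ρ q = ρ p + 2) (hF₀ : ρ F₀ = ρ p + 1) (hsplit : ∀ x ∈ C, x ≤ p ∨ q ≤ x)
    (hfull : IsFull ρ (insert F₀ C)) : IsFull ρ' C := by
  have hlow : ∀ x, x ≤ p → ρ x ≤ ρ p ∧ ρ x = ρ' x := fun x hx =>
    ⟨h.rankLike.mono hx, h.of_notMem x (h.notMem_of_le hx hpU)⟩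
  have hup : ∀ x, q ≤ x → ρ q ≤ ρ x ∧ ρ x = ρ' x + 1 := fun x hx =>
    ⟨h.rankLike.mono hx, h.of_mem x (h.upper hx hqU)⟩
  refine ⟨hfull.chain.mono (Set.subset_insert F₀ C), h0, h1, ?_, ?_⟩
  · intro x hx y hy hxy
    apply hfull.inj (Set.mem_insert_of_mem F₀ hx) (Set.mem_insert_of_mem F₀ hy)
    rcases hsplit x hx with hx' | hx' <;> rcases hsplit y hy with hy' | hy'
    · have := hlow x hx'
      have := hlow y hy'
      omega
    · have := hlow x hx'
      have := hup y hy'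
      omega
    · have := hup x hx'
      have := hlow y hy'
      omega
    · have := hup x hx'
      have := hup y hy'
      omega
  · intro j hj
    have htop := h.of_mem ⊤ h.top_mem
    by_cases hjp : j ≤ ρ p
    · obtain ⟨x, rfl | hx, hxj⟩ := hfull.surj j (by omega)
      · omega
      · refine ⟨x, hx, ?_⟩
        rcases hsplit x hx with hx' | hx'
        · have := hlow x hx'
          omega
        · have := hup x hx'
          omega
    · obtain ⟨x, rfl | hx, hxj⟩ := hfull.surj (j + 1) (by omega)
      · omega
      · refine ⟨x, hx, ?_⟩
        rcases hsplit x hx with hx' | hx'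
        · have := hlow x hx'
          omega
        · have := hup x hx'
          omega

variable [Fintype L]

theorem IsLowering.pathEta_eq_one (h : IsLowering at' ρ ρ' U) {p q : L} (hp : p ∉ U) (hpq : p ≤ q) :
    pathEta ρ p q = 1 :=
  TropGraph.pathEta_eq_one hpq fun _ hb _ => (h.lt_of_lt hp hb).ne'

theorem IsLowering.pathEta_congr (h : IsLowering at' ρ ρ' U) {p q : L} (hpq : p ∈ U ∨ q ∉ U) :
    pathEta ρ' p q = pathEta ρ p q := by
  refine TropGraph.pathEta_congr fun b hb hbq => ?_
  rcases hpq with hp | hq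
  · have h1 := h.of_mem p hp
    have h2 := h.of_mem b (h.upper hb hp)
    omega
  · have h1 := h.of_notMem b (h.notMem_of_le hbq hq)
    have h2 := h.of_notMem p (h.notMem_of_le (hb.trans hbq) hq)
    omega

open Classical in
/-- The weight of a step crossing into `U`. The sum of the weights to `q`, over the elements at the
level of `p` for `ρ'`, is `1`; besides `p`, these are the members of `U` of the next rank for `ρ`. -/
theorem IsLowering.pathEta_crossing (h : IsLowering at' ρ ρ' U) {p q : L} (hp : p ∉ U)
    (hpq : p ≤ q) :
    pathEta ρ' p q + ∑ F with (p ≤ F ∧ F ≤ q ∧ ρ F = ρ p + 1) ∧ F ∈ U, pathEta ρ F q = 1 := by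
  have hsum : ∑ F with (p ≤ F ∧ F ≤ q ∧ ρ F = ρ p + 1) ∧ F ∈ U, pathEta ρ F q =
      ∑ F with (p ≤ F ∧ F ≤ q ∧ ρ F = ρ p + 1) ∧ F ∈ U, pathEta ρ' F q := by
    refine Finset.sum_congr rfl fun F hF => ?_
    simp only [Finset.mem_filter, Finset.mem_univ, true_and] at hF
    exact (h.pathEta_congr (Or.inl hF.2)).symm
  rw [hsum, ← sum_pathEta h.mono hpq, ← Finset.sum_singleton (fun F => pathEta ρ' F q) p,
    ← Finset.sum_union]
  · refine Finset.sum_congr ?_ fun _ _ => rfl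
    ext F
    simp only [Finset.mem_union, Finset.mem_singleton, Finset.mem_filter, Finset.mem_univ, true_and]
    have hp' := h.of_notMem p hp
    constructor
    · rintro (rfl | ⟨⟨h1, h2, h3⟩, h4⟩)
      · exact ⟨le_rfl, hpq, rfl⟩
      · have := h.of_mem F h4
        exact ⟨h1, h2, by omega⟩
    · rintro ⟨h1, h2, h3⟩
      by_cases hF : F ∈ U
      · have := h.of_mem F hF
        exact Or.inr ⟨⟨h1, h2, by omega⟩, hF⟩
      · left
        by_contra hne
        have := h.strict p F hF (lt_of_le_of_ne h1 (Ne.symm hne))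
        have := h.of_notMem F hF
        omega
  · rw [Finset.disjoint_singleton_left]
    intro hmem
    simp only [Finset.mem_filter, Finset.mem_univ, true_and] at hmem
    exact hp hmem.2

open Classical in
theorem IsLowering.chainWeight_of_gap (h : IsLowering at' ρ ρ' U) {C : Set L} {p q : L}
    (hp : p ∈ C) (hq : q ∈ C) (hpU : p ∉ U) (hqU : q ∈ U)
    (hpq : ρ q = ρ p + 2) (hsplit : ∀ x ∈ C, x ≤ p ∨ q ≤ x) (hfull' : IsFull ρ' C) :
    chainWeight ρ' C =
      (∏ x : L × L with x.1 ∈ C ∧ x.2 ∈ C ∧ ρ x.2 = ρ x.1 + 1, pathEta ρ x.1 x.2) *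
        pathEta ρ' p q := by
  have hlow : ∀ x, x ≤ p → ρ x ≤ ρ p ∧ ρ x = ρ' x := fun x hx =>
    ⟨h.rankLike.mono hx, h.of_notMem x (h.notMem_of_le hx hpU)⟩
  have hup : ∀ x, q ≤ x → ρ q ≤ ρ x ∧ ρ x = ρ' x + 1 := fun x hx =>
    ⟨h.rankLike.mono hx, h.of_mem x (h.upper hx hqU)⟩
  have hprod : ∏ x : L × L with x.1 ∈ C ∧ x.2 ∈ C ∧ ρ x.2 = ρ x.1 + 1, pathEta ρ x.1 x.2 =
      ∏ x : L × L with x.1 ∈ C ∧ x.2 ∈ C ∧ ρ x.2 = ρ x.1 + 1, pathEta ρ' x.1 x.2 := by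
    refine Finset.prod_congr rfl ?_
    rintro ⟨x, y⟩ hxy
    simp only [Finset.mem_filter, Finset.mem_univ, true_and] at hxy
    obtain ⟨hx, hy, hxy⟩ := hxy
    symm
    apply h.pathEta_congr
    rcases hsplit x hx with hx' | hx'
    · right
      rcases hsplit y hy with hy' | hy'
      · exact h.notMem_of_le hy' hpU
      · have := hlow x hx'
        have := hup y hy'
        omega
    · exact Or.inl (h.upper hx' hqU)
  rw [chainWeight, if_pos hfull', hprod,
    ← Finset.prod_singleton (fun x : L × L => pathEta ρ' x.1 x.2) (p, q), ← Finset.prod_union]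
  · refine Finset.prod_congr ?_ fun _ _ => rfl
    ext ⟨x, y⟩
    simp only [Finset.mem_union, Finset.mem_singleton, Finset.mem_filter, Finset.mem_univ, true_and,
      Prod.mk.injEq]
    have hp' := hlow p le_rfl
    have hq' := hup q le_rfl
    constructor
    · rintro ⟨hx, hy, hxy⟩
      rcases hsplit x hx with hx' | hx' <;> rcases hsplit y hy with hy' | hy'
      · have := hlow x hx'
        have := hlow y hy'
        exact Or.inl ⟨hx, hy, by omega⟩
      · have := hlow x hx'
        have := hup y hy'
        right
        exact ⟨hfull'.inj hx hp (by omega), hfull'.inj hy hq (by omega)⟩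
      · have := hup x hx'
        have := hlow y hy'
        omega
      · have := hup x hx'
        have := hup y hy'
        exact Or.inl ⟨hx, hy, by omega⟩
    · rintro (⟨hx, hy, hxy⟩ | ⟨rfl, rfl⟩)
      · refine ⟨hx, hy, ?_⟩
        rcases hsplit x hx with hx' | hx' <;> rcases hsplit y hy with hy' | hy'
        · have := hlow x hx'
          have := hlow y hy'
          omega
        · have := hlow x hx'
          have := hup y hy'
          omega
        · have := hup x hx'
          have := hlow y hy'
          omega
        · have := hup x hx'
          have := hup y hy'
          omega
      · exact ⟨hp, hq, by omega⟩
  · rw [Finset.disjoint_singleton_right]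
    intro hmem
    simp only [Finset.mem_filter, Finset.mem_univ, true_and] at hmem
    omega

theorem linExt_zero (φ : (ι → ℤ) → ℤ) (τ : Finset (ι → ℤ)) : linExt φ τ 0 = 0 := by
  unfold linExt
  split_ifs <;> simp

variable [Finite ι] [Nonempty ι]

/-- The divisor of the function `-1` on `U` and `0` elsewhere lowers the rank function on `U`. -/
theorem weilDivisor_rankFan (hS : IsBounded S) (hat : IsSupport at' S) (h : IsLowering at' ρ ρ' U)
    {φ : (ι → ℤ) → ℤ} (hφ : ∀ p ∈ U, φ (chi (S p)) = -1) (hφ' : ∀ p ∉ U, φ (chi (S p)) = 0)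
    (hneg : φ (-chi univ) = -φ (chi univ)) :
    weilDivisor φ (rankFan S ρ) = rankFan S ρ' := by
  classical
  ext τ
  have hdef : weilDivisor φ (rankFan S ρ) τ = starSum (rankFan S ρ) τ φ -
      linExt φ τ (starSum (rankFan S ρ) τ (fun v => v)) := rfl
  rw [hdef]
  by_cases hτ : ∃ (C₀ : Set L) (s : ℤ), ⊥ ∈ C₀ ∧ ⊤ ∈ C₀ ∧ (s = 1 ∨ s = -1) ∧
      τ = flagCone (S '' C₀) s
  swap
  · rw [not_exists] at hτ
    have h1 : rankFan S ρ' τ = 0 := by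
      by_contra hne
      obtain ⟨C, s, hC0, hC1, hs, -, rfl⟩ := exists_of_chainFan_apply_ne_zero hS
        (isBoundedWeight_chainWeight ρ') hne
      exact hτ C ⟨s, hC0, hC1, hs, rfl⟩
    have hτ' : ∀ (C : Set L) (s : ℤ), ⊥ ∈ C → ⊤ ∈ C → (s = 1 ∨ s = -1) →
        τ ≠ flagCone (S '' C) s := fun C s hC0 hC1 hs hC => hτ C ⟨s, hC0, hC1, hs, hC⟩
    rw [h1, rankFan, starSum_chainFan_of_odd hS (isBoundedWeight_chainWeight ρ) hτ' φ hneg,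
      starSum_chainFan_of_odd hS (isBoundedWeight_chainWeight ρ) hτ' (fun v => v) rfl,
      linExt_zero, sub_zero]
  obtain ⟨C, s, h0, h1, hs, rfl⟩ := hτ
  rw [show rankFan S ρ' (flagCone (S '' C) s) = chainWeight ρ' C from
    chainFan_apply_cone hS (isBoundedWeight_chainWeight ρ') h0 h1 hs]
  by_cases hex : ∃ F₀ ∉ C, IsFull ρ (insert F₀ C)
  swap
  · rw [chainWeight, if_neg fun hfull => hex (h.exists_isFull_insert hat hfull)]
    push Not at hex
    rw [starSum_rankFan_eq_zero hS h0 h1 hs hex, starSum_rankFan_eq_zero hS h0 h1 hs hex,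
      linExt_zero, sub_zero]
  obtain ⟨F₀, hF₀, hfull⟩ := hex
  obtain ⟨p, hp, q, hq, hle, hpq, hF₀p, hsplit, hmiss, hgap⟩ :=
    exists_gap h.rankLike.mono h0 h1 hF₀ hfull
  obtain ⟨l, hl, hlin⟩ := (hasDual_flagCone (univ_mem_image hS h1) (isChain_image_embedding
    (hfull.chain.mono (Set.subset_insert F₀ C))) hs).exists_linExt φ
  -- the linear extension has the values of `φ` at the vectors of the chain
  have hlchi : ∀ x ∈ C, l (chi (S x)) = φ (chi (S x)) := by
    intro x hx
    by_cases hxb : x = ⊥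
    · rw [hxb, hφ' ⊥ h.bot_notMem, hS.bot, chi_empty, map_zero]
    · have h2 := hl _ ((rayVec_mem_flagCone_image hS h1 hs hxb).2 hx)
      by_cases hxu : S x = univ
      · rw [hxu, rayVec_univ] at h2
        rw [hxu]
        rcases hs with rfl | rfl
        · rwa [one_smul] at h2
        · rw [neg_one_smul, map_neg, hneg] at h2
          exact neg_injective h2
      · rwa [rayVec_of_ne hxu] at h2
  rw [hlin, starSum_rankFan hS h0 h1 hs hp hq hpq hgap, starSum_rankFan hS h0 h1 hs hp hq hpq hgap,
    sum_smul_chi hat h.rankLike hle]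
  simp only [map_smul, map_add, map_sub, hlchi p hp, hlchi q hq, smul_eq_mul]
  -- a full chain for `ρ'` enters `U` across the gap
  have hcross : IsFull ρ' C → p ∉ U ∧ q ∈ U := by
    intro hfull'
    obtain ⟨p₁, hp₁, q₁, hq₁, hp₁U, hq₁U, -, hρ, hle₁, hge₁⟩ := h.exists_crossing hfull'
    have hF₀1 : ρ F₀ = ρ p₁ + 1 := by
      have : ρ q₁ ≤ ρ ⊤ := h.rankLike.mono le_top
      obtain ⟨y, rfl | hy, hyj⟩ := hfull.surj (ρ p₁ + 1) (by omega)
      · exact hyj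
      · by_cases hyU : y ∈ U
        · have := h.rankLike.mono (hge₁ y hy hyU)
          omega
        · have := h.rankLike.mono (hle₁ y hy hyU)
          omega
    have e1 : p = p₁ := hfull.inj (Set.mem_insert_of_mem F₀ hp) (Set.mem_insert_of_mem F₀ hp₁)
      (by omega)
    have e2 : q = q₁ := hfull.inj (Set.mem_insert_of_mem F₀ hq) (Set.mem_insert_of_mem F₀ hq₁)
      (by omega)
    rw [e1, e2]
    exact ⟨hp₁U, hq₁U⟩
  by_cases hpU : p ∈ U
  · have hqU := h.upper hle hpU
    rw [chainWeight, if_neg fun hfull' => (hcross hfull').1 hpU, hφ p hpU, hφ q hqU,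
      Finset.sum_congr rfl fun F hF => by
        simp only [Finset.mem_filter, Finset.mem_univ, true_and] at hF
        rw [hφ F (h.upper hF.1 hpU)], ← Finset.sum_mul]
    ring
  by_cases hqU : q ∈ U
  · have hfull' := h.isFull_of_gap h0 h1 hpU hqU hpq hF₀p hsplit hfull
    have hsum : ∑ F with p ≤ F ∧ F ≤ q ∧ ρ F = ρ p + 1,
        pathEta ρ p F * pathEta ρ F q * φ (chi (S F)) =
        -∑ F with (p ≤ F ∧ F ≤ q ∧ ρ F = ρ p + 1) ∧ F ∈ U, pathEta ρ F q := by
      rw [← Finset.sum_neg_distrib, Finset.sum_filter, Finset.sum_filter]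
      refine Finset.sum_congr rfl fun F _ => ?_
      by_cases hF : p ≤ F ∧ F ≤ q ∧ ρ F = ρ p + 1
      · rw [if_pos hF, h.pathEta_eq_one hpU hF.1]
        by_cases hFU : F ∈ U
        · rw [if_pos ⟨hF, hFU⟩, hφ F hFU]
          ring
        · rw [if_neg fun h' => hFU h'.2, hφ' F hFU, mul_zero]
      · rw [if_neg hF, if_neg fun h' => hF h'.1]
    rw [h.chainWeight_of_gap hp hq hpU hqU hpq hsplit hfull', hφ' p hpU, hφ q hqU, hsum,
      h.pathEta_eq_one hpU hle, ← eq_sub_iff_add_eq.2 (h.pathEta_crossing hpU hle) |>.symm]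
    ring
  · rw [chainWeight, if_neg fun hfull' => hqU (hcross hfull').2, hφ' p hpU, hφ' q hqU,
      Finset.sum_congr rfl fun F hF => by
        simp only [Finset.mem_filter, Finset.mem_univ, true_and] at hF
        rw [hφ' F (h.notMem_of_le hF.2.1 hqU)], ← Finset.sum_mul]
    ring

end Divisor

/-! ### Flag fans determine their pairs up to rescaling -/

section FlagPairs

variable {ι : Type*}

instance (P : FlagPair ι) : BoundedOrder P.Vertex where
  bot := ⟨∅, P.empty_mem⟩
  bot_le := P.empty_le
  top := ⟨univ, P.univ_mem⟩
  le_top := P.le_univ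

namespace FlagPair

variable (P : FlagPair ι)

theorem val_bot : (⊥ : P.Vertex).1 = ∅ := rfl

theorem val_top : (⊤ : P.Vertex).1 = univ := rfl

variable {P}

theorem val_subset {A B : P.Vertex} (h : A ≤ B) : A.1 ⊆ B.1 := P.subset_of_le A B h

theorem val_injective : Function.Injective (fun A : P.Vertex => A.1) := Subtype.val_injective

theorem edge_val_iff {A B : P.Vertex} : P.Edge A.1 B.1 ↔ A ⋖ B := by
  constructor
  · rintro ⟨A', B', hA, hB, h⟩
    rwa [← Subtype.ext hA, ← Subtype.ext hB]
  · exact fun h => ⟨A, B, rfl, rfl, h⟩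

/-- Along a flag, the order is the inclusion order. -/
theorem lt_iff_ssubset (c : Flag P.Vertex) {A B : P.Vertex} (hA : A ∈ c) (hB : B ∈ c) :
    A < B ↔ A.1 ⊂ B.1 := by
  constructor
  · intro h
    exact (val_subset h.le).ssubset_of_ne fun h' => h.ne (Subtype.ext h')
  · intro h
    rcases c.le_or_le hA hB with h' | h'
    · exact lt_of_le_of_ne h' (by rintro rfl; exact h.ne rfl)
    · exact absurd (val_subset h') h.2

/-- The edges between elements of a flag are the pairs of consecutive sets. -/
theorem covBy_iff_of_mem_flag (c : Flag P.Vertex) {A B : P.Vertex} (hA : A ∈ c) (hB : B ∈ c) :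
    A ⋖ B ↔ A.1 ⊂ B.1 ∧ ∀ X ∈ (fun A : P.Vertex => A.1) '' (c : Set P.Vertex),
      ¬ (A.1 ⊂ X ∧ X ⊂ B.1) := by
  constructor
  · intro h
    refine ⟨(lt_iff_ssubset c hA hB).1 h.lt, ?_⟩
    rintro _ ⟨X, hX, rfl⟩ ⟨h1, h2⟩
    exact h.2 ((lt_iff_ssubset c hA hX).2 h1) ((lt_iff_ssubset c hX hB).2 h2)
  · rintro ⟨h, h'⟩
    refine ⟨(lt_iff_ssubset c hA hB).2 h, fun X hAX hXB => ?_⟩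
    have hXc : X ∈ c := by
      have hch : IsChain (· ≤ ·) (insert X (c : Set P.Vertex)) := by
        refine c.chain_le.insert fun Z hZ _ => ?_
        rcases c.le_or_le hZ hA with h1 | h1
        · exact Or.inr (h1.trans hAX.le)
        · rcases c.le_or_le hB hZ with h2 | h2
          · exact Or.inl (hXB.le.trans h2)
          · rcases h1.eq_or_lt with rfl | h1
            · exact Or.inr hAX.le
            · rcases h2.eq_or_lt with rfl | h2
              · exact Or.inl hXB.le
              · exact absurd ⟨(lt_iff_ssubset c hA hZ).1 h1, (lt_iff_ssubset c hZ hB).1 h2⟩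
                  (h' Z.1 ⟨Z, hZ, rfl⟩)
      rw [← SetLike.mem_coe, c.maxChain.2 hch (Set.subset_insert _ _)]
      exact Set.mem_insert _ _
    exact h' X.1 ⟨X, hXc, rfl⟩ ⟨(lt_iff_ssubset c hA hXc).1 hAX, (lt_iff_ssubset c hXc hB).1 hXB⟩

theorem univ_mem_flag (c : Flag P.Vertex) :
    univ ∈ (fun A : P.Vertex => A.1) '' (c : Set P.Vertex) := ⟨⊤, c.top_mem, rfl⟩

theorem empty_mem_flag (c : Flag P.Vertex) :
    ∅ ∈ (fun A : P.Vertex => A.1) '' (c : Set P.Vertex) := ⟨⊥, c.bot_mem, rfl⟩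

variable (P) in
theorem exists_isRanking [Finite ι] : ∃ ρ : P.Vertex → ℕ, IsRanking ρ := by
  obtain ⟨r, hr⟩ := P.ranked
  let r' : P.Vertex → ℕ := r
  have hcov : ∀ A B : P.Vertex, A ⋖ B → r' B = r' A + 1 := fun A B h => hr A B h
  have hmono : StrictMono r' := strictMono_of_covBy hcov
  refine ⟨fun A => r' A - r' ⊥, ⟨Nat.sub_self _, fun A B h => ?_⟩⟩
  have h1 := hcov A B h
  have h2 := hmono.monotone (bot_le : ⊥ ≤ A)
  omega

section Weights

variable [Finite ι]

open Classical in
/-- The product of a function of pairs of sets along the edges of a flag. -/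
noncomputable def edgeProd {A : Type*} [CommMonoid A] (w : Set ι → Set ι → A) (c : Flag P.Vertex) :
    A :=
  letI : Fintype P.Vertex := Fintype.ofFinite _
  ∏ p : P.Vertex × P.Vertex with p.1 ∈ c ∧ p.2 ∈ c ∧ p.1 ⋖ p.2, w p.1.1 p.2.1

open Classical in
theorem edgeProd_eq [Fintype P.Vertex] {A : Type*} [CommMonoid A] (w : Set ι → Set ι → A)
    (c : Flag P.Vertex) : edgeProd w c =
      ∏ p : P.Vertex × P.Vertex with p.1 ∈ c ∧ p.2 ∈ c ∧ p.1 ⋖ p.2, w p.1.1 p.2.1 := by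
  unfold edgeProd
  congr!

theorem flagFan_eq : P.flagFan =
    ∑ᶠ c : Flag P.Vertex, flagCones ((fun A : P.Vertex => A.1) '' (c : Set P.Vertex))
      (edgeProd P.weight c) := rfl

open Classical in
theorem flagFan_eq_finsum_isFull [Fintype P.Vertex] {ρ : P.Vertex → ℕ} (hρ : IsRanking ρ) :
    P.flagFan = ∑ᶠ C : Set P.Vertex, if IsFull ρ C then
      flagCones ((fun A : P.Vertex => A.1) '' C)
        (∏ p : P.Vertex × P.Vertex with p.1 ∈ C ∧ p.2 ∈ C ∧ p.1 ⋖ p.2, P.weight p.1.1 p.2.1)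
      else 0 := by
  rw [flagFan_eq, ← finsum_flag hρ]
  refine finsum_congr fun c => ?_
  rw [edgeProd_eq]
  rfl

theorem edgeProd_weight_ne_zero (hP : P.Reduced) (c : Flag P.Vertex) :
    edgeProd P.weight c ≠ 0 := by
  classical
  unfold edgeProd
  refine Finset.prod_ne_zero_iff.2 fun p hp => ?_
  rw [Finset.mem_filter] at hp
  exact hP _ _ (edge_val_iff.2 hp.2.2.2)

/-- The product along a flag only depends on the sets of the flag. -/
theorem edgeProd_congr {Q : FlagPair ι} {A : Type*} [CommMonoid A] (w : Set ι → Set ι → A)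
    {c : Flag P.Vertex} {d : Flag Q.Vertex}
    (h : (fun A : P.Vertex => A.1) '' (c : Set P.Vertex) =
      (fun A : Q.Vertex => A.1) '' (d : Set Q.Vertex)) : edgeProd w c = edgeProd w d := by
  classical
  have key : ∀ (R : FlagPair ι) (e : Flag R.Vertex),
      edgeProd w e = ∏ᶠ x : Set ι × Set ι, ∏ᶠ (_ : ∃ A B : R.Vertex, A ∈ e ∧ B ∈ e ∧ A ⋖ B ∧
        x = (A.1, B.1)), w x.1 x.2 := by
    intro R e
    unfold edgeProd
    have hinj : Function.Injective fun p : R.Vertex × R.Vertex => ((p.1.1, p.2.1) : Set ι × Set ι) :=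
      fun p q hpq => Prod.ext (Subtype.ext (Prod.ext_iff.1 hpq).1)
        (Subtype.ext (Prod.ext_iff.1 hpq).2)
    rw [← Finset.prod_image (f := fun x : Set ι × Set ι => w x.1 x.2)
      (g := fun p : R.Vertex × R.Vertex => ((p.1.1, p.2.1) : Set ι × Set ι)) hinj.injOn,
      ← finprod_mem_coe_finset]
    refine finprod_congr fun x => finprod_congr_Prop (propext ?_) fun _ => rfl
    rw [Finset.mem_coe, Finset.mem_image]
    simp only [Finset.mem_filter, Finset.mem_univ, true_and, Prod.exists]
    constructor
    · rintro ⟨A, B, ⟨h1, h2, h3⟩, h4⟩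
      exact ⟨A, B, h1, h2, h3, h4.symm⟩
    · rintro ⟨A, B, h1, h2, h3, h4⟩
      exact ⟨A, B, ⟨h1, h2, h3⟩, h4.symm⟩
  have hdir : ∀ (R R' : FlagPair ι) (e : Flag R.Vertex) (e' : Flag R'.Vertex),
      (fun A : R.Vertex => A.1) '' (e : Set R.Vertex) =
        (fun A : R'.Vertex => A.1) '' (e' : Set R'.Vertex) → ∀ x : Set ι × Set ι,
      (∃ A B : R.Vertex, A ∈ e ∧ B ∈ e ∧ A ⋖ B ∧ x = (A.1, B.1)) →
      ∃ A B : R'.Vertex, A ∈ e' ∧ B ∈ e' ∧ A ⋖ B ∧ x = (A.1, B.1) := by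
    rintro R R' e e' hee _ ⟨A, B, hA, hB, hAB, rfl⟩
    obtain ⟨A', hA', hAA⟩ : A.1 ∈ (fun A : R'.Vertex => A.1) '' (e' : Set R'.Vertex) :=
      hee ▸ ⟨A, hA, rfl⟩
    obtain ⟨B', hB', hBB⟩ : B.1 ∈ (fun A : R'.Vertex => A.1) '' (e' : Set R'.Vertex) :=
      hee ▸ ⟨B, hB, rfl⟩
    simp only at hAA hBB
    refine ⟨A', B', hA', hB', ?_, by rw [hAA, hBB]⟩
    rw [covBy_iff_of_mem_flag e' hA' hB', ← hee, hAA, hBB]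
    exact (covBy_iff_of_mem_flag e hA hB).1 hAB
  rw [key P c, key Q d]
  exact finprod_congr fun x => finprod_congr_Prop
    (propext ⟨hdir P Q c d h x, hdir Q P d c h.symm x⟩) fun _ => rfl

instance : Finite (Flag P.Vertex) :=
  Finite.of_injective (fun c : Flag P.Vertex => (c : Set P.Vertex)) SetLike.coe_injective

variable [Nonempty ι]

theorem flagFan_apply_flag (c : Flag P.Vertex) :
    P.flagFan (flagCone ((fun A : P.Vertex => A.1) '' (c : Set P.Vertex)) 1) =
      edgeProd P.weight c := by
  classical
  let _ : Fintype (Flag P.Vertex) := Fintype.ofFinite _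
  rw [flagFan_eq, finsum_eq_sum_of_fintype, Finsupp.finsetSum_apply, Finset.sum_eq_single c]
  · rw [flagCones_eq (univ_mem_flag c), Finsupp.add_apply, Finsupp.single_eq_same,
      Finsupp.single_apply, if_neg, add_zero]
    intro h
    have := (flagCone_inj (univ_mem_flag c) (univ_mem_flag c) (empty_mem_flag c) (empty_mem_flag c)
      (Or.inr rfl) (Or.inl rfl) h).2
    norm_num at this
  · intro d _ hdc
    rw [flagCones_eq (univ_mem_flag d), Finsupp.add_apply, Finsupp.single_apply,
      Finsupp.single_apply, if_neg, if_neg, add_zero]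
    · intro h
      have := (flagCone_inj (univ_mem_flag d) (univ_mem_flag c) (empty_mem_flag d)
        (empty_mem_flag c) (Or.inr rfl) (Or.inl rfl) h).2
      norm_num at this
    · intro h
      have := (flagCone_inj (univ_mem_flag d) (univ_mem_flag c) (empty_mem_flag d)
        (empty_mem_flag c) (Or.inl rfl) (Or.inl rfl) h).1
      exact hdc (SetLike.coe_injective (val_injective.image_injective this))
  · simp

theorem exists_flag_of_flagFan_apply_ne_zero {D : Set (Set ι)} (hu : univ ∈ D) (h0 : ∅ ∈ D)
    (h : P.flagFan (flagCone D 1) ≠ 0) :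
    ∃ c : Flag P.Vertex, (fun A : P.Vertex => A.1) '' (c : Set P.Vertex) = D := by
  classical
  let _ : Fintype (Flag P.Vertex) := Fintype.ofFinite _
  rw [flagFan_eq, finsum_eq_sum_of_fintype, Finsupp.finsetSum_apply] at h
  obtain ⟨c, _, hc⟩ := Finset.exists_ne_zero_of_sum_ne_zero h
  refine ⟨c, ?_⟩
  rw [flagCones_eq (univ_mem_flag c), Finsupp.add_apply, Finsupp.single_apply,
    Finsupp.single_apply] at hc
  by_cases h1 : flagCone ((fun A : P.Vertex => A.1) '' (c : Set P.Vertex)) 1 = flagCone D 1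
  · exact (flagCone_inj (univ_mem_flag c) hu (empty_mem_flag c) h0 (Or.inl rfl) (Or.inl rfl) h1).1
  · by_cases h2 : flagCone ((fun A : P.Vertex => A.1) '' (c : Set P.Vertex)) (-1) = flagCone D 1
    · exact (flagCone_inj (univ_mem_flag c) hu (empty_mem_flag c) h0 (Or.inr rfl) (Or.inl rfl)
        h2).1
    · rw [if_neg h1, if_neg h2, add_zero] at hc
      exact absurd rfl hc

/-- Reduced pairs with the same Flag fan have the same maximal flags of sets. -/
theorem exists_flag_image_eq {Q : FlagPair ι} (hP : P.Reduced) (h : P.flagFan = Q.flagFan)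
    (c : Flag P.Vertex) : ∃ d : Flag Q.Vertex,
      (fun A : P.Vertex => A.1) '' (c : Set P.Vertex) =
        (fun A : Q.Vertex => A.1) '' (d : Set Q.Vertex) ∧
      edgeProd P.weight c = edgeProd Q.weight d := by
  have h1 := flagFan_apply_flag c
  have h2 : Q.flagFan (flagCone ((fun A : P.Vertex => A.1) '' (c : Set P.Vertex)) 1) ≠ 0 := by
    rw [← h, h1]
    exact edgeProd_weight_ne_zero hP c
  obtain ⟨d, hd⟩ := exists_flag_of_flagFan_apply_ne_zero (univ_mem_flag c) (empty_mem_flag c) h2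
  refine ⟨d, hd.symm, ?_⟩
  rw [← h1, h, ← hd, flagFan_apply_flag d]

/-- Every edge is a pair of consecutive sets of a maximal flag, and the Flag fan determines these. -/
theorem edge_of_flagFan_eq {Q : FlagPair ι} (hP : P.Reduced) (h : P.flagFan = Q.flagFan)
    {S T : Set ι} (hST : P.Edge S T) : Q.Edge S T := by
  obtain ⟨A, B, rfl, rfl, hAB⟩ := hST
  obtain ⟨c, hc⟩ := (IsChain.pair (r := (· ≤ ·)) hAB.le).exists_subset_flag
  have hA : A ∈ c := hc (Set.mem_insert _ _)
  have hB : B ∈ c := hc (Set.mem_insert_of_mem _ rfl)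
  obtain ⟨d, hd, -⟩ := exists_flag_image_eq hP h c
  obtain ⟨A', hA', hAA⟩ : A.1 ∈ (fun A : Q.Vertex => A.1) '' (d : Set Q.Vertex) :=
    hd ▸ ⟨A, hA, rfl⟩
  obtain ⟨B', hB', hBB⟩ : B.1 ∈ (fun A : Q.Vertex => A.1) '' (d : Set Q.Vertex) :=
    hd ▸ ⟨B, hB, rfl⟩
  simp only at hAA hBB
  refine ⟨A', B', hAA, hBB, ?_⟩
  rw [covBy_iff_of_mem_flag d hA' hB', ← hd, hAA, hBB]
  exact (covBy_iff_of_mem_flag c hA hB).1 hAB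

/-- The weights of two reduced pairs with the same Flag fan agree up to rescaling at the vertices. -/
theorem exists_rescaling {Q : FlagPair ι} (hP : P.Reduced) (hQ : Q.Reduced)
    (h : P.flagFan = Q.flagFan) :
    ∃ c : Set ι → ℚ, c ∅ = 1 ∧ c univ = 1 ∧ (∀ S ∈ P.carrier, c S ≠ 0) ∧
      ∀ S T, P.Edge S T → c S * P.weight S T = Q.weight S T * c T := by
  classical
  let _ : Fintype P.Vertex := Fintype.ofFinite _
  obtain ⟨ρ, hρ⟩ := P.exists_isRanking
  have hne : ∀ A B : P.Vertex, A ⋖ B →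
      (P.weight A.1 B.1 : ℚ) ≠ 0 ∧ (Q.weight A.1 B.1 : ℚ) ≠ 0 := fun A B hAB =>
    ⟨Int.cast_ne_zero.2 (hP _ _ (edge_val_iff.2 hAB)),
      Int.cast_ne_zero.2 (hQ _ _ (edge_of_flagFan_eq hP h (edge_val_iff.2 hAB)))⟩
  have hprod : ∀ c : Flag P.Vertex, ∏ x : P.Vertex × P.Vertex with x.1 ∈ c ∧ x.2 ∈ c ∧ x.1 ⋖ x.2,
      (P.weight x.1.1 x.2.1 / Q.weight x.1.1 x.2.1 : ℚ) = 1 := by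
    intro c
    obtain ⟨d, hd, hw⟩ := exists_flag_image_eq hP h c
    rw [← edgeProd_congr Q.weight hd, edgeProd_eq, edgeProd_eq] at hw
    rw [Finset.prod_div_distrib, ← Int.cast_prod, ← Int.cast_prod, hw, div_self]
    rw [← hw, ← edgeProd_eq]
    exact Int.cast_ne_zero.2 (edgeProd_weight_ne_zero hP c)
  obtain ⟨c, hbot, htop, hc, hcr⟩ := exists_potential hρ
    (fun A B : P.Vertex => (P.weight A.1 B.1 / Q.weight A.1 B.1 : ℚ))
    (fun A B hAB => div_ne_zero (hne A B hAB).1 (hne A B hAB).2) hprod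
  have hext : ∀ A : P.Vertex, Function.extend (fun A : P.Vertex => A.1) c 1 A.1 = c A :=
    val_injective.extend_apply c 1
  refine ⟨Function.extend (fun A : P.Vertex => A.1) c 1, (hext ⊥).trans hbot, (hext ⊤).trans htop,
    fun S hS => ?_, ?_⟩
  · rw [hext ⟨S, hS⟩]
    exact hc _
  · rintro _ _ ⟨A, B, rfl, rfl, hAB⟩
    have h2 := (hne A B hAB).2
    rw [hext, hext, ← hcr A B hAB]
    field_simp

end Weights

end FlagPair

end FlagPairs

/-! ### The lattice of flats -/

section Lattice

variable {α : Type*} {M : Matroid α}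

/-- The flat spanned by a set. -/
def flatCl (M : Matroid α) (X : Set α) : Flats M := ⟨M.closure X, M.isFlat_closure X⟩

theorem flatCl_le_iff {X : Set α} (hX : X ⊆ M.E) {F : Flats M} : flatCl M X ≤ F ↔ X ⊆ F.1 := by
  constructor
  · exact fun h => (M.subset_closure X hX).trans h
  · intro h
    have := M.closure_subset_closure h
    rwa [F.2.closure] at this

theorem Flats.subset_ground (F : Flats M) : F.1 ⊆ M.E := F.2.subset_ground

instance : Lattice (Flats M) :=
  { (inferInstance : PartialOrder (Flats M)) with
    sup := fun F G => flatCl M (F.1 ∪ G.1)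
    le_sup_left := fun F G => (subset_union_left.trans
      (M.subset_closure _ (union_subset F.subset_ground G.subset_ground)) : F.1 ⊆ _)
    le_sup_right := fun F G => (subset_union_right.trans
      (M.subset_closure _ (union_subset F.subset_ground G.subset_ground)) : G.1 ⊆ _)
    sup_le := fun F G _ hF hG => (flatCl_le_iff
      (union_subset F.subset_ground G.subset_ground)).2 (union_subset hF hG)
    inf := fun F G => ⟨F.1 ∩ G.1, Matroid.isFlat_iff_closure_eq.2 <| Subset.antisymm
      (subset_inter ((M.closure_subset_closure inter_subset_left).trans F.2.closure.subset)
        ((M.closure_subset_closure inter_subset_right).trans G.2.closure.subset))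
      (M.subset_closure _ (inter_subset_left.trans F.subset_ground))⟩
    inf_le_left := fun F G => (inter_subset_left : F.1 ∩ G.1 ⊆ F.1)
    inf_le_right := fun F G => (inter_subset_right : F.1 ∩ G.1 ⊆ G.1)
    le_inf := fun F G H hG hH => (subset_inter hG hH : F.1 ⊆ G.1 ∩ H.1) }

theorem sup_val (F G : Flats M) : (F ⊔ G).1 = M.closure (F.1 ∪ G.1) := rfl

instance [M.Loopless] : BoundedOrder (Flats M) where
  bot := ⟨∅, Matroid.isFlat_iff_closure_eq.2 (by rw [M.closure_empty, M.loops_eq_empty])⟩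
  bot_le F := empty_subset F.1
  top := ⟨M.E, M.ground_isFlat⟩
  le_top F := F.subset_ground

theorem bot_val [M.Loopless] : (⊥ : Flats M).1 = ∅ := rfl

theorem rk_closure (X : Set α) : rk M (M.closure X) = rk M X := by
  rw [rk, rk, M.eRk_closure_eq]

theorem rk_empty : rk M ∅ = 0 := by
  rw [rk, M.eRk_empty, ENat.toNat_zero]

theorem rk_union_closure (X Y : Set α) : rk M (X ∪ M.closure Y) = rk M (X ∪ Y) := by
  rw [rk, rk, M.eRk_union_closure_right_eq]

variable [M.Finite]

theorem cast_rk (M : Matroid α) [M.Finite] (X : Set α) : (rk M X : ℕ∞) = M.eRk X :=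
  ENat.natCast_toNat (Matroid.eRk_ne_top_iff.2 (M.isRkFinite_set X))

theorem rk_mono {X Y : Set α} (h : X ⊆ Y) : rk M X ≤ rk M Y := by
  rw [← ENat.natCast_le_natCast, cast_rk, cast_rk]
  exact M.eRk_mono h

theorem rk_insert_le (e : α) (X : Set α) : rk M (insert e X) ≤ rk M X + 1 := by
  rw [← ENat.natCast_le_natCast, cast_rk, Nat.cast_add, cast_rk]
  exact M.eRk_insert_le_add_one e X

theorem rk_union_le (X Y : Set α) : rk M (X ∪ Y) ≤ rk M X + rk M Y := by
  rw [← ENat.natCast_le_natCast, cast_rk, Nat.cast_add, cast_rk, cast_rk]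
  exact M.eRk_union_le_eRk_add_eRk X Y

theorem Flats.eq_of_le_of_rk_le {F G : Flats M} (h : F ≤ G) (hr : rk M G.1 ≤ rk M F.1) : F = G := by
  rw [← ENat.natCast_le_natCast, cast_rk, cast_rk] at hr
  have := (M.isRkFinite_set F.1).closure_eq_closure_of_subset_of_eRk_ge_eRk h hr
  rw [F.2.closure, G.2.closure] at this
  exact Subtype.ext this

theorem Flats.rk_strictMono : StrictMono (fun F : Flats M => rk M F.1) := by
  intro F G h
  by_contra hr
  exact h.ne (Flats.eq_of_le_of_rk_le h.le (not_lt.1 hr))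

theorem rk_sup_singleton_le (F : Flats M) (e : α) : rk M (F ⊔ flatCl M {e}).1 ≤ rk M F.1 + 1 := by
  rw [sup_val, rk_closure]
  change rk M (F.1 ∪ M.closure {e}) ≤ _
  rw [rk_union_closure, union_singleton]
  exact rk_insert_le e F.1

theorem Flats.covBy_or_eq_sup_singleton (F : Flats M) (e : α) :
    F ⋖ F ⊔ flatCl M {e} ∨ F ⊔ flatCl M {e} = F := by
  rcases (le_sup_left : F ≤ F ⊔ flatCl M {e}).eq_or_lt with h | h
  · exact Or.inr h.symm
  · refine Or.inl ⟨h, fun G hFG hG => ?_⟩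
    have h1 := Flats.rk_strictMono hFG
    have h2 := Flats.rk_strictMono hG
    have h3 := rk_sup_singleton_le F e
    simp only at h1 h2
    omega

/-- The rank grows by at most one under a cover of flats, also after adding a further set. -/
theorem rk_union_le_of_covBy {F G : Flats M} (h : F ⋖ G) (X : Set α) :
    rk M (G.1 ∪ X) ≤ rk M (F.1 ∪ X) + 1 := by
  obtain ⟨e, heG, heF⟩ := exists_of_ssubset (Subtype.coe_lt_coe.2 h.lt : F.1 ⊂ G.1)
  have he : ({e} : Set α) ⊆ M.E := singleton_subset_iff.2 (G.subset_ground heG)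
  have hG : F ⊔ flatCl M {e} = G := by
    have hle : F ⊔ flatCl M {e} ≤ G :=
      sup_le h.le ((flatCl_le_iff he).2 (singleton_subset_iff.2 heG))
    rcases h.eq_or_eq le_sup_left hle with h' | h'
    · exact absurd (singleton_subset_iff.1 ((flatCl_le_iff he).1 (sup_eq_left.1 h'))) heF
    · exact h'
  have h1 : rk M (G.1 ∪ X) = rk M (insert e (F.1 ∪ X)) := by
    rw [← hG, sup_val, union_comm, rk_union_closure]
    change rk M (X ∪ (F.1 ∪ M.closure {e})) = _
    rw [← union_assoc, rk_union_closure, union_singleton, union_comm X]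
  rw [h1]
  exact rk_insert_le e _

/-- Flats whose rank grows by one form a covering pair. -/
theorem Flats.covBy_of_rk_eq {F G : Flats M} (h : F ≤ G) (hr : rk M G.1 = rk M F.1 + 1) : F ⋖ G := by
  refine ⟨lt_of_le_of_ne h (by rintro rfl; omega), fun H hF hG => ?_⟩
  have h1 := Flats.rk_strictMono hF
  have h2 := Flats.rk_strictMono hG
  simp only at h1 h2
  omega

theorem Flats.rk_eq_of_covBy {F G : Flats M} (h : F ⋖ G) : rk M G.1 = rk M F.1 + 1 := by
  have h1 := rk_union_le_of_covBy h ∅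
  have h2 := Flats.rk_strictMono h.lt
  rw [union_empty, union_empty] at h1
  simp only at h2
  omega

end Lattice

/-! ### The rank functions of a covering lattice map -/

section RankFunctions

variable {α β : Type*} {M₁ : Matroid α} {M₂ : Matroid β}

theorem pairSet_subset_iff {p q : Flats M₁ × Flats M₂} : pairSet p ⊆ pairSet q ↔ p ≤ q := by
  constructor
  · intro h
    exact ⟨fun a ha => h (a := Sum.inl ⟨a, p.1.subset_ground ha⟩) ha,
      fun b hb => h (a := Sum.inr ⟨b, p.2.subset_ground hb⟩) hb⟩
  · rintro ⟨h1, h2⟩ (a | b) h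
    · exact h1 h
    · exact h2 h

/-- The flats of `M₁ ⊕ M₂` as subsets of the ground set. -/
def pairEmb (M₁ : Matroid α) (M₂ : Matroid β) : Flats M₁ × Flats M₂ ↪o Set (Ground M₁ M₂) :=
  OrderEmbedding.ofMapLEIff pairSet fun _ _ => pairSet_subset_iff

theorem pairEmb_apply (p : Flats M₁ × Flats M₂) : pairEmb M₁ M₂ p = pairSet p := rfl

theorem pairSet_injective : Function.Injective (pairSet : Flats M₁ × Flats M₂ → _) :=
  (pairEmb M₁ M₂).injective

variable [M₁.Loopless] [M₂.Loopless]

theorem topPair_eq : topPair M₁ M₂ = ⊤ := rfl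

theorem isBounded_pairEmb : IsBounded (pairEmb M₁ M₂) where
  bot := by
    ext (a | b)
    · exact iff_of_false (fun h : a.1 ∈ (∅ : Set α) => h) id
    · exact iff_of_false (fun h : b.1 ∈ (∅ : Set β) => h) id
  top := by
    ext (a | b)
    · exact iff_of_true a.2 trivial
    · exact iff_of_true b.2 trivial

/-- The flat of `M₁ ⊕ M₂` spanned by an element. -/
def flatAt (M₁ : Matroid α) (M₂ : Matroid β) [M₁.Loopless] [M₂.Loopless] :
    Ground M₁ M₂ → Flats M₁ × Flats M₂ :=
  Sum.elim (fun a => (flatCl M₁ {a.1}, ⊥)) fun b => (⊥, flatCl M₂ {b.1})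

theorem isSupport_flatAt : IsSupport (flatAt M₁ M₂) (pairEmb M₁ M₂) := by
  rintro (a | b) p
  · change a.1 ∈ p.1.1 ↔ (flatCl M₁ {a.1}, ⊥) ≤ p
    rw [Prod.le_def]
    simp only [flatCl_le_iff (singleton_subset_iff.2 a.2), singleton_subset_iff, bot_le, and_true]
  · change b.1 ∈ p.2.1 ↔ (⊥, flatCl M₂ {b.1}) ≤ p
    rw [Prod.le_def]
    simp only [flatCl_le_iff (singleton_subset_iff.2 b.2), singleton_subset_iff, bot_le, true_and]

/-- The rank function of `M₁ ⊕ M₂`. -/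
noncomputable def rkTotal (p : Flats M₁ × Flats M₂) : ℕ := rk M₁ p.1.1 + rk M₂ p.2.1

/-- The rank of `f F₁ ∪ F₂`. -/
noncomputable def rkGraph (f : Flats M₁ → Flats M₂) (p : Flats M₁ × Flats M₂) : ℕ :=
  rk M₂ ((f p.1).1 ∪ p.2.1)

/-- The rank functions interpolating between `rkTotal` and `rkGraph f`. -/
noncomputable def rkLevel (f : Flats M₁ → Flats M₂) (t : ℕ) (p : Flats M₁ × Flats M₂) : ℕ :=
  min (rkTotal p) (rkGraph f p + t)

variable [M₁.Finite] [M₂.Finite] {f : Flats M₁ → Flats M₂}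

theorem rkTotal_strictMono : StrictMono (rkTotal : Flats M₁ × Flats M₂ → ℕ) := by
  intro p q h
  rw [Prod.lt_iff] at h
  rcases h with ⟨h1, h2⟩ | ⟨h1, h2⟩
  · exact add_lt_add_of_lt_of_le (Flats.rk_strictMono h1) (rk_mono h2)
  · exact add_lt_add_of_le_of_lt (rk_mono h1) (Flats.rk_strictMono h2)

theorem isRankLike_rkTotal : IsRankLike (flatAt M₁ M₂) (rkTotal : Flats M₁ × Flats M₂ → ℕ) where
  mono := rkTotal_strictMono.monotone
  bot := by
    change rk M₁ ∅ + rk M₂ ∅ = 0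
    rw [rk_empty, rk_empty]
  step b i := by
    rcases i with a | e
    · change rk M₁ (b.1 ⊔ flatCl M₁ {a.1}).1 + rk M₂ (b.2 ⊔ ⊥).1 ≤ _
      rw [sup_bot_eq]
      have := rk_sup_singleton_le b.1 a.1
      unfold rkTotal
      omega
    · change rk M₁ (b.1 ⊔ ⊥).1 + rk M₂ (b.2 ⊔ flatCl M₂ {e.1}).1 ≤ _
      rw [sup_bot_eq]
      have := rk_sup_singleton_le b.2 e.1
      unfold rkTotal
      omega

theorem isRanking_rkTotal : IsRanking (rkTotal : Flats M₁ × Flats M₂ → ℕ) where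
  bot := isRankLike_rkTotal.bot
  covBy p q h := by
    obtain ⟨i, hiq, hip⟩ := exists_of_ssubset ((pairEmb M₁ M₂).strictMono h.lt)
    have hlt := rkTotal_strictMono h.lt
    have hstep := isRankLike_rkTotal.step p i
    rcases h.eq_or_eq (le_sup_left : p ≤ p ⊔ flatAt M₁ M₂ i)
      (sup_le h.le ((isSupport_flatAt i q).1 hiq)) with h' | h'
    · exact absurd ((isSupport_flatAt i p).2 (sup_eq_left.1 h')) hip
    · rw [h'] at hstep
      omega

theorem IsWeakLatticeMap.map_bot (hf : IsWeakLatticeMap f) : f ⊥ = ⊥ := by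
  symm
  apply Flats.eq_of_le_of_rk_le bot_le
  have := hf.rk_le ⊥
  rw [bot_val, rk_empty] at this
  omega

theorem isRankLike_rkGraph (hf : IsCoveringLatticeMap f) :
    IsRankLike (flatAt M₁ M₂) (rkGraph f) where
  mono p q h := rk_mono (union_subset_union (hf.monotone h.1) h.2)
  bot := by
    change rk M₂ ((f ⊥).1 ∪ ∅) = 0
    rw [hf.toIsWeakLatticeMap.map_bot, bot_val, union_empty, rk_empty]
  step b i := by
    rcases i with a | e
    · change rk M₂ ((f (b.1 ⊔ flatCl M₁ {a.1})).1 ∪ (b.2 ⊔ ⊥).1) ≤ rk M₂ ((f b.1).1 ∪ b.2.1) + 1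
      rw [sup_bot_eq]
      rcases b.1.covBy_or_eq_sup_singleton a.1 with h | h
      · rcases hf.covering _ _ h with h' | h'
        · exact rk_union_le_of_covBy h' _
        · rw [h']
          exact Nat.le_succ _
      · rw [h]
        exact Nat.le_succ _
    · change rk M₂ ((f (b.1 ⊔ ⊥)).1 ∪ (b.2 ⊔ flatCl M₂ {e.1}).1) ≤ rk M₂ ((f b.1).1 ∪ b.2.1) + 1
      rw [sup_bot_eq]
      rcases b.2.covBy_or_eq_sup_singleton e.1 with h | h
      · rw [union_comm, union_comm (f b.1).1]
        exact rk_union_le_of_covBy h _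
      · rw [h]
        exact Nat.le_succ _

theorem isRankLike_rkLevel (hf : IsCoveringLatticeMap f) (t : ℕ) :
    IsRankLike (flatAt M₁ M₂) (rkLevel f t) where
  mono p q h := min_le_min (isRankLike_rkTotal.mono h)
    (Nat.add_le_add_right ((isRankLike_rkGraph hf).mono h) t)
  bot := by
    rw [rkLevel, isRankLike_rkTotal.bot]
    exact Nat.zero_min _
  step b i := by
    have h1 := isRankLike_rkTotal.step b i
    have h2 := (isRankLike_rkGraph hf).step b i
    unfold rkLevel
    omega

theorem rkGraph_le_rkTotal (hf : IsWeakLatticeMap f) (p : Flats M₁ × Flats M₂) :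
    rkGraph f p ≤ rkTotal p := by
  have h1 := rk_union_le (M := M₂) (f p.1).1 p.2.1
  have h2 := hf.rk_le p.1
  unfold rkGraph rkTotal
  omega

/-- The difference of the rank functions is monotone. -/
theorem rkTotal_add_rkGraph_le (hf : IsCoveringLatticeMap f) {p q : Flats M₁ × Flats M₂}
    (h : p ≤ q) : rkTotal p + rkGraph f q ≤ rkTotal q + rkGraph f p := by
  induction hn : rkTotal q - rkTotal p using Nat.strong_induction_on generalizing p with
  | _ n ih =>
    rcases h.eq_or_lt with rfl | hlt
    · exact le_rfl
    · obtain ⟨i, hiq, hip⟩ := exists_of_ssubset ((pairEmb M₁ M₂).strictMono hlt)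
      have hp' : p < p ⊔ flatAt M₁ M₂ i :=
        left_lt_sup.2 (mt (isSupport_flatAt i p).2 hip)
      have hq' : p ⊔ flatAt M₁ M₂ i ≤ q := sup_le h ((isSupport_flatAt i q).1 hiq)
      have h1 := rkTotal_strictMono hp'
      have h2 := rkTotal_strictMono.monotone hq'
      have h3 := isRankLike_rkTotal.step p i
      have h4 := (isRankLike_rkGraph hf).step p i
      have h5 := ih _ (by omega) hq' rfl
      omega

theorem rk_ground_union (X : Set β) (hX : X ⊆ M₂.E) : rk M₂ (X ∪ M₂.E) = rk M₂ M₂.E := by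
  rw [union_eq_self_of_subset_left hX]

theorem rkGraph_top : rkGraph f ⊤ = rk M₂ M₂.E := rk_ground_union _ (Flats.subset_ground _)

theorem rkLevel_rk_ground : rkLevel f (rk M₁ M₁.E) = rkTotal := by
  funext p
  have h1 : rk M₁ p.1.1 ≤ rk M₁ M₁.E := rk_mono p.1.subset_ground
  have h2 : rk M₂ p.2.1 ≤ rkGraph f p := rk_mono subset_union_right
  unfold rkLevel rkTotal
  omega

theorem rkLevel_zero (hf : IsWeakLatticeMap f) : rkLevel f 0 = rkGraph f := by
  funext p
  exact min_eq_right (rkGraph_le_rkTotal hf p)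

/-- The function `γ_i(f)` is `-1` on the set where `rkLevel f t` and `rkLevel f (t + 1)` differ, for
`t = rk M₁ - i`. -/
theorem isLowering_rkLevel (hf : IsCoveringLatticeMap f) {t : ℕ} (ht : t + 1 ≤ rk M₁ M₁.E) :
    IsLowering (flatAt M₁ M₂) (rkLevel f (t + 1)) (rkLevel f t)
      {p | rkGraph f p + (t + 1) ≤ rkTotal p} where
  rankLike := isRankLike_rkLevel hf _
  mono := (isRankLike_rkLevel hf _).mono
  upper p q h hp := by
    have := rkTotal_add_rkGraph_le hf h
    simp only [mem_ofPred_eq] at hp ⊢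
    omega
  top_mem := by
    have : rkTotal (⊤ : Flats M₁ × Flats M₂) = rk M₁ M₁.E + rk M₂ M₂.E := rfl
    rw [mem_ofPred_eq, rkGraph_top, this]
    omega
  bot_notMem h := by
    rw [mem_ofPred_eq, isRankLike_rkTotal.bot] at h
    omega
  of_mem p hp := by
    simp only [mem_ofPred_eq] at hp
    unfold rkLevel
    omega
  of_notMem p hp := by
    simp only [mem_ofPred_eq] at hp
    unfold rkLevel
    omega
  strict p F hF h := by
    have := rkTotal_strictMono h
    simp only [mem_ofPred_eq] at hF
    unfold rkLevel
    omega

/-! ### The graph correspondence as the fan of a rank function -/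

theorem rayFun_chi (g : Flats M₁ × Flats M₂ → ℤ) (p : Flats M₁ × Flats M₂) :
    rayFun g (chi (pairSet p)) = g p := by
  have h : ∃ q : Flats M₁ × Flats M₂, chi (pairSet p) = chi (pairSet q) := ⟨p, rfl⟩
  unfold rayFun
  rw [dif_pos h]
  exact congrArg g (pairSet_injective (chi_injective h.choose_spec)).symm

theorem rayFun_neg_chi_univ [Nonempty (Ground M₁ M₂)] (g : Flats M₁ × Flats M₂ → ℤ) :
    rayFun g (-chi univ) = -rayFun g (chi univ) := by
  have h1 : (univ : Set (Ground M₁ M₂)) = pairSet ⊤ := isBounded_pairEmb.top.symm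
  have h2 : ¬ ∃ q : Flats M₁ × Flats M₂, -chi univ = chi (pairSet q) := by
    rintro ⟨q, hq⟩
    have h3 := congrFun hq (Classical.arbitrary _)
    unfold chi at h3
    rw [Pi.neg_apply, if_pos (mem_univ _)] at h3
    split_ifs at h3
  conv_rhs => rw [h1, rayFun_chi]
  unfold rayFun
  rw [dif_neg h2, if_pos rfl, topPair_eq]

noncomputable instance : Fintype (Flats M₁ × Flats M₂) := Fintype.ofFinite _

theorem bergmanProduct_eq : bergmanProduct M₁ M₂ = rankFan (pairEmb M₁ M₂) rkTotal := by
  classical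
  unfold bergmanProduct rankFan chainFan
  rw [finsum_flag isRanking_rkTotal (fun C => flagCones (pairSet '' C) 1), finsum_eq_sum_of_fintype]
  refine Finset.sum_congr rfl fun C _ => ?_
  split_ifs with hC
  · have : chainWeight rkTotal C = 1 := by
      rw [chainWeight, if_pos hC]
      refine Finset.prod_eq_one fun x hx => ?_
      simp only [Finset.mem_filter, Finset.mem_univ, true_and] at hx
      exact pathEta_eq_one (hC.le_of_le rkTotal_strictMono.monotone hx.1 hx.2.1 (by omega))
        fun b hb _ => (rkTotal_strictMono hb).ne'
    rw [this]
    rfl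
  · rw [chainWeight, if_neg hC, flagCones_zero]

theorem graphStep_eq (hf : IsCoveringLatticeMap f) {k : ℕ} (hk : k ≤ rk M₁ M₁.E) :
    graphStep f k = rankFan (pairEmb M₁ M₂) (rkLevel f (rk M₁ M₁.E - k)) := by
  induction k with
  | zero => rw [Nat.sub_zero, rkLevel_rk_ground, graphStep, bergmanProduct_eq]
  | succ k ih =>
    have hne : Nonempty (Ground M₁ M₂) := by
      have : M₁.E.Nonempty := by
        rw [nonempty_iff_ne_empty]
        intro h
        rw [h, rk_empty] at hk
        omega
      exact ⟨Sum.inl ⟨_, this.some_mem⟩⟩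
    obtain ⟨t, ht⟩ : ∃ t, rk M₁ M₁.E = t + (k + 1) := ⟨rk M₁ M₁.E - (k + 1), by omega⟩
    have e1 : rk M₁ M₁.E - k = t + 1 := by omega
    have e2 : rk M₁ M₁.E - (k + 1) = t := by omega
    rw [graphStep, ih (by omega), e1, e2]
    refine weilDivisor_rankFan isBounded_pairEmb isSupport_flatAt
      (isLowering_rkLevel hf (by omega)) (fun p hp => ?_) (fun p hp => ?_) (rayFun_neg_chi_univ _)
    · rw [pairEmb_apply, rayFun_chi, gammaFun, if_neg]
      simp only [mem_ofPred_eq, rkGraph, rkTotal] at hp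
      push_cast
      omega
    · rw [pairEmb_apply, rayFun_chi, gammaFun, if_pos]
      simp only [mem_ofPred_eq, rkGraph, rkTotal] at hp
      push_cast
      omega

theorem graphCorrespondence_eq (hf : IsCoveringLatticeMap f) :
    graphCorrespondence f = rankFan (pairEmb M₁ M₂) (rkGraph f) := by
  rw [graphCorrespondence, graphStep_eq hf le_rfl, Nat.sub_self, rkLevel_zero hf.toIsWeakLatticeMap]

open Classical in
theorem zero_notMem_of_flagCones_apply_ne_zero {ι : Type*} [Finite ι] {C : Set (Set ι)} {w : ℤ}
    {σ : Finset (ι → ℤ)} (h : flagCones C w σ ≠ 0) : (0 : ι → ℤ) ∉ σ := by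
  unfold flagCones at h
  rw [Finsupp.finsetSum_apply] at h
  obtain ⟨τ, hτ, hne⟩ := Finset.exists_ne_zero_of_sum_ne_zero h
  have hτσ : τ = σ := by
    by_contra hne'
    exact hne (by rw [Finsupp.single_apply, if_neg hne'])
  rw [← hτσ]
  rw [Finset.mem_insert, Finset.mem_singleton] at hτ
  rcases hτ with rfl | rfl <;> exact Finset.notMem_erase _ _

theorem isTropicalFan_graphCorrespondence (hf : IsCoveringLatticeMap f) :
    IsTropicalFan (rk M₂ M₂.E) (graphCorrespondence f) := by
  rcases isEmpty_or_nonempty (Ground M₁ M₂) with h | h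
  · -- over the empty ground set, the only cone is the origin
    have hr : rk M₂ M₂.E = 0 := by
      have : M₂.E = ∅ := eq_empty_of_forall_notMem fun b hb => h.elim (Sum.inr ⟨b, hb⟩)
      rw [this, rk_empty]
    rw [hr, graphCorrespondence_eq hf]
    refine ⟨fun σ hσ => ?_, fun τ hτ => absurd hτ (Nat.succ_ne_zero _)⟩
    have hσ' : σ = ∅ := by
      rw [Finsupp.mem_support_iff, rankFan, chainFan, Finsupp.finsetSum_apply] at hσ
      obtain ⟨C, _, hC⟩ := Finset.exists_ne_zero_of_sum_ne_zero hσ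
      exact Finset.eq_empty_of_forall_notMem fun v hv =>
        zero_notMem_of_flagCones_apply_ne_zero hC (Subsingleton.elim v 0 ▸ hv)
    rw [hσ']
    exact ⟨Finset.card_empty, HasDual.isUnimodular fun v hv => absurd hv (Finset.notMem_empty v)⟩
  · rw [graphCorrespondence_eq hf, ← rkGraph_top (f := f)]
    exact isTropicalFan_rankFan isBounded_pairEmb isSupport_flatAt (isRankLike_rkGraph hf)

end RankFunctions

/-! ### The weights of the graph pair -/

section GraphWeights

theorem eta_eq_sum_mob {P : Type*} [PartialOrder P] [Fintype P] [DecidableLE P] (x : P) :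
    eta x = ∑ b with x ≤ b, mob x b := by
  unfold eta mob
  congr!

variable {α β : Type*} {M₁ : Matroid α} {M₂ : Matroid β} {f : Flats M₁ → Flats M₂}
  {p q : Flats M₁ × Flats M₂}

theorem rkGraph_of_le (h : f p.1 ≤ p.2) : rkGraph f p = rk M₂ p.2.1 := by
  rw [rkGraph, union_eq_self_of_subset_left h]

theorem GraphEdge.le [M₁.Finite] (h : GraphEdge f p q) : p ≤ q := ⟨h.2.2.1, h.1.le⟩

theorem le_of_reach [M₁.Finite] (h : Relation.ReflTransGen (GraphEdge f) p q) : p ≤ q := by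
  induction h with
  | refl => exact le_rfl
  | tail _ h ih => exact ih.trans h.le

variable [M₂.Finite]

theorem rkGraph_eq_iff (hp : f p.1 ≤ p.2) (hpq : p ≤ q) :
    rkGraph f q = rkGraph f p ↔ q.2 = p.2 ∧ f q.1 ≤ p.2 := by
  rw [rkGraph_of_le hp]
  constructor
  · intro h
    have h1 : rk M₂ (f q.1 ⊔ q.2).1 = rk M₂ p.2.1 := by rw [sup_val, rk_closure, ← h, rkGraph]
    have h2 : p.2 = f q.1 ⊔ q.2 :=
      Flats.eq_of_le_of_rk_le (hpq.2.trans le_sup_right) h1.le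
    exact ⟨le_antisymm (h2 ▸ le_sup_right) hpq.2, h2 ▸ le_sup_left⟩
  · rintro ⟨h1, h2⟩
    rw [rkGraph, h1, union_eq_self_of_subset_left h2]

variable [M₁.Finite]

/-- The interval `[(X₁, Y₁), (X₂, Y₂)]` meets the level set of `rkGraph f` through `(X₁, Y₁)` in a
copy of `ℱ(X₁, X₂, Y₁)`. -/
theorem edgeEta_eq_pathEta (hf : Monotone f) (hp : f p.1 ≤ p.2) (hpq : p ≤ q) :
    edgeEta f p.1 q.1 p.2 = pathEta (rkGraph f) p q := by
  classical
  let _ : Fintype (Between f p.1 q.1 p.2) := Fintype.ofFinite _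
  let e : Between f p.1 q.1 p.2 ↪o Flats M₁ × Flats M₂ :=
    OrderEmbedding.ofMapLEIff (fun F => (F.1, p.2)) fun F G =>
      ⟨fun h => h.1, fun h => ⟨h, le_rfl⟩⟩
  have he : ∀ (a b : Between f p.1 q.1 p.2) (x : Flats M₁ × Flats M₂),
      e a ≤ x → x ≤ e b → ∃ c, e c = x := by
    intro a b x hax hxb
    exact ⟨⟨x.1, a.2.1.trans hax.1, hxb.1.trans b.2.2.1, (hf hxb.1).trans b.2.2.2⟩,
      Prod.ext rfl (le_antisymm hax.2 hxb.2)⟩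
  rw [edgeEta, dif_pos ⟨hpq.1, hp⟩, eta_eq_sum_mob, pathEta]
  refine Finset.sum_bij (fun b _ => e b) ?_ (fun a _ b _ h => e.injective h) ?_ ?_
  · intro b hb
    have hpb : p ≤ e b := ⟨b.2.1, le_rfl⟩
    simp only [Finset.mem_filter, Finset.mem_univ, true_and]
    exact ⟨hpb, ⟨b.2.2.1, hpq.2⟩, (rkGraph_eq_iff hp hpb).2 ⟨rfl, b.2.2.2⟩⟩
  · intro b hb
    simp only [Finset.mem_filter, Finset.mem_univ, true_and] at hb
    obtain ⟨h1, h2, h3⟩ := hb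
    obtain ⟨h4, h5⟩ := (rkGraph_eq_iff hp h1).1 h3
    exact ⟨⟨b.1, h1.1, h2.1, h5⟩, Finset.mem_filter.2 ⟨Finset.mem_univ _, h1.1⟩,
      Prod.ext rfl h4.symm⟩
  · intro b hb
    exact (mob_orderEmbedding e he _ b (Finset.mem_filter.1 hb).2).symm

/-- A pair outside the graph, `¬ f X₁ ≤ Y₁`, has no edge of nonzero weight into the graph: joining
with `(∅, f X₁)` does not change `rkGraph f` above `(X₁, Y₁)`, so Weisner's theorem applies. -/
theorem map_le_of_pathEta_ne_zero [M₁.Loopless] (hf : Monotone f) (hpq : p ≤ q)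
    (hq : f q.1 ≤ q.2) (h : pathEta (rkGraph f) p q ≠ 0) : f p.1 ≤ p.2 := by
  classical
  by_contra hp
  apply h
  let w : Flats M₁ × Flats M₂ := (⊥, f p.1)
  have hw : ¬ w ≤ p := fun h' => hp h'.2
  have hwq : w ≤ q := ⟨bot_le, (hf hpq.1).trans hq⟩
  have hρ : ∀ b, p ≤ b → rkGraph f (b ⊔ w) = rkGraph f b := by
    intro b hb
    change rk M₂ ((f (b.1 ⊔ ⊥)).1 ∪ (b.2 ⊔ f p.1).1) = rk M₂ ((f b.1).1 ∪ b.2.1)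
    have h1 : (f p.1).1 ⊆ (f b.1).1 := hf hb.1
    rw [sup_bot_eq, sup_val, rk_union_closure, union_comm b.2.1, ← union_assoc,
      union_eq_self_of_subset_right h1]
  refine (Finset.sum_congr ?_ fun _ _ => rfl).trans
    (sum_mob_sup hw fun b => b ≤ q ∧ rkGraph f b = rkGraph f p)
  ext b
  simp only [Finset.mem_filter, Finset.mem_univ, true_and, sup_le_iff]
  constructor
  · rintro ⟨h1, h2, h3⟩
    exact ⟨h1, ⟨h2, hwq⟩, (hρ b h1).trans h3⟩
  · rintro ⟨h1, ⟨h2, -⟩, h3⟩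
    exact ⟨h1, h2, (hρ b h1).symm.trans h3⟩

theorem GraphEdge.rk_eq (h : GraphEdge f p q) : rk M₂ q.2.1 = rk M₂ p.2.1 + 1 :=
  Flats.rk_eq_of_covBy h.1

/-- The pairs on the graph joined by edges of nonzero weight are exactly the steps `→`. -/
theorem graphEdge_of_pathEta_ne_zero (hf : Monotone f) (hpq : p ≤ q) (hp : f p.1 ≤ p.2)
    (hq : f q.1 ≤ q.2) (hr : rkGraph f q = rkGraph f p + 1) (h : pathEta (rkGraph f) p q ≠ 0) :
    GraphEdge f p q := by
  rw [rkGraph_of_le hp, rkGraph_of_le hq] at hr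
  exact ⟨Flats.covBy_of_rk_eq hpq.2 hr, hp, hpq.1, by rwa [edgeEta_eq_pathEta hf hp hpq]⟩

variable [M₁.Loopless] [M₂.Loopless]

theorem map_le_of_reach_top (h : Relation.ReflTransGen (GraphEdge f) p ⊤) : f p.1 ≤ p.2 := by
  rcases h.cases_head with rfl | ⟨q, h, -⟩
  · exact le_top
  · exact h.2.1

/-- Every pair on the graph is reached from the bottom. -/
theorem reach_bot (hf : IsWeakLatticeMap f) (hp : f p.1 ≤ p.2) :
    Relation.ReflTransGen (GraphEdge f) ⊥ p := by
  induction hn : rk M₂ p.2.1 using Nat.strong_induction_on generalizing p with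
  | _ n ih =>
    rcases eq_or_ne p.2 ⊥ with h2 | h2
    · have h1 : p.1 = ⊥ := by
        by_contra h1
        refine hf.nonempty p.1 (fun h => h1 (Subtype.ext h)) ?_
        rw [h2] at hp
        exact congrArg Subtype.val (le_bot_iff.1 hp)
      rw [show p = ⊥ from Prod.ext h1 h2]
    · obtain ⟨Y, hY⟩ : ∃ Y, Y ⋖ p.2 := by
        obtain ⟨Y, -, hY⟩ := exists_le_covBy_of_lt (bot_lt_iff_ne_bot.2 h2)
        exact ⟨Y, hY⟩
      -- a maximal flat below `p.1` mapped below `Y`: its interval in the level set is a point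
      obtain ⟨X, hX⟩ := (Set.toFinite {F : Flats M₁ | F ≤ p.1 ∧ f F ≤ Y}).exists_maximal
        ⟨⊥, bot_le, by rw [hf.map_bot]; exact bot_le⟩
      have hle : (X, Y) ≤ p := ⟨hX.prop.1, hY.le⟩
      have hXY : f (X, Y).1 ≤ (X, Y).2 := hX.prop.2
      have hedge : GraphEdge f (X, Y) p := by
        refine ⟨hY, hXY, hX.prop.1, ?_⟩
        rw [edgeEta_eq_pathEta hf.monotone hXY hle, pathEta_eq_one hle]
        · exact one_ne_zero
        · intro b hb hbp h
          obtain ⟨hb2, hb1⟩ := (rkGraph_eq_iff hXY hb.le).1 h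
          have := hX.eq_of_le ⟨hbp.1, hb1⟩ hb.le.1
          exact hb.ne (Prod.ext this hb2.symm)
      have hr := hedge.rk_eq
      exact (ih _ (by omega) hXY rfl).tail hedge

variable {D : Set (Flats M₁ × Flats M₂)}

theorem pathEta_ne_zero_of_chainWeight_ne_zero (hD : chainWeight (rkGraph f) D ≠ 0)
    (hp : p ∈ D) (hq : q ∈ D) (h : rkGraph f q = rkGraph f p + 1) :
    pathEta (rkGraph f) p q ≠ 0 := by
  classical
  rw [chainWeight, if_pos (isFull_of_chainWeight_ne_zero hD), Finset.prod_ne_zero_iff] at hD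
  exact hD (p, q) (Finset.mem_filter.2 ⟨Finset.mem_univ _, hp, hq, h⟩)

/-- The chains of nonzero weight lie on the graph. -/
theorem map_le_of_chainWeight_ne_zero (hf : IsCoveringLatticeMap f)
    (hD : chainWeight (rkGraph f) D ≠ 0) (hp : p ∈ D) : f p.1 ≤ p.2 := by
  have hfull := isFull_of_chainWeight_ne_zero hD
  have hmono := (isRankLike_rkGraph hf).mono
  induction hn : rkGraph f ⊤ - rkGraph f p using Nat.strong_induction_on generalizing p with
  | _ n ih =>
    rcases (hmono (le_top : p ≤ ⊤)).eq_or_lt with h | h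
    · rw [hfull.inj hp hfull.top_mem h]
      exact le_top
    · obtain ⟨q, hq, hqr⟩ := hfull.surj (rkGraph f p + 1) h
      exact map_le_of_pathEta_ne_zero hf.monotone (hfull.le_of_le hmono hp hq (by omega))
        (ih _ (by omega) hq rfl) (pathEta_ne_zero_of_chainWeight_ne_zero hD hp hq hqr)

/-- The chains of nonzero weight are chains of steps `→`. -/
theorem reach_of_chainWeight_ne_zero (hf : IsCoveringLatticeMap f)
    (hD : chainWeight (rkGraph f) D ≠ 0) (hp : p ∈ D) (hq : q ∈ D)
    (h : rkGraph f p ≤ rkGraph f q) : Relation.ReflTransGen (GraphEdge f) p q := by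
  have hfull := isFull_of_chainWeight_ne_zero hD
  have hmono := (isRankLike_rkGraph hf).mono
  induction hn : rkGraph f q - rkGraph f p generalizing p with
  | zero => rw [hfull.inj hp hq (by omega)]
  | succ n ih =>
    have hq' := hmono (le_top : q ≤ ⊤)
    obtain ⟨x, hx, hxr⟩ := hfull.surj (rkGraph f p + 1) (by omega)
    exact .head (graphEdge_of_pathEta_ne_zero hf.monotone (hfull.le_of_le hmono hp hx (by omega))
      (map_le_of_chainWeight_ne_zero hf hD hp) (map_le_of_chainWeight_ne_zero hf hD hx) hxr
      (pathEta_ne_zero_of_chainWeight_ne_zero hD hp hx hxr)) (ih hx (by omega) (by omega))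

end GraphWeights

/-! ### The graph pair -/

section GraphPair

variable {α β : Type*} {M₁ : Matroid α} {M₂ : Matroid β} [M₁.Finite] [M₂.Finite]
  [M₁.Loopless] [M₂.Loopless] {f : Flats M₁ → Flats M₂} {p q : Flats M₁ × Flats M₂}

instance : Nonempty (Flats M₁ × Flats M₂) := ⟨⊤⟩

/-- The pair of flats represented by a subset of the ground set of `M₁ ⊕ M₂`; a junk value for
subsets not of this form. -/
noncomputable def pairOf (M₁ : Matroid α) (M₂ : Matroid β) [M₁.Loopless] [M₂.Loopless] :
    Set (Ground M₁ M₂) → Flats M₁ × Flats M₂ :=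
  Function.invFun pairSet

theorem pairOf_pairSet (p : Flats M₁ × Flats M₂) : pairOf M₁ M₂ (pairSet p) = p :=
  Function.leftInverse_invFun pairSet_injective p

/-- The pairs lying on a path of steps `→` from the bottom to the top. -/
def graphCarrier (f : Flats M₁ → Flats M₂) : Set (Set (Ground M₁ M₂)) :=
  {S | ∃ p, S = pairSet p ∧ Relation.ReflTransGen (GraphEdge f) ⊥ p ∧
    Relation.ReflTransGen (GraphEdge f) p ⊤}

theorem pairSet_mem_graphCarrier : pairSet p ∈ graphCarrier f ↔
    Relation.ReflTransGen (GraphEdge f) ⊥ p ∧ Relation.ReflTransGen (GraphEdge f) p ⊤ := by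
  constructor
  · rintro ⟨q, hq, h⟩
    rwa [pairSet_injective hq]
  · exact fun h => ⟨p, rfl, h⟩

theorem pairSet_pairOf {S : Set (Ground M₁ M₂)} (hS : S ∈ graphCarrier f) :
    pairSet (pairOf M₁ M₂ S) = S := by
  obtain ⟨p, rfl, -⟩ := hS
  rw [pairOf_pairSet]

/-- Reachability strictly raises the rank of the second component. -/
theorem rk_lt_of_reach (h : Relation.ReflTransGen (GraphEdge f) p q) (hne : p ≠ q) :
    rk M₂ p.2.1 < rk M₂ q.2.1 := by
  rcases h.cases_head with h' | ⟨x, hx, hxq⟩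
  · exact absurd h' hne
  · have h1 := hx.rk_eq
    have h2 : rk M₂ x.2.1 ≤ rk M₂ q.2.1 := rk_mono (le_of_reach hxq).2
    omega

theorem not_graphEdge_of_reach {x : Flats M₁ × Flats M₂}
    (h1 : Relation.ReflTransGen (GraphEdge f) p x) (h2 : Relation.ReflTransGen (GraphEdge f) x q)
    (hp : p ≠ x) (hq : x ≠ q) : ¬ GraphEdge f p q := fun h => by
  have := h.rk_eq
  have := rk_lt_of_reach h1 hp
  have := rk_lt_of_reach h2 hq
  omega

/-- The members of `graphCarrier f`, ordered by reachability (and not by inclusion). -/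
def GraphVertex (f : Flats M₁ → Flats M₂) : Type _ := {S // S ∈ graphCarrier f}

theorem GraphVertex.ext {A B : GraphVertex f} (h : pairOf M₁ M₂ A.1 = pairOf M₁ M₂ B.1) : A = B :=
  Subtype.ext (by rw [← pairSet_pairOf A.2, ← pairSet_pairOf B.2, h])

instance : PartialOrder (GraphVertex f) where
  le A B := Relation.ReflTransGen (GraphEdge f) (pairOf M₁ M₂ A.1) (pairOf M₁ M₂ B.1)
  le_refl _ := .refl
  le_trans _ _ _ := .trans
  le_antisymm _ _ h h' := GraphVertex.ext (le_antisymm (le_of_reach h) (le_of_reach h'))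

theorem GraphVertex.le_iff {A B : GraphVertex f} : A ≤ B ↔
    Relation.ReflTransGen (GraphEdge f) (pairOf M₁ M₂ A.1) (pairOf M₁ M₂ B.1) := Iff.rfl

theorem GraphVertex.covBy_iff {A B : GraphVertex f} :
    A ⋖ B ↔ GraphEdge f (pairOf M₁ M₂ A.1) (pairOf M₁ M₂ B.1) := by
  constructor
  · intro h
    rcases (GraphVertex.le_iff.1 h.le).cases_head with h' | ⟨x, hx, hxB⟩
    · exact absurd (GraphVertex.ext h') h.ne
    · have hx' : pairSet x ∈ graphCarrier f := by
        have hA := A.2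
        have hB := B.2
        rw [← pairSet_pairOf A.2, pairSet_mem_graphCarrier] at hA
        rw [← pairSet_pairOf B.2, pairSet_mem_graphCarrier] at hB
        exact pairSet_mem_graphCarrier.2 ⟨hA.1.tail hx, hxB.trans hB.2⟩
      let X : GraphVertex f := ⟨pairSet x, hx'⟩
      have hX : pairOf M₁ M₂ X.1 = x := pairOf_pairSet x
      have hAX : A ≤ X := by
        rw [GraphVertex.le_iff, hX]
        exact .single hx
      have hXB : X ≤ B := by
        rwa [GraphVertex.le_iff, hX]
      rcases h.eq_or_eq hAX hXB with h' | h'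
      · rw [← h', hX] at hx
        exact absurd hx.rk_eq (by omega)
      · rwa [← h', hX]
  · intro h
    refine ⟨lt_of_le_of_ne (GraphVertex.le_iff.2 (.single h)) ?_, fun X hAX hXB => ?_⟩
    · rintro rfl
      exact absurd h.rk_eq (by omega)
    · exact not_graphEdge_of_reach (GraphVertex.le_iff.1 hAX.le) (GraphVertex.le_iff.1 hXB.le)
        (fun h' => hAX.ne (GraphVertex.ext h')) (fun h' => hXB.ne (GraphVertex.ext h')) h

/-- The pair `(𝒢, ω)` of the graph of `f`: the pairs of flats lying on a path of steps `→` from the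
bottom to the top, ordered by reachability and weighted by `edgeEta f`. -/
noncomputable def graphPair (hf : IsWeakLatticeMap f) : FlagPair (Ground M₁ M₂) where
  carrier := graphCarrier f
  order := inferInstanceAs (PartialOrder (GraphVertex f))
  subset_of_le S T h := by
    rw [← pairSet_pairOf S.2, ← pairSet_pairOf T.2]
    exact pairSet_subset_iff.2 (le_of_reach h)
  empty_mem := by
    rw [← show pairSet ⊥ = (∅ : Set (Ground M₁ M₂)) from isBounded_pairEmb.bot]
    exact pairSet_mem_graphCarrier.2 ⟨.refl, reach_bot hf le_top⟩
  univ_mem := by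
    rw [← show pairSet ⊤ = (univ : Set (Ground M₁ M₂)) from isBounded_pairEmb.top]
    exact pairSet_mem_graphCarrier.2 ⟨reach_bot hf le_top, .refl⟩
  empty_le S := by
    have hS := S.2
    rw [← pairSet_pairOf S.2, pairSet_mem_graphCarrier] at hS
    change Relation.ReflTransGen (GraphEdge f) (pairOf M₁ M₂ ∅) _
    rw [← show pairSet ⊥ = (∅ : Set (Ground M₁ M₂)) from isBounded_pairEmb.bot, pairOf_pairSet]
    exact hS.1
  le_univ S := by
    have hS := S.2
    rw [← pairSet_pairOf S.2, pairSet_mem_graphCarrier] at hS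
    change Relation.ReflTransGen (GraphEdge f) _ (pairOf M₁ M₂ univ)
    rw [← show pairSet ⊤ = (univ : Set (Ground M₁ M₂)) from isBounded_pairEmb.top, pairOf_pairSet]
    exact hS.2
  ranked := ⟨fun S => rk M₂ (pairOf M₁ M₂ S.1).2.1, fun S T h =>
    ((GraphVertex.covBy_iff (A := S) (B := T)).1 h).rk_eq⟩
  weight S T := edgeEta f (pairOf M₁ M₂ S).1 (pairOf M₁ M₂ T).1 (pairOf M₁ M₂ S).2

theorem graphPair_covBy_iff {hf : IsWeakLatticeMap f} {A B : (graphPair hf).Vertex} :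
    A ⋖ B ↔ GraphEdge f (pairOf M₁ M₂ A.1) (pairOf M₁ M₂ B.1) :=
  GraphVertex.covBy_iff (A := A) (B := B)

theorem graphPair_le_iff {hf : IsWeakLatticeMap f} {A B : (graphPair hf).Vertex} :
    A ≤ B ↔ Relation.ReflTransGen (GraphEdge f) (pairOf M₁ M₂ A.1) (pairOf M₁ M₂ B.1) := Iff.rfl

theorem reduced_graphPair (hf : IsWeakLatticeMap f) : (graphPair hf).Reduced := by
  rintro S T ⟨A, B, rfl, rfl, h⟩
  exact (graphPair_covBy_iff.1 h).2.2.2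

theorem edge_graphPair_iff (hf : IsWeakLatticeMap f) {S T : Set (Ground M₁ M₂)} :
    (graphPair hf).Edge S T ↔ ∃ p q : Flats M₁ × Flats M₂, S = pairSet p ∧ T = pairSet q ∧
      GraphEdge f p q ∧ Relation.ReflTransGen (GraphEdge f) q ⊤ := by
  constructor
  · rintro ⟨A, B, rfl, rfl, h⟩
    have hB := B.2
    rw [← pairSet_pairOf B.2] at hB
    exact ⟨_, _, (pairSet_pairOf A.2).symm, (pairSet_pairOf B.2).symm,
      graphPair_covBy_iff.1 h, (pairSet_mem_graphCarrier.1 hB).2⟩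
  · rintro ⟨p, q, rfl, rfl, h, hq⟩
    have hp := reach_bot hf h.2.1
    refine ⟨⟨pairSet p, pairSet_mem_graphCarrier.2 ⟨hp, .head h hq⟩⟩,
      ⟨pairSet q, pairSet_mem_graphCarrier.2 ⟨hp.tail h, hq⟩⟩, rfl, rfl,
      graphPair_covBy_iff.2 ?_⟩
    change GraphEdge f (pairOf M₁ M₂ (pairSet p)) (pairOf M₁ M₂ (pairSet q))
    rwa [pairOf_pairSet, pairOf_pairSet]

theorem graphPair_weight (hf : IsWeakLatticeMap f) (p q : Flats M₁ × Flats M₂) :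
    (graphPair hf).weight (pairSet p) (pairSet q) = edgeEta f p.1 q.1 p.2 := by
  change edgeEta f (pairOf M₁ M₂ (pairSet p)).1 (pairOf M₁ M₂ (pairSet q)).1
    (pairOf M₁ M₂ (pairSet p)).2 = _
  rw [pairOf_pairSet, pairOf_pairSet]

/-- The pair of flats of a vertex of the graph pair. -/
noncomputable def vertexPair (hf : IsWeakLatticeMap f) (A : (graphPair hf).Vertex) :
    Flats M₁ × Flats M₂ := pairOf M₁ M₂ A.1

theorem pairSet_vertexPair (hf : IsWeakLatticeMap f) (A : (graphPair hf).Vertex) :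
    pairSet (vertexPair hf A) = A.1 := pairSet_pairOf A.2

theorem vertexPair_injective (hf : IsWeakLatticeMap f) : Function.Injective (vertexPair hf) :=
  fun A B h => Subtype.ext (by
    change A.1 = B.1
    rw [← pairSet_vertexPair hf A, ← pairSet_vertexPair hf B, h])

theorem exists_vertexPair_eq_iff (hf : IsWeakLatticeMap f) : (∃ A, vertexPair hf A = p) ↔
    Relation.ReflTransGen (GraphEdge f) ⊥ p ∧ Relation.ReflTransGen (GraphEdge f) p ⊤ := by
  rw [← pairSet_mem_graphCarrier]
  constructor
  · rintro ⟨A, rfl⟩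
    rw [pairSet_vertexPair]
    exact A.2
  · exact fun h => ⟨⟨pairSet p, h⟩, pairOf_pairSet p⟩

theorem vertexPair_bot (hf : IsWeakLatticeMap f) : vertexPair hf ⊥ = ⊥ := by
  apply pairSet_injective
  rw [pairSet_vertexPair, FlagPair.val_bot]
  exact isBounded_pairEmb.bot.symm

theorem vertexPair_top (hf : IsWeakLatticeMap f) : vertexPair hf ⊤ = ⊤ := by
  apply pairSet_injective
  rw [pairSet_vertexPair, FlagPair.val_top]
  exact isBounded_pairEmb.top.symm

theorem map_le_vertexPair (hf : IsWeakLatticeMap f) (A : (graphPair hf).Vertex) :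
    f (vertexPair hf A).1 ≤ (vertexPair hf A).2 :=
  map_le_of_reach_top ((exists_vertexPair_eq_iff hf).1 ⟨A, rfl⟩).2

theorem isRanking_rkGraph_vertexPair (hf : IsWeakLatticeMap f) :
    IsRanking fun A => rkGraph f (vertexPair hf A) where
  bot := by
    rw [rkGraph_of_le (map_le_vertexPair hf _), vertexPair_bot]
    exact rk_empty
  covBy A B h := by
    rw [rkGraph_of_le (map_le_vertexPair hf _), rkGraph_of_le (map_le_vertexPair hf _)]
    exact (graphPair_covBy_iff.1 h).rk_eq

theorem isFull_image_vertexPair {hf : IsWeakLatticeMap f} {C : Set (graphPair hf).Vertex}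
    (hC : IsFull (fun A => rkGraph f (vertexPair hf A)) C) :
    IsFull (rkGraph f) (vertexPair hf '' C) where
  chain := by
    rintro _ ⟨A, hA, rfl⟩ _ ⟨B, hB, rfl⟩ _
    exact (hC.chain.total hA hB).imp (fun h => le_of_reach (graphPair_le_iff.1 h))
      fun h => le_of_reach (graphPair_le_iff.1 h)
  bot_mem := ⟨⊥, hC.bot_mem, vertexPair_bot hf⟩
  top_mem := ⟨⊤, hC.top_mem, vertexPair_top hf⟩
  inj := by
    rintro _ ⟨A, hA, rfl⟩ _ ⟨B, hB, rfl⟩ h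
    rw [hC.inj hA hB h]
  surj j hj := by
    rw [← vertexPair_top hf] at hj
    obtain ⟨A, hA, h⟩ := hC.surj j hj
    exact ⟨_, ⟨A, hA, rfl⟩, h⟩

theorem isFull_of_chainWeight_image_ne_zero (hf : IsCoveringLatticeMap f)
    {C : Set (graphPair hf.toIsWeakLatticeMap).Vertex}
    (h : chainWeight (rkGraph f) (vertexPair hf.toIsWeakLatticeMap '' C) ≠ 0) :
    IsFull (fun A => rkGraph f (vertexPair hf.toIsWeakLatticeMap A)) C := by
  have hfull := isFull_of_chainWeight_ne_zero h
  have hinj := vertexPair_injective hf.toIsWeakLatticeMap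
  refine ⟨?_, ?_, ?_, ?_, ?_⟩
  · intro A hA B hB _
    exact (le_total (rkGraph f (vertexPair _ A)) (rkGraph f (vertexPair _ B))).imp
      (fun h' => reach_of_chainWeight_ne_zero hf h ⟨A, hA, rfl⟩ ⟨B, hB, rfl⟩ h')
      fun h' => reach_of_chainWeight_ne_zero hf h ⟨B, hB, rfl⟩ ⟨A, hA, rfl⟩ h'
  · obtain ⟨A, hA, h'⟩ := hfull.bot_mem
    rw [← vertexPair_bot hf.toIsWeakLatticeMap] at h'
    rwa [← hinj h']
  · obtain ⟨A, hA, h'⟩ := hfull.top_mem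
    rw [← vertexPair_top hf.toIsWeakLatticeMap] at h'
    rwa [← hinj h']
  · intro A hA B hB h'
    exact hinj (hfull.inj ⟨A, hA, rfl⟩ ⟨B, hB, rfl⟩ h')
  · intro j hj
    rw [vertexPair_top] at hj
    obtain ⟨_, ⟨A, hA, rfl⟩, h'⟩ := hfull.surj j hj
    exact ⟨A, hA, h'⟩

open Classical in
/-- The maximal flags of the graph pair are the full chains for `rkGraph f` consisting of vertices, and
all other chains have weight zero. -/
theorem flagFan_graphPair (hf : IsCoveringLatticeMap f) :
    (graphPair hf.toIsWeakLatticeMap).flagFan = rankFan (pairEmb M₁ M₂) (rkGraph f) := by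
  let _ : Fintype (graphPair hf.toIsWeakLatticeMap).Vertex := Fintype.ofFinite _
  let e := vertexPair hf.toIsWeakLatticeMap
  have he : Function.Injective e := vertexPair_injective _
  have hρ := isRanking_rkGraph_vertexPair hf.toIsWeakLatticeMap
  rw [FlagPair.flagFan_eq_finsum_isFull hρ, finsum_eq_sum_of_fintype, rankFan, chainFan]
  refine Finset.sum_of_injOn (fun C => e '' C) he.image_injective.injOn
    (fun _ _ => Finset.mem_coe.2 (Finset.mem_univ _)) (fun D _ hD => ?_) fun C _ => ?_
  · have h0 : chainWeight (rkGraph f) D = 0 := by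
      by_contra h0
      have hfull := isFull_of_chainWeight_ne_zero h0
      have hmono := (isRankLike_rkGraph hf).mono
      apply hD
      refine ⟨e ⁻¹' D, Finset.mem_coe.2 (Finset.mem_univ _), image_preimage_eq_of_subset ?_⟩
      intro p hp
      exact (exists_vertexPair_eq_iff _).2
        ⟨reach_of_chainWeight_ne_zero hf h0 hfull.bot_mem hp (hmono bot_le),
          reach_of_chainWeight_ne_zero hf h0 hp hfull.top_mem (hmono le_top)⟩
    rw [h0, flagCones_zero]
  · have himage : pairEmb M₁ M₂ '' (e '' C) = 
        (fun A : (graphPair hf.toIsWeakLatticeMap).Vertex => A.1) '' C := by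
      rw [image_image]
      exact image_congr fun A _ => pairSet_vertexPair _ A
    change _ = flagCones (pairEmb M₁ M₂ '' (e '' C)) (chainWeight (rkGraph f) (e '' C))
    rw [himage]
    split_ifs with hC
    · congr 1
      rw [chainWeight, if_pos (isFull_image_vertexPair hC)]
      refine Finset.prod_bij (fun x _ => (e x.1, e x.2)) ?_ ?_ ?_ ?_
      · intro x hx
        simp only [Finset.mem_filter, Finset.mem_univ, true_and] at hx ⊢
        exact ⟨⟨_, hx.1, rfl⟩, ⟨_, hx.2.1, rfl⟩, hρ.covBy _ _ hx.2.2⟩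
      · intro x _ y _ h
        rw [Prod.mk.injEq] at h
        exact Prod.ext (he h.1) (he h.2)
      · rintro ⟨_, _⟩ hx
        simp only [Finset.mem_filter, Finset.mem_univ, true_and] at hx
        obtain ⟨⟨A, hA, rfl⟩, ⟨B, hB, rfl⟩, h⟩ := hx
        refine ⟨(A, B), ?_, rfl⟩
        simp only [Finset.mem_filter, Finset.mem_univ, true_and]
        exact ⟨hA, hB, (hC.covBy_iff hρ hA hB).2 h⟩
      · intro x hx
        simp only [Finset.mem_filter, Finset.mem_univ, true_and] at hx
        exact edgeEta_eq_pathEta hf.monotone (map_le_vertexPair _ x.1)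
          (le_of_reach (graphPair_le_iff.1 hx.2.2.le))
    · have h0 : chainWeight (rkGraph f) (e '' C) = 0 := by
        by_contra h0
        exact hC (isFull_of_chainWeight_image_ne_zero hf h0)
      rw [h0, flagCones_zero]

end GraphPair

end TropGraph

theorem mainTheorem3 {α β : Type*} (M₁ : Matroid α) (M₂ : Matroid β) [M₁.Finite] [M₂.Finite]
    [M₁.Loopless] [M₂.Loopless] (f : Flats M₁ → Flats M₂) (hf : IsCoveringLatticeMap f) :
    IsTropicalFan (rk M₂ M₂.E) (graphCorrespondence f) ∧
    (∃ P : FlagPair (Ground M₁ M₂), P.Reduced ∧ graphCorrespondence f = P.flagFan ∧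
      ∀ p q : Flats M₁ × Flats M₂, P.Edge (pairSet p) (pairSet q) →
        P.weight (pairSet p) (pairSet q) = edgeEta f p.1 q.1 p.2) ∧
    ∀ P : FlagPair (Ground M₁ M₂), P.Reduced → graphCorrespondence f = P.flagFan →
      (∀ S T : Set (Ground M₁ M₂), P.Edge S T ↔
        ∃ p q : Flats M₁ × Flats M₂, S = pairSet p ∧ T = pairSet q ∧
          GraphEdge f p q ∧ Relation.ReflTransGen (GraphEdge f) q (topPair M₁ M₂)) ∧
      ∃ c : Set (Ground M₁ M₂) → ℚ, c ∅ = 1 ∧ c Set.univ = 1 ∧ (∀ S ∈ P.carrier, c S ≠ 0) ∧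
        ∀ p q : Flats M₁ × Flats M₂, P.Edge (pairSet p) (pairSet q) →
          c (pairSet p) * P.weight (pairSet p) (pairSet q) =
            edgeEta f p.1 q.1 p.2 * c (pairSet q) := by
  have hw := hf.toIsWeakLatticeMap
  have hfan : graphCorrespondence f = (graphPair hw).flagFan :=
    (graphCorrespondence_eq hf).trans (flagFan_graphPair hf).symm
  refine ⟨isTropicalFan_graphCorrespondence hf, ⟨graphPair hw, reduced_graphPair hw, hfan,
    fun p q _ => graphPair_weight hw p q⟩, fun P hP h => ?_⟩
  simp only [topPair_eq, ← edge_graphPair_iff hw]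
  rcases isEmpty_or_nonempty (Ground M₁ M₂) with hE | hE
  · -- the only subset of the ground set is `∅`, so neither pair has an edge
    have hno : ∀ (Q : FlagPair (Ground M₁ M₂)) S T, ¬ Q.Edge S T := by
      rintro Q S T ⟨A, B, -, -, hAB⟩
      exact hAB.ne (Subtype.ext (Subsingleton.elim A.1 B.1))
    exact ⟨fun S T => iff_of_false (hno _ _ _) (hno _ _ _), fun _ => 1, rfl, rfl,
      fun _ _ => one_ne_zero, fun p q hpq => absurd hpq (hno _ _ _)⟩
  · have hPG := h.symm.trans hfan
    refine ⟨fun S T => ⟨FlagPair.edge_of_flagFan_eq hP hPG,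
      FlagPair.edge_of_flagFan_eq (reduced_graphPair hw) hPG.symm⟩, ?_⟩
    obtain ⟨c, h0, h1, hc, hcw⟩ := FlagPair.exists_rescaling hP (reduced_graphPair hw) hPG
    refine ⟨c, h0, h1, hc, fun p q hpq => ?_⟩
    rw [hcw _ _ hpq, graphPair_weight]
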